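/- Let $I,J\subseteq\mathbb R$ be nonempty open intervals, $U=I\times J$, $x_0\in I$, and let $f,g,h:U\to\mathbb C$ be real-analytic functions of $(x,t)$ with $f$ and $g$ nowhere zero. Consider $$i\psi_t+f\,\psi_{xx}+g\,|\psi|^2\psi+h\,\psi=0 \qquad (*)$$ and the associated system for independent functions $u,v$: $$iu_t+fu_{xx}+gu^2v+hu=0,\qquad -iv_t+\bar f v_{xx}+\bar g\,uv^2+\bar h v=0 .$$ *Painlevé (WTC) test.* For an open $W\subseteq U$ and a real-analytic $\Phi:W\to\mathbb R$ that has a zero in $W$ and satisfies $\Phi_x\neq0$ on $W$, a Painlevé expansion with leading orders $\alpha,\beta$ is a pair of formal series $u=\sum_{j\ge0}u_j\Phi^{\alpha+j}$, $v=\sum_{j\ge0}v_j\Phi^{\beta+j}$ with $u_j,v_j:W\to\mathbb C$ analytic and $u_0,v_0$ nowhere zero, such that after termwise substitution into the system the coefficient of every power of $\Phi$ vanishes identically on $W$. Equation $(*)$ passes the test if there are negative integers $\alpha,\beta$ and three coefficient slots (each of the form "$u_j$" or "$v_j$", of level $j$) such that for all $W,\Phi$ as above: (a) for arbitrary analytic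 functions $a_1,a_2,a_3:W\to\mathbb C$ (nowhere zero for slots of level $0$) there is a Painlevé expansion with leading orders $\alpha,\beta$ whose coefficients in the three slots are $a_1,a_2,a_3$; (b) for every $N$, two Painlevé expansions with leading orders $\alpha,\beta$ and the same $\Phi$ that agree in the slots of level $\le N$ agree in all coefficients of level $\le N$. (Thus, with $\Phi$, the expansion contains the four arbitrary functions required by the Cauchy–Kovalevskaya theorem.) Write $h=h_1+ih_2$ with $h_1,h_2$ real, and $\int F\,dx=\int_{x_0}^xF(s,t)\,ds$. Then: 1. Equation $(*)$ passes the Painlevé test if and only if $f$ and $g$ are real-valued on $U$ and there are real functions $K(t),\gamma(t),\delta_0(t),\delta_1(t)$ on $J$ such that on $U$ $$f g^2=K(t),\qquad h_2=\frac{g_t}{g}+\gamma(t),$$ $$h_1=\frac{\tau_0}{2}\Big(\int g\,dx\Big)^2+\int g\Big(\int\tau_1\,dx\Big)dx+\frac K2\Big(\frac{g_{xx}}{g^3}-\frac32\frac{g_x^2}{g^4}\Big)+\delta_0\int g\,dx+\delta_1,$$ where $$\tau_0=\frac{2\gamma^2}{K}+\frac{(\gamma K)_t}{K^2}+\frac{(\ln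 |K|)_{tt}}{2K},\qquad \tau_1=-\frac12\Big(\frac{g_t}{K}\Big)_t .$$ 2. If $f$ and $g$ are both purely imaginary on $U$, then $(*)$ does not pass the Painlevé test. 3. If $f=f(t)$ and $g=g(t)$ do not depend on $x$, then $(*)$ passes the Painlevé test if and only if $f$ and $g$ are real and there are real functions $\beta(t),H_1(t),H_2(t)$ on $J$ such that on $U$ one has $h_2=\beta(t)$ and $$h_1=\frac1{4f}\Big\{4\beta^2+2\dot\beta+2\beta\frac{\dot f}{f}-4\beta\frac{\dot g}{g}+(\ln |f|)_{tt}+g\Big(\frac1g\Big)_{tt}-(\ln |f|)_t(\ln |g|)_t\Big\}x^2+H_1(t)x+H_2(t).$$ -/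

import Mathlib

open scoped ComplexConjugate

noncomputable section

namespace VCNLS

/-- Partial derivative in the first variable `x` of a function of `(x, t)`. -/
def Dx {E : Type*} [NormedAddCommGroup E] [NormedSpace ℝ E] (F : ℝ × ℝ → E) : ℝ × ℝ → E :=
  fun z => deriv (fun x => F (x, z.2)) z.1

/-- Partial derivative in the second variable `t` of a function of `(x, t)`. -/
def Dt {E : Type*} [NormedAddCommGroup E] [NormedSpace ℝ E] (F : ℝ × ℝ → E) : ℝ × ℝ → E :=
  fun z => deriv (fun t => F (z.1, t)) z.2

/-! ### Formal Laurent series in powers of a function `Φ`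

A two-sided sequence `c : ℤ → (ℝ × ℝ → ℂ)` stands for the formal series `∑ n, c n * Φ ^ n`. -/

/-- The coefficient of `Φ ^ n` in `∑ j : ℕ, u j * Φ ^ (α + j)`. -/
def laurentCoeff (α : ℤ) (u : ℕ → ℝ × ℝ → ℂ) (n : ℤ) : ℝ × ℝ → ℂ :=
  if α ≤ n then u (n - α).toNat else 0

/-- Termwise `x`-derivative: since `∂ₓ (c n * Φ ^ n) = ∂ₓ (c n) * Φ ^ n + n * c n * Φₓ * Φ ^ (n - 1)`,
the coefficient of `Φ ^ n` in the derivative is `∂ₓ (c n) + (n + 1) * Φₓ * c (n + 1)`. -/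
def seriesDx (Φ : ℝ × ℝ → ℝ) (c : ℤ → ℝ × ℝ → ℂ) (n : ℤ) : ℝ × ℝ → ℂ :=
  fun z => Dx (c n) z + ((n : ℂ) + 1) * ((Dx Φ z : ℝ) : ℂ) * c (n + 1) z

/-- Termwise `t`-derivative. -/
def seriesDt (Φ : ℝ × ℝ → ℝ) (c : ℤ → ℝ × ℝ → ℂ) (n : ℤ) : ℝ × ℝ → ℂ :=
  fun z => Dt (c n) z + ((n : ℂ) + 1) * ((Dt Φ z : ℝ) : ℂ) * c (n + 1) z

/-- The Cauchy product `∑_{a + b + c = k} u_a u_b v_c`. -/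
def cubicConv (u v : ℕ → ℝ × ℝ → ℂ) (k : ℕ) : ℝ × ℝ → ℂ :=
  fun z => ∑ p ∈ Finset.HasAntidiagonal.antidiagonal k, ∑ q ∈ Finset.HasAntidiagonal.antidiagonal p.1,
    u q.1 z * u q.2 z * v p.2 z

/-- The coefficient of `Φ ^ n` in `s * u_t + f * u_xx + g * u ^ 2 * v + h * u` after the substitution
`u = ∑ j, u j * Φ ^ (α + j)`, `v = ∑ j, v j * Φ ^ (β + j)`. -/
def residual (s : ℂ) (f g h : ℝ × ℝ → ℂ) (Φ : ℝ × ℝ → ℝ)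
    (α : ℤ) (u : ℕ → ℝ × ℝ → ℂ) (β : ℤ) (v : ℕ → ℝ × ℝ → ℂ) (n : ℤ) : ℝ × ℝ → ℂ :=
  fun z => s * seriesDt Φ (laurentCoeff α u) n z
    + f z * seriesDx Φ (seriesDx Φ (laurentCoeff α u)) n z
    + g z * laurentCoeff (2 * α + β) (cubicConv u v) n z
    + h z * laurentCoeff α u n z

/-- `Φ` is an admissible singularity function on the open set `W`: real analytic, with
`{Φ = 0}` a nonempty curve in `W`, and non-characteristic, i.e. `Φₓ ≠ 0`. -/
structure IsSingularManifold (W : Set (ℝ × ℝ)) (Φ : ℝ × ℝ → ℝ) : Prop where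
  analytic : AnalyticOnNhd ℝ Φ W
  exists_zero : ∃ z ∈ W, Φ z = 0
  nonchar : ∀ z ∈ W, Dx Φ z ≠ 0

/-- `u = ∑ u_j Φ^(α+j)`, `v = ∑ v_j Φ^(β+j)` is a Painlevé expansion on `W`: the coefficients are
analytic, `u_0, v_0 ≠ 0`, and all coefficients of powers of `Φ` vanish after substitution into
`i u_t + f u_xx + g u² v + h u = 0`, `-i v_t + f̄ v_xx + ḡ u v² + h̄ v = 0`
(`u` and `v` are independent functions). -/
structure IsPainleveExpansion (f g h : ℝ × ℝ → ℂ) (W : Set (ℝ × ℝ)) (Φ : ℝ × ℝ → ℝ)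
    (α β : ℤ) (u v : ℕ → ℝ × ℝ → ℂ) : Prop where
  analytic_u : ∀ j, AnalyticOnNhd ℝ (u j) W
  analytic_v : ∀ j, AnalyticOnNhd ℝ (v j) W
  u_zero_ne : ∀ z ∈ W, u 0 z ≠ 0
  v_zero_ne : ∀ z ∈ W, v 0 z ≠ 0
  eq_u : ∀ n : ℤ, ∀ z ∈ W, residual Complex.I f g h Φ α u β v n z = 0
  eq_v : ∀ n : ℤ, ∀ z ∈ W,
    residual (-Complex.I) (fun w => conj (f w)) (fun w => conj (g w)) (fun w => conj (h w))
      Φ β v α u n z = 0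

/-- The level `j` of a coefficient slot: `Sum.inl j` is the slot of `u_j`, `Sum.inr j` that
of `v_j`, so that `Sum.elim u v s` is the coefficient in the slot `s`. -/
def slotLevel (s : ℕ ⊕ ℕ) : ℕ := Sum.elim id id s

/-- The equation `i ψ_t + f ψ_xx + g |ψ|² ψ + h ψ = 0` on `U` passes the Painlevé (WTC) test.

The system for `(u, v)` consists of two equations of second order in `x`, so by the
Cauchy–Kovalevskaya theorem its general solution contains four arbitrary functions. One of them is
`Φ`; the test asks for three slots among the expansion coefficients (the resonances other than the
one belonging to `Φ`) that carry the other three: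
* for every non-characteristic `Φ`, arbitrary analytic functions can be prescribed in the three
  slots (nowhere zero ones at level `0`, as `u_0, v_0 ≠ 0`);
* up to each level `N`, the expansion is determined by `Φ` and by the functions prescribed in the
  slots of level at most `N`.
-/
def PassesPainleveTest (U : Set (ℝ × ℝ)) (f g h : ℝ × ℝ → ℂ) : Prop :=
  ∃ α β : ℤ, α < 0 ∧ β < 0 ∧ ∃ slot : Fin 3 → ℕ ⊕ ℕ,
    ∀ (W : Set (ℝ × ℝ)) (Φ : ℝ × ℝ → ℝ), IsOpen W → W ⊆ U → IsSingularManifold W Φ →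
      (∀ a : Fin 3 → ℝ × ℝ → ℂ, (∀ k, AnalyticOnNhd ℝ (a k) W) →
        (∀ k, slotLevel (slot k) = 0 → ∀ z ∈ W, a k z ≠ 0) →
        ∃ u v : ℕ → ℝ × ℝ → ℂ, IsPainleveExpansion f g h W Φ α β u v ∧
          ∀ k, ∀ z ∈ W, Sum.elim u v (slot k) z = a k z) ∧
      (∀ u v u' v' : ℕ → ℝ × ℝ → ℂ, IsPainleveExpansion f g h W Φ α β u v →
        IsPainleveExpansion f g h W Φ α β u' v' → ∀ N : ℕ,
        (∀ k, slotLevel (slot k) ≤ N → ∀ z ∈ W,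
          Sum.elim u v (slot k) z = Sum.elim u' v' (slot k) z) →
        ∀ j ≤ N, ∀ z ∈ W, u j z = u' j z ∧ v j z = v' j z)

/-! ### The conditions on the coefficients -/

/-- The integral in `x` from the base point `x₀`, at fixed `t`. -/
def intX (x₀ : ℝ) (F : ℝ × ℝ → ℝ) : ℝ × ℝ → ℝ :=
  fun z => ∫ s in x₀..z.1, F (s, z.2)

/-- `τ₀ = 2γ²/K + (γK)_t/K² + (ln K)_tt/(2K)`. The logarithm enters only through its derivative
`K_t/K`, so that `K` may be negative. -/
def tau0 (K γ : ℝ → ℝ) (t : ℝ) : ℝ :=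
  2 * γ t ^ 2 / K t + deriv (fun s => γ s * K s) t / K t ^ 2 + deriv (logDeriv K) t / (2 * K t)

/-- `τ₁ = -(1/2) (g_t/K)_t`. -/
def tau1 (K : ℝ → ℝ) (g : ℝ × ℝ → ℝ) : ℝ × ℝ → ℝ :=
  fun z => -(1 / 2) * Dt (fun w => Dt g w / K w.2) z

/-- The real part of the potential:
`(τ₀/2)(∫g)² + ∫ g (∫τ₁) + (K/2)(g_xx/g³ - (3/2) g_x²/g⁴) + δ₀ ∫g + δ₁`. -/
def potential (x₀ : ℝ) (g : ℝ × ℝ → ℝ) (K γ δ₀ δ₁ : ℝ → ℝ) : ℝ × ℝ → ℝ :=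
  fun z => tau0 K γ z.2 / 2 * intX x₀ g z ^ 2
    + intX x₀ (fun w => g w * intX x₀ (tau1 K g) w) z
    + K z.2 / 2 * (Dx (Dx g) z / g z ^ 3 - 3 / 2 * (Dx g z ^ 2 / g z ^ 4))
    + δ₀ z.2 * intX x₀ g z + δ₁ z.2

/-- `(1/(4f)) {4β² + 2β_t + 2β f_t/f - 4β g_t/g + (ln f)_tt + g (1/g)_tt - (ln f)_t (ln g)_t}`. -/
def quadCoeff (f g β : ℝ → ℝ) (t : ℝ) : ℝ :=
  1 / (4 * f t) * (4 * β t ^ 2 + 2 * deriv β t + 2 * β t * (deriv f t / f t)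
    - 4 * β t * (deriv g t / g t) + deriv (logDeriv f) t
    + g t * deriv (deriv (fun s => 1 / g s)) t - logDeriv f t * logDeriv g t)

end VCNLS

end

noncomputable section

/-! ### Partial derivatives, and the differential algebra of analytic functions on an open set. -/

namespace VCNLS

open TopologicalSpace Topology

section AnalyticCalculus

variable {E : Type*} [NormedAddCommGroup E] [NormedSpace ℝ E] {F : ℝ × ℝ → E} {z : ℝ × ℝ}

/-! On an open `W` the test becomes algebra in the ℂ-algebra `An W` of analytic functions with its
commuting derivations `dx`, `dt`. Balancing `u_xx` against `u²v` forces both leading orders to be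
`-1` and `g u₀ v₀ = -2 f Φₓ²`. Put `p = u/u₀`, `q = v/v₀`, and replace `∂ₓ`, `∂ₜ` by the commuting
derivations `D = Φₓ⁻¹ ∂ₓ` and `T = ∂ₜ - Φₜ D`. The system becomes `p_yy + M p_y + a p_t + C p = 2 p²
q` and its mirror image with coefficients `M', a', C'`. At level `j` the pair `(p_j, q_j)` is acted
on by the symmetric matrix with diagonal entries `(j-1)(j-2)-4` and off-diagonal entries `-2`, of
determinant `(j+1) j (j-3) (j-4)`. Free functions thus enter through `Φ` (`j = -1`), `u₀`, and one
coefficient at each of the levels 3 and 4, and the recursion can be solved as soon as two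
compatibility conditions `obstr3 = 0`, `obstr4 = 0` hold (`exists_recursive_solution`,
`exists_solution_of_obstr`, `normalRes_unique`).

Necessity is tested on curves `Φ = x - x₀ + q(t)`. The scaling `(u, v) ↦ (c u, c⁻¹ v)` shows that a
slot of level 0 is needed, so `u₀` can be prescribed (`exists_formalSolution`). Comparing `u₀ = 1`
with `u₀ = eᵗ` in `obstr3`, once for `Φₜ = 0` and once for `Φₜ = 1`, gives `(a + a')² = 0` with `a =
i/f`, `a' = -i/f̄`; hence `f` is real, and so is `g` by the leading-order relation
(`coeff_eq_of_formalSolutions`). Where `Φₜ = 0`, `obstr4` is affine in `Φₜₜ` with slope proportional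
to `(f g²)ₓ`, so `f g² = K(t)` (`eval_deriv_eq_zero_of_formalSolutions`).

Once `f g² = K(t)`, the choice of `Φ` and `u₀` survives only in powers of `θ = g/Φₓ`: `obstr3` is
`2iθ²/K` times `D (h₂ - g_t/g)`, and when this vanishes `2 obstr4` is `θ⁴` times an expression in
the coefficients alone (`obstr3_eq_frame`, `obstr4_eq_frame`). The two resulting conditions are
therefore necessary and sufficient. The second is a second-order equation for `h₁` in the variable
`∫ g dx`; two quadratures at fixed `t` give the stated formula, with `δ₀, δ₁` as constants of
integration (`exists_potential_iff`).

Purely imaginary `f` would be real as well, hence zero. If `f, g` depend on `t` only, then `∫ g dx =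
g (x - x₀)` and the formula is a quadratic polynomial in `x`. -/

theorem hasDerivAt_slice_fst (hF : DifferentiableAt ℝ F z) :
    HasDerivAt (fun x => F (x, z.2)) (fderiv ℝ F z (1, 0)) z.1 :=
  hF.hasFDerivAt.comp_hasDerivAt (f := fun x : ℝ => (x, z.2)) z.1
    ((hasDerivAt_id z.1).prodMk (hasDerivAt_const z.1 z.2))

theorem hasDerivAt_slice_snd (hF : DifferentiableAt ℝ F z) :
    HasDerivAt (fun t => F (z.1, t)) (fderiv ℝ F z (0, 1)) z.2 :=
  hF.hasFDerivAt.comp_hasDerivAt (f := fun t : ℝ => (z.1, t)) z.2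
    ((hasDerivAt_const z.2 z.1).prodMk (hasDerivAt_id z.2))

theorem Dx_eq_fderiv (hF : DifferentiableAt ℝ F z) : Dx F z = fderiv ℝ F z (1, 0) :=
  (hasDerivAt_slice_fst hF).deriv

theorem Dt_eq_fderiv (hF : DifferentiableAt ℝ F z) : Dt F z = fderiv ℝ F z (0, 1) :=
  (hasDerivAt_slice_snd hF).deriv

theorem hasDerivAt_Dx (hF : DifferentiableAt ℝ F z) :
    HasDerivAt (fun x => F (x, z.2)) (Dx F z) z.1 :=
  Dx_eq_fderiv hF ▸ hasDerivAt_slice_fst hF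

theorem hasDerivAt_Dt (hF : DifferentiableAt ℝ F z) :
    HasDerivAt (fun t => F (z.1, t)) (Dt F z) z.2 :=
  Dt_eq_fderiv hF ▸ hasDerivAt_slice_snd hF

variable [CompleteSpace E]

theorem Dx_eventuallyEq (hF : AnalyticAt ℝ F z) :
    Dx F =ᶠ[𝓝 z] fun w => fderiv ℝ F w (1, 0) :=
  hF.eventually_analyticAt.mono fun _ hw => Dx_eq_fderiv hw.differentiableAt

theorem Dt_eventuallyEq (hF : AnalyticAt ℝ F z) :
    Dt F =ᶠ[𝓝 z] fun w => fderiv ℝ F w (0, 1) :=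
  hF.eventually_analyticAt.mono fun _ hw => Dt_eq_fderiv hw.differentiableAt

theorem analyticAt_fderiv_apply (hF : AnalyticAt ℝ F z) (v : ℝ × ℝ) :
    AnalyticAt ℝ (fun w => fderiv ℝ F w v) z :=
  ((ContinuousLinearMap.apply ℝ E v).analyticAt _).comp hF.fderiv

theorem analyticAt_Dx (hF : AnalyticAt ℝ F z) : AnalyticAt ℝ (Dx F) z :=
  (analyticAt_fderiv_apply hF (1, 0)).congr (Dx_eventuallyEq hF).symm

theorem analyticAt_Dt (hF : AnalyticAt ℝ F z) : AnalyticAt ℝ (Dt F) z :=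
  (analyticAt_fderiv_apply hF (0, 1)).congr (Dt_eventuallyEq hF).symm

theorem analyticOnNhd_Dx {s : Set (ℝ × ℝ)} (hF : AnalyticOnNhd ℝ F s) :
    AnalyticOnNhd ℝ (Dx F) s :=
  fun z hz => analyticAt_Dx (hF z hz)

theorem analyticOnNhd_Dt {s : Set (ℝ × ℝ)} (hF : AnalyticOnNhd ℝ F s) :
    AnalyticOnNhd ℝ (Dt F) s :=
  fun z hz => analyticAt_Dt (hF z hz)

theorem fderiv_fderiv_apply (hF : AnalyticAt ℝ F z) (v w : ℝ × ℝ) :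
    fderiv ℝ (fun y => fderiv ℝ F y v) z w = fderiv ℝ (fderiv ℝ F) z w v := by
  have h : HasFDerivAt (fun y => fderiv ℝ F y v)
      ((ContinuousLinearMap.apply ℝ E v).comp (fderiv ℝ (fderiv ℝ F) z)) z :=
    (ContinuousLinearMap.apply ℝ E v).hasFDerivAt.comp z hF.fderiv.differentiableAt.hasFDerivAt
  rw [h.fderiv]; rfl

theorem Dx_Dt_comm (hF : AnalyticAt ℝ F z) : Dx (Dt F) z = Dt (Dx F) z := by
  rw [Dx_eq_fderiv (analyticAt_Dt hF).differentiableAt,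
    Dt_eq_fderiv (analyticAt_Dx hF).differentiableAt, (Dt_eventuallyEq hF).fderiv_eq,
    (Dx_eventuallyEq hF).fderiv_eq, fderiv_fderiv_apply hF, fderiv_fderiv_apply hF]
  have := (hF.contDiffAt (n := 2)).isSymmSndFDerivAt (by simp)
  exact this _ _

end AnalyticCalculus

section Local

variable {E : Type*} [NormedAddCommGroup E] [NormedSpace ℝ E] {F G : ℝ × ℝ → E} {z : ℝ × ℝ}

theorem Dx_congr (h : F =ᶠ[𝓝 z] G) : Dx F z = Dx G z := by
  have : Filter.Tendsto (fun x : ℝ => (x, z.2)) (𝓝 z.1) (𝓝 z) :=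
    (continuous_id.prodMk continuous_const).tendsto' _ _ rfl
  exact Filter.EventuallyEq.deriv_eq (this.eventually h)

theorem Dt_congr (h : F =ᶠ[𝓝 z] G) : Dt F z = Dt G z := by
  have : Filter.Tendsto (fun t : ℝ => (z.1, t)) (𝓝 z.2) (𝓝 z) :=
    (continuous_const.prodMk continuous_id).tendsto' _ _ rfl
  exact Filter.EventuallyEq.deriv_eq (this.eventually h)

end Local

/-- The algebra of complex-valued real-analytic functions on an open set. -/
def An (W : Opens (ℝ × ℝ)) : Subalgebra ℂ (W → ℂ) where
  carrier := {F | AnalyticOnNhd ℝ (Function.extend Subtype.val F 0) W}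
  mul_mem' {F G} hF hG := by
    refine (hF.mul hG).congr W.isOpen fun z hz => ?_
    simp only [Pi.mul_apply, Subtype.val_injective.extend_apply _ _ (⟨z, hz⟩ : W)]
  add_mem' {F G} hF hG := by
    refine (hF.add hG).congr W.isOpen fun z hz => ?_
    simp only [Pi.add_apply, Subtype.val_injective.extend_apply _ _ (⟨z, hz⟩ : W)]
  algebraMap_mem' c := by
    refine (analyticOnNhd_const (v := c)).congr W.isOpen fun z hz => ?_
    simp only [Subtype.val_injective.extend_apply _ _ (⟨z, hz⟩ : W)]
    rfl

namespace An

variable {W : Opens (ℝ × ℝ)}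

/-- An analytic function on `W`, extended by zero. -/
def toFun (F : An W) : ℝ × ℝ → ℂ := Function.extend Subtype.val F.1 0

/-- Evaluation at a point of `W`. -/
def ev (z : W) : An W →ₐ[ℂ] ℂ := (Pi.evalAlgHom ℂ (fun _ : W => ℂ) z).comp (An W).val

theorem toFun_apply (F : An W) (z : W) : toFun F z = ev z F :=
  Subtype.val_injective.extend_apply _ _ z

theorem analytic (F : An W) : AnalyticOnNhd ℝ (toFun F) W := F.2

/-- Elements are functions on `W` only, so an identity between coefficients "on `W`" is an equality
in `An W`, available to `ring` and `linear_combination`. -/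
theorem ext_ev {F G : An W} (h : ∀ z, ev z F = ev z G) : F = G := Subtype.ext (funext h)

/-- The restriction to `W` of a function that is analytic there. -/
def ofFun (F : ℝ × ℝ → ℂ) (hF : AnalyticOnNhd ℝ F W) : An W :=
  ⟨fun z => F z, hF.congr W.isOpen fun z hz =>
    (Subtype.val_injective.extend_apply (fun z : W => F z) 0 ⟨z, hz⟩).symm⟩

theorem ev_ofFun (F : ℝ × ℝ → ℂ) (hF : AnalyticOnNhd ℝ F W) (z : W) : ev z (ofFun F hF) = F z :=
  rfl

theorem toFun_eventuallyEq {F : ℝ × ℝ → ℂ} {G : An W} (h : ∀ z : W, ev z G = F z) (z : W) :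
    toFun G =ᶠ[𝓝 z.1] F :=
  Filter.eventuallyEq_of_mem (W.isOpen.mem_nhds z.2) fun w hw =>
    (toFun_apply G ⟨w, hw⟩).trans (h ⟨w, hw⟩)

/-- The `x`-derivative. -/
def dx : Derivation ℂ (An W) (An W) :=
  Derivation.mk'
    { toFun := fun F => ofFun (Dx (toFun F)) (analyticOnNhd_Dx (analytic F))
      map_add' := fun F G => ext_ev fun z => by
        rw [map_add, ev_ofFun, ev_ofFun, ev_ofFun]
        rw [Dx_congr (toFun_eventuallyEq (F := toFun F + toFun G) (fun w => by
          rw [Pi.add_apply, toFun_apply, toFun_apply, map_add]) z)]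
        exact ((hasDerivAt_Dx (analytic F z z.2).differentiableAt).add
          (hasDerivAt_Dx (analytic G z z.2).differentiableAt)).deriv
      map_smul' := fun c F => ext_ev fun z => by
        rw [RingHom.id_apply, map_smul, ev_ofFun, ev_ofFun]
        rw [Dx_congr (toFun_eventuallyEq (F := c • toFun F) (fun w => by
          rw [Pi.smul_apply, toFun_apply, map_smul]) z)]
        exact ((hasDerivAt_Dx (analytic F z z.2).differentiableAt).const_smul c).deriv }
    fun F G => ext_ev fun z => by
      simp only [LinearMap.coe_mk, AddHom.coe_mk, smul_eq_mul, map_add, map_mul]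
      rw [ev_ofFun, ev_ofFun, ev_ofFun]
      rw [Dx_congr (toFun_eventuallyEq (F := toFun F * toFun G) (fun w => by
          rw [Pi.mul_apply, toFun_apply, toFun_apply, map_mul]) z)]
      refine ((hasDerivAt_Dx (analytic F z z.2).differentiableAt).mul
          (hasDerivAt_Dx (analytic G z z.2).differentiableAt)).deriv.trans ?_
      rw [← toFun_apply, ← toFun_apply]; ring

/-- The `t`-derivative. -/
def dt : Derivation ℂ (An W) (An W) :=
  Derivation.mk'
    { toFun := fun F => ofFun (Dt (toFun F)) (analyticOnNhd_Dt (analytic F))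
      map_add' := fun F G => ext_ev fun z => by
        rw [map_add, ev_ofFun, ev_ofFun, ev_ofFun]
        rw [Dt_congr (toFun_eventuallyEq (F := toFun F + toFun G) (fun w => by
          rw [Pi.add_apply, toFun_apply, toFun_apply, map_add]) z)]
        exact ((hasDerivAt_Dt (analytic F z z.2).differentiableAt).add
          (hasDerivAt_Dt (analytic G z z.2).differentiableAt)).deriv
      map_smul' := fun c F => ext_ev fun z => by
        rw [RingHom.id_apply, map_smul, ev_ofFun, ev_ofFun]
        rw [Dt_congr (toFun_eventuallyEq (F := c • toFun F) (fun w => by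
          rw [Pi.smul_apply, toFun_apply, map_smul]) z)]
        exact ((hasDerivAt_Dt (analytic F z z.2).differentiableAt).const_smul c).deriv }
    fun F G => ext_ev fun z => by
      simp only [LinearMap.coe_mk, AddHom.coe_mk, smul_eq_mul, map_add, map_mul]
      rw [ev_ofFun, ev_ofFun, ev_ofFun]
      rw [Dt_congr (toFun_eventuallyEq (F := toFun F * toFun G) (fun w => by
          rw [Pi.mul_apply, toFun_apply, toFun_apply, map_mul]) z)]
      refine ((hasDerivAt_Dt (analytic F z z.2).differentiableAt).mul
          (hasDerivAt_Dt (analytic G z z.2).differentiableAt)).deriv.trans ?_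
      rw [← toFun_apply, ← toFun_apply]; ring

theorem ev_dx {F : ℝ × ℝ → ℂ} {G : An W} (h : ∀ z : W, ev z G = F z) (z : W) :
    ev z (dx G) = Dx F z :=
  Dx_congr (toFun_eventuallyEq h z)

theorem ev_dt {F : ℝ × ℝ → ℂ} {G : An W} (h : ∀ z : W, ev z G = F z) (z : W) :
    ev z (dt G) = Dt F z :=
  Dt_congr (toFun_eventuallyEq h z)

theorem dx_dt (F : An W) : dx (dt F) = dt (dx F) := ext_ev fun z => by
  rw [ev_dx (F := Dt (toFun F)) (fun z => ev_dt (fun w => (toFun_apply F w).symm) z),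
    ev_dt (F := Dx (toFun F)) (fun z => ev_dx (fun w => (toFun_apply F w).symm) z)]
  exact Dx_Dt_comm (analytic F z z.2)

theorem toFun_ne_zero {F : An W} (h : ∀ z, ev z F ≠ 0) (z : ℝ × ℝ) (hz : z ∈ (W : Set (ℝ × ℝ))) :
    toFun F z ≠ 0 := by
  rw [toFun_apply F ⟨z, hz⟩]; exact h _

theorem exists_mul_eq_one {F : An W} (h : ∀ z, ev z F ≠ 0) : ∃ G : An W, F * G = 1 :=
  ⟨ofFun (fun z => (toFun F z)⁻¹) ((analytic F).inv (toFun_ne_zero h)),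
    ext_ev fun z => by
      rw [map_mul, ev_ofFun, toFun_apply, map_one]; exact mul_inv_cancel₀ (h z)⟩

end An

end VCNLS

/-! ### Formal series, the resonances, and the recursion for the coefficients. -/

namespace VCNLS

section FormalSeries

variable {A : Type*} [CommRing A]

/-- The coefficient of the `n`-th power in a formal Laurent series of leading order `α`. -/
def laurent (α : ℤ) (u : ℕ → A) (n : ℤ) : A := if α ≤ n then u (n - α).toNat else 0

theorem laurent_add (α : ℤ) (u : ℕ → A) (j : ℕ) : laurent α u (α + j) = u j := by
  simp [laurent]

theorem laurent_mul (α : ℤ) (c : A) (p : ℕ → A) (n : ℤ) :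
    laurent α (fun j => c * p j) n = c * laurent α p n := by
  unfold laurent; split_ifs <;> simp

theorem mul_normalised {y yi : A} (hy : y * yi = 1) (u : ℕ → A) :
    (fun j => y * (yi * u j)) = u := by
  funext j; rw [← mul_assoc, hy, one_mul]

theorem laurent_of_lt {α n : ℤ} (u : ℕ → A) (h : n < α) : laurent α u n = 0 :=
  if_neg (not_le.mpr h)

/-- The coefficients of `p² q`. -/
def conv3 (p q : ℕ → A) (k : ℕ) : A :=
  PowerSeries.coeff k (PowerSeries.mk p * PowerSeries.mk p * PowerSeries.mk q)

theorem coeff_mul_of_lt {k : ℕ} {P : PowerSeries A} (hP : ∀ i < k, PowerSeries.coeff i P = 0)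
    (Q : PowerSeries A) :
    PowerSeries.coeff k (P * Q) = PowerSeries.coeff k P * PowerSeries.coeff 0 Q := by
  rw [PowerSeries.coeff_mul]
  refine Finset.sum_eq_single (k, 0) (fun x hx hne => ?_) (fun h => by simp at h)
  have hx' := Finset.HasAntidiagonal.mem_antidiagonal.mp hx
  have : x.1 < k := by
    by_contra hk
    exact hne (Prod.ext (by simp; omega) (by simp; omega))
  rw [hP _ this, zero_mul]

/-- Write `p²q - p'²q' = (p - p')(p + p')q + (q - q')p'²`. Both differences start at order `k`, so
only constant terms of the cofactors contribute. -/
theorem conv3_sub {p q p' q' : ℕ → A} {k : ℕ} (hp : ∀ i < k, p i = p' i)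
    (hq : ∀ i < k, q i = q' i) (hp0 : p 0 = 1) (hq0 : q 0 = 1) (hp0' : p' 0 = 1) :
    conv3 p q k - conv3 p' q' k = 2 * (p k - p' k) + (q k - q' k) := by
  have e : PowerSeries.mk p * PowerSeries.mk p * PowerSeries.mk q
      - PowerSeries.mk p' * PowerSeries.mk p' * PowerSeries.mk q'
      = (PowerSeries.mk p - PowerSeries.mk p') *
          ((PowerSeries.mk p + PowerSeries.mk p') * PowerSeries.mk q)
        + (PowerSeries.mk q - PowerSeries.mk q') * (PowerSeries.mk p' * PowerSeries.mk p') := by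
    ring
  have h1 := coeff_mul_of_lt (k := k) (P := PowerSeries.mk p - PowerSeries.mk p')
    (fun i hi => by simp [hp i hi]) ((PowerSeries.mk p + PowerSeries.mk p') * PowerSeries.mk q)
  have h2 := coeff_mul_of_lt (k := k) (P := PowerSeries.mk q - PowerSeries.mk q')
    (fun i hi => by simp [hq i hi]) (PowerSeries.mk p' * PowerSeries.mk p')
  rw [conv3, conv3, ← map_sub, e, map_add, h1, h2]
  simp [hp0, hq0, hp0']
  ring

theorem conv3_mul (c d : A) (p q : ℕ → A) (k : ℕ) :
    conv3 (fun j => c * p j) (fun j => d * q j) k = c ^ 2 * d * conv3 p q k := by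
  have hs : ∀ (c : A) (p : ℕ → A), PowerSeries.mk (fun j => c * p j)
      = PowerSeries.C c * PowerSeries.mk p := fun c p => by ext; simp
  rw [conv3, hs, hs, conv3, ← PowerSeries.coeff_C_mul]
  congr 1
  rw [map_mul, map_pow]; ring

theorem conv3_eq_sum (p q : ℕ → A) (k : ℕ) : conv3 p q k =
    ∑ a ∈ Finset.HasAntidiagonal.antidiagonal k,
      ∑ b ∈ Finset.HasAntidiagonal.antidiagonal a.1, p b.1 * p b.2 * q a.2 := by
  simp [conv3, PowerSeries.coeff_mul, Finset.sum_mul]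

theorem laurent_nonneg_aux (p : ℕ → A) :
    laurent (-1) p (-3) = 0 ∧ laurent (-1) p (-2) = 0 ∧ laurent (-1) p (-1) = p 0 ∧
      laurent (-1) p 0 = p 1 ∧ laurent (-1) p 1 = p 2 ∧ laurent (-1) p 2 = p 3 ∧
      laurent (-1) p 3 = p 4 :=
  ⟨rfl, rfl, rfl, rfl, rfl, rfl, rfl⟩

theorem laurent_three_aux (p : ℕ → A) :
    laurent (-3) p (-3) = p 0 ∧ laurent (-3) p (-2) = p 1 ∧ laurent (-3) p (-1) = p 2 ∧
      laurent (-3) p 0 = p 3 ∧ laurent (-3) p 1 = p 4 :=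
  ⟨rfl, rfl, rfl, rfl, rfl⟩

variable [Algebra ℂ A] (D T : Derivation ℂ A A)

/-- Termwise derivative of a formal series in powers of a function with derivative `1`. -/
def nabla (c : ℤ → A) (n : ℤ) : A := D (c n) + ((n : A) + 1) * c (n + 1)

/-- The coefficient of the `n`-th power in `p_yy + M p_y + a p_t + C p - 2 p² q`. -/
def normalRes (M a C : A) (p q : ℕ → A) (n : ℤ) : A :=
  nabla D (nabla D (laurent (-1) p)) n + M * nabla D (laurent (-1) p) n
    + a * T (laurent (-1) p n) + C * laurent (-1) p n - 2 * laurent (-3) (conv3 p q) n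

variable {D T} {M a C M' a' C' : A} {p q p' q' : ℕ → A}

/-- The power `-3 + j` is level `j`. There the top coefficients enter linearly: `p_yy` contributes
`(j-1)(j-2) p_j` and `-2p²q` contributes `-4 p_j - 2 q_j`, while every other term involves lower
levels only. -/
theorem normalRes_sub {j : ℕ} (hp : ∀ i < j, p i = p' i)
    (hq : ∀ i < j, q i = q' i) (hp0 : p 0 = 1) (hq0 : q 0 = 1) (hp0' : p' 0 = 1) :
    normalRes D T M a C p q (-3 + j) - normalRes D T M a C p' q' (-3 + j)
      = (((j : A) - 1) * (j - 2) - 4) * (p j - p' j) - 2 * (q j - q' j) := by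
  have h1 : laurent (-1) p (-3 + j) = laurent (-1) p' (-3 + j) := by
    unfold laurent; split_ifs
    · exact hp _ (by omega)
    · rfl
  have h2 : laurent (-1) p (-3 + j + 1) = laurent (-1) p' (-3 + j + 1) := by
    unfold laurent; split_ifs
    · exact hp _ (by omega)
    · rfl
  have h3 : ∀ p : ℕ → A, laurent (-1) p (-3 + j + 1 + 1) = p j := fun p => by
    rw [← laurent_add (-1) p j]; congr 1; ring
  have h4 := conv3_sub hp hq hp0 hq0 hp0'
  simp only [normalRes, nabla, laurent_add, h1, h2, h3, map_add]
  push_cast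
  linear_combination (-2) * h4

theorem normalRes_of_lt {n : ℤ} (hn : n < -3) : normalRes D T M a C p q n = 0 := by
  simp [normalRes, nabla, laurent_of_lt _ hn, laurent_of_lt p (show n < -1 by omega),
    laurent_of_lt p (show n + 1 < -1 by omega), laurent_of_lt p (show n + 1 + 1 < -1 by omega)]

theorem normalRes_zero (hp0 : p 0 = 1) (hq0 : q 0 = 1) :
    normalRes D T M a C p q (-3) = 0 := by
  simp [normalRes, nabla, laurent_nonneg_aux, laurent_three_aux, conv3, hp0, hq0]
  ring

theorem normalRes_one (hp0 : p 0 = 1) (hq0 : q 0 = 1) :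
    normalRes D T M a C p q (-2) = -(M + 4 * p 1 + 2 * q 1) := by
  have h2 : D 2 = 0 := D.map_natCast 2
  simp [normalRes, nabla, laurent_nonneg_aux, laurent_three_aux, conv3_eq_sum, hp0, hq0, h2,
    Finset.Nat.antidiagonal_succ]
  ring

theorem normalRes_two (hp0 : p 0 = 1) (hq0 : q 0 = 1) :
    normalRes D T M a C p q (-1) = C - (4 * p 2 + 2 * q 2 + 2 * p 1 ^ 2 + 4 * p 1 * q 1) := by
  simp [normalRes, nabla, laurent_nonneg_aux, laurent_three_aux, conv3_eq_sum, hp0, hq0,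
    Finset.Nat.antidiagonal_succ]
  ring

theorem normalRes_three (hp0 : p 0 = 1) (hq0 : q 0 = 1) :
    normalRes D T M a C p q 0 = -2 * p 3 - 2 * q 3 + (2 * D (p 2) + D (D (p 1))
      + M * (p 2 + D (p 1)) + a * T (p 1) + C * p 1
      - 2 * (2 * p 1 * p 2 + q 1 * (2 * p 2 + p 1 ^ 2) + 2 * p 1 * q 2)) := by
  simp [normalRes, nabla, laurent_nonneg_aux, laurent_three_aux, conv3_eq_sum, hp0, hq0,
    Finset.Nat.antidiagonal_succ]
  ring

theorem normalRes_four (hp0 : p 0 = 1) (hq0 : q 0 = 1) :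
    normalRes D T M a C p q 1 = 2 * p 4 - 2 * q 4 + (4 * D (p 3) + D (D (p 2))
      + M * (2 * p 3 + D (p 2)) + a * T (p 2) + C * p 2
      - 2 * (2 * p 1 * p 3 + p 2 ^ 2 + q 1 * (2 * p 3 + 2 * p 1 * p 2)
        + q 2 * (2 * p 2 + p 1 ^ 2) + 2 * p 1 * q 3)) := by
  simp [normalRes, nabla, laurent_nonneg_aux, laurent_three_aux, conv3_eq_sum, hp0, hq0,
    Finset.Nat.antidiagonal_succ, Derivation.leibniz]
  ring

/-- Nonzero integers are invertible in a ℂ-algebra. This replaces division by numerical constants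
throughout. -/
theorem eq_zero_of_intCast_mul {n : ℤ} (hn : n ≠ 0) {x : A} (h : (n : A) * x = 0) : x = 0 := by
  have h1 : (algebraMap ℂ A ((n : ℂ)⁻¹)) * (n : A) = 1 := by
    rw [← map_intCast (algebraMap ℂ A), ← map_mul, inv_mul_cancel₀ (by exact_mod_cast hn), map_one]
  linear_combination (algebraMap ℂ A ((n : ℂ)⁻¹)) * h - x * h1

theorem eq_of_intCast_mul {n : ℤ} (hn : n ≠ 0) {x y : A} (h : (n : A) * x = n * y) : x = y :=
  sub_eq_zero.mp (eq_zero_of_intCast_mul hn (by rw [mul_sub, h, sub_self]))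

theorem exists_intCast_mul_eq {n : ℤ} (hn : n ≠ 0) (y : A) : ∃ x, (n : A) * x = y :=
  ⟨algebraMap ℂ A ((n : ℂ)⁻¹) * y, by
    rw [← mul_assoc, ← map_intCast (algebraMap ℂ A), ← map_mul,
      mul_inv_cancel₀ (by exact_mod_cast hn), map_one, one_mul]⟩

/-- The determinant of the level-`j` system factors as `(j+1) j (j-3) (j-4)`; the root `-1`
corresponds to the freedom in `Φ`. -/
theorem resonance_det_ne_zero {j : ℕ} (h0 : j ≠ 0) (h3 : j ≠ 3) (h4 : j ≠ 4) :
    (((j : ℤ) - 1) * (j - 2) - 4) ^ 2 - 4 ≠ 0 := by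
  have : (((j : ℤ) - 1) * (j - 2) - 4) ^ 2 - 4 = (j + 1) * j * (j - 3) * (j - 4) := by ring
  rw [this]
  have h1 : (j : ℤ) + 1 ≠ 0 := by omega
  have h2 : (j : ℤ) ≠ 0 := by omega
  have h5 : (j : ℤ) - 3 ≠ 0 := by omega
  have h6 : (j : ℤ) - 4 ≠ 0 := by omega
  positivity

/-- Away from the resonances the linear system at level `j` determines the coefficients; at the
resonances `3` and `4` one of them is free. -/
theorem exists_level_solution (j : ℕ) (hj : j ≠ 0) (r r' x₃ x₄ : A) :
    ∃ x : A × A, (((j : A) - 1) * (j - 2) - 4) * x.1 - 2 * x.2 + r = 0 ∧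
      (j ≠ 3 → j ≠ 4 → (((j : A) - 1) * (j - 2) - 4) * x.2 - 2 * x.1 + r' = 0) ∧
      (j = 3 → x.1 = x₃) ∧ (j = 4 → x.1 = x₄) := by
  obtain ⟨ρ, hρ⟩ := exists_intCast_mul_eq (two_ne_zero : (2 : ℤ) ≠ 0) r
  push_cast at hρ
  -- At `j = 3` all four entries of the matrix are `-2`; at `j = 4` the diagonal is `2` and the rest
  -- `-2`. The first equation then fixes the second unknown from the prescribed one, and the second
  -- equation is not demanded.
  by_cases h3 : j = 3
  · subst h3
    refine ⟨(x₃, ρ - x₃), ?_, fun h => absurd rfl h, fun _ => rfl, by omega⟩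
    push_cast; linear_combination (-1) * hρ
  by_cases h4 : j = 4
  · subst h4
    refine ⟨(x₄, x₄ + ρ), ?_, fun _ h => absurd rfl h, by omega, fun _ => rfl⟩
    push_cast; linear_combination (-1) * hρ
  -- Cramer's rule.
  obtain ⟨x, hx⟩ := exists_intCast_mul_eq (resonance_det_ne_zero hj h3 h4)
    (-((((j : A) - 1) * (j - 2) - 4) * r + 2 * r'))
  obtain ⟨y, hy⟩ := exists_intCast_mul_eq (resonance_det_ne_zero hj h3 h4)
    (-((((j : A) - 1) * (j - 2) - 4) * r' + 2 * r))
  push_cast at hx hy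
  refine ⟨(x, y), ?_, fun _ _ => ?_, fun h => absurd h h3, fun h => absurd h h4⟩
  all_goals
    apply eq_zero_of_intCast_mul (resonance_det_ne_zero hj h3 h4)
    push_cast
  · linear_combination (((j : A) - 1) * (j - 2) - 4) * hx - 2 * hy
  · linear_combination (((j : A) - 1) * (j - 2) - 4) * hy - 2 * hx

variable (D T) in
/-- The recursion for the coefficients, with compatibility at the resonances left open. -/
theorem exists_recursive_solution (M a C M' a' C' x₃ x₄ : A) :
    ∃ p q : ℕ → A, p 0 = 1 ∧ q 0 = 1 ∧ p 3 = x₃ ∧ p 4 = x₄ ∧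
      (∀ n, normalRes D T M a C p q n = 0) ∧
      (∀ n, n ≠ 0 → n ≠ 1 → normalRes D T M' a' C' q p n = 0) := by
  choose sol hsol using fun (j : ℕ) (hj : j ≠ 0) (r r' : A) =>
    exists_level_solution j hj r r' x₃ x₄
  -- With level `j` set to zero, the residual at level `j` is exactly the inhomogeneity of the
  -- linear system there.
  let trunc (j : ℕ) (S : ℕ → A × A) : ℕ → A × A := Function.update S j 0
  -- `S n` is a sequence whose entries up to level `n` are final; the solution is the diagonal `i ↦
  -- S i i`.
  let S : ℕ → ℕ → A × A := fun n => Nat.rec (fun _ => (1, 1)) (fun j S =>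
    Function.update S (j + 1) (sol (j + 1) j.succ_ne_zero
      (normalRes D T M a C (fun i => (trunc (j + 1) S i).1) (fun i => (trunc (j + 1) S i).2)
        (-3 + (j + 1 : ℕ)))
      (normalRes D T M' a' C' (fun i => (trunc (j + 1) S i).2) (fun i => (trunc (j + 1) S i).1)
        (-3 + (j + 1 : ℕ))))) n
  have hS : ∀ j, S (j + 1) = Function.update (S j) (j + 1) (sol (j + 1) j.succ_ne_zero
      (normalRes D T M a C (fun i => (trunc (j + 1) (S j) i).1)
        (fun i => (trunc (j + 1) (S j) i).2) (-3 + (j + 1 : ℕ)))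
      (normalRes D T M' a' C' (fun i => (trunc (j + 1) (S j) i).2)
        (fun i => (trunc (j + 1) (S j) i).1) (-3 + (j + 1 : ℕ)))) := fun _ => rfl
  have hst : ∀ i m, i ≤ m → S m i = S i i := by
    intro i m him
    induction m, him using Nat.le_induction with
    | base => rfl
    | succ m hm ih => rw [hS, Function.update_of_ne (by omega), ih]
  have hlt : ∀ j, ∀ i < j + 1, S i i = trunc (j + 1) (S j) i := fun j i hi => by
    simp only [trunc]
    rw [Function.update_of_ne (by omega), hst i j (by omega)]
  have hz : ∀ j, trunc (j + 1) (S j) 0 = (1, 1) := fun j => (hlt j 0 (by omega)).symm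
  have key : ∀ j, S (j + 1) (j + 1) = sol (j + 1) j.succ_ne_zero
      (normalRes D T M a C (fun i => (trunc (j + 1) (S j) i).1)
        (fun i => (trunc (j + 1) (S j) i).2) (-3 + (j + 1 : ℕ)))
      (normalRes D T M' a' C' (fun i => (trunc (j + 1) (S j) i).2)
        (fun i => (trunc (j + 1) (S j) i).1) (-3 + (j + 1 : ℕ))) := fun j => by
    rw [hS, Function.update_self]
  -- By `normalRes_sub`, passing from the truncated sequence to the diagonal adds precisely the
  -- linear part that `sol` was chosen to cancel.
  have hres : ∀ j, normalRes D T M a C (fun i => (S i i).1) (fun i => (S i i).2)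
        (-3 + (j + 1 : ℕ)) = 0 ∧ (j + 1 ≠ 3 → j + 1 ≠ 4 →
      normalRes D T M' a' C' (fun i => (S i i).2) (fun i => (S i i).1) (-3 + (j + 1 : ℕ)) = 0) := by
    intro j
    have h1 := normalRes_sub (D := D) (T := T) (M := M) (a := a) (C := C) (j := j + 1)
      (p := fun i => (S i i).1) (q := fun i => (S i i).2)
      (p' := fun i => (trunc (j + 1) (S j) i).1) (q' := fun i => (trunc (j + 1) (S j) i).2)
      (fun i hi => by rw [hlt j i hi]) (fun i hi => by rw [hlt j i hi]) rfl rfl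
      (by simp only [hz])
    have h2 := normalRes_sub (D := D) (T := T) (M := M') (a := a') (C := C') (j := j + 1)
      (p := fun i => (S i i).2) (q := fun i => (S i i).1)
      (p' := fun i => (trunc (j + 1) (S j) i).2) (q' := fun i => (trunc (j + 1) (S j) i).1)
      (fun i hi => by rw [hlt j i hi]) (fun i hi => by rw [hlt j i hi]) rfl rfl
      (by simp only [hz])
    have ht : trunc (j + 1) (S j) (j + 1) = 0 := Function.update_self _ _ _
    obtain ⟨k1, k2, -, -⟩ := hsol (j + 1) j.succ_ne_zero
      (normalRes D T M a C (fun i => (trunc (j + 1) (S j) i).1)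
        (fun i => (trunc (j + 1) (S j) i).2) (-3 + (j + 1 : ℕ)))
      (normalRes D T M' a' C' (fun i => (trunc (j + 1) (S j) i).2)
        (fun i => (trunc (j + 1) (S j) i).1) (-3 + (j + 1 : ℕ)))
    rw [← key j] at k1 k2
    simp only [ht, Prod.fst_zero, Prod.snd_zero, sub_zero] at h1 h2
    exact ⟨by linear_combination h1 + k1, fun a b => by linear_combination h2 + k2 a b⟩
  have hcase : ∀ n : ℤ, n < -3 ∨ n = -3 ∨ ∃ j : ℕ, n = -3 + (j + 1 : ℕ) := fun n => by
    rcases lt_trichotomy n (-3) with h | h | h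
    · exact Or.inl h
    · exact Or.inr (Or.inl h)
    · exact Or.inr (Or.inr ⟨(n + 2).toNat, by push_cast; omega⟩)
  refine ⟨fun i => (S i i).1, fun i => (S i i).2, rfl, rfl, ?_, ?_, fun n => ?_,
    fun n hn0 hn1 => ?_⟩
  · show (S 3 3).1 = x₃
    exact (congrArg Prod.fst (key 2)).trans ((hsol 3 _ _ _).2.2.1 rfl)
  · show (S 4 4).1 = x₄
    exact (congrArg Prod.fst (key 3)).trans ((hsol 4 _ _ _).2.2.2 rfl)
  · rcases hcase n with h | rfl | ⟨j, rfl⟩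
    · exact normalRes_of_lt h
    · exact normalRes_zero rfl rfl
    · exact (hres j).1
  · rcases hcase n with h | rfl | ⟨j, rfl⟩
    · exact normalRes_of_lt h
    · exact normalRes_zero rfl rfl
    · exact (hres j).2 (by rintro h; apply hn0; push_cast; omega)
        (by rintro h; apply hn1; push_cast; omega)

/-- Uniqueness of the coefficients up to the free ones at levels `3` and `4`. -/
theorem normalRes_unique (hp0 : p 0 = 1) (hq0 : q 0 = 1) (hp0' : p' 0 = 1) (hq0' : q' 0 = 1)
    (h1 : ∀ n, normalRes D T M a C p q n = 0) (h2 : ∀ n, normalRes D T M' a' C' q p n = 0)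
    (h1' : ∀ n, normalRes D T M a C p' q' n = 0) (h2' : ∀ n, normalRes D T M' a' C' q' p' n = 0)
    (N : ℕ) (h3 : 3 ≤ N → p 3 = p' 3) (h4 : 4 ≤ N → p 4 = p' 4) :
    ∀ j ≤ N, p j = p' j ∧ q j = q' j := by
  intro j
  induction j using Nat.strong_induction_on with
  | _ j ih =>
  intro hjN
  rcases Nat.eq_zero_or_pos j with rfl | hj
  · exact ⟨hp0.trans hp0'.symm, hq0.trans hq0'.symm⟩
  have e1 := normalRes_sub (D := D) (T := T) (M := M) (a := a) (C := C)
    (fun i hi => (ih i hi (by omega)).1) (fun i hi => (ih i hi (by omega)).2) hp0 hq0 hp0'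
  have e2 := normalRes_sub (D := D) (T := T) (M := M') (a := a') (C := C')
    (fun i hi => (ih i hi (by omega)).2) (fun i hi => (ih i hi (by omega)).1) hq0 hp0 hq0'
  rw [h1, h1'] at e1
  rw [h2, h2'] at e2
  -- The off-diagonal entry `-2` is never zero, so at every level, resonant or not, the first
  -- equation recovers `q j` from `p j`.
  have hfree : p j = p' j → q j = q' j := fun h => by
    refine eq_of_intCast_mul (two_ne_zero : (2 : ℤ) ≠ 0) ?_
    push_cast
    linear_combination e1 + (((j : A) - 1) * (j - 2) - 4) * h
  by_cases hj3 : j = 3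
  · subst hj3; exact ⟨h3 hjN, hfree (h3 hjN)⟩
  by_cases hj4 : j = 4
  · subst hj4; exact ⟨h4 hjN, hfree (h4 hjN)⟩
  have : p j = p' j := by
    refine eq_of_intCast_mul (resonance_det_ne_zero hj.ne' hj3 hj4) ?_
    push_cast
    linear_combination -(((j : A) - 1) * (j - 2) - 4) * e1 - 2 * e2
  exact ⟨this, hfree this⟩

end FormalSeries

end VCNLS

/-! ### The compatibility conditions at the resonances 3 and 4. -/

namespace VCNLS

section Compatibility

variable {A : Type*} [CommRing A] [Algebra ℂ A] (D T : Derivation ℂ A A)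

theorem derivation_ofNat (n : ℕ) [n.AtLeastTwo] : D (ofNat(n) : A) = 0 := D.map_natCast n

/-- The inhomogeneity at the resonance `3`. -/
def res3 (a p₁ q₁ p₂ q₂ : A) : A :=
  2 * D p₂ + D (D p₁) + a * T p₁ - (4 * p₁ + 2 * q₁) * D p₁ - p₂ * (4 * p₁ + 6 * q₁)
    - 2 * p₁ * q₂ + 2 * p₁ ^ 3 + 2 * p₁ ^ 2 * q₁

/-- The obstruction at the resonance `3`. -/
def obstr3 (a a' p₁ q₁ p₂ q₂ : A) : A := res3 D T a p₁ q₁ p₂ q₂ - res3 D T a' q₁ p₁ q₂ p₂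

/-- The obstruction at the resonance `4`. -/
def obstr4 (a a' p₁ q₁ p₂ q₂ : A) : A :=
  D (res3 D T a p₁ q₁ p₂ q₂ + res3 D T a' q₁ p₁ q₂ p₂)
    - 3 * (p₁ + q₁) * (res3 D T a p₁ q₁ p₂ q₂ + res3 D T a' q₁ p₁ q₂ p₂)
    + D (D (p₂ + q₂)) - (4 * p₁ + 2 * q₁) * D p₂ - (4 * q₁ + 2 * p₁) * D q₂
    + a * T p₂ + a' * T q₂ + 2 * (p₂ - q₂) ^ 2 + 2 * (p₁ ^ 2 - q₁ ^ 2) * (p₂ - q₂)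

/-- The equations that determine the coefficients of levels `1` and `2`. -/
structure LowLevels (M C M' C' p₁ q₁ p₂ q₂ : A) : Prop where
  eq_M : M = -(4 * p₁ + 2 * q₁)
  eq_M' : M' = -(4 * q₁ + 2 * p₁)
  eq_C : C = 4 * p₂ + 2 * q₂ + 2 * p₁ ^ 2 + 4 * p₁ * q₁
  eq_C' : C' = 4 * q₂ + 2 * p₂ + 2 * q₁ ^ 2 + 4 * q₁ * p₁

variable {D T} {M a C M' a' C' : A} {p q : ℕ → A}

theorem LowLevels.of_solution (hp0 : p 0 = 1) (hq0 : q 0 = 1)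
    (h1 : ∀ n, normalRes D T M a C p q n = 0)
    (h2 : ∀ n, n ≠ 0 → n ≠ 1 → normalRes D T M' a' C' q p n = 0) :
    LowLevels M C M' C' (p 1) (q 1) (p 2) (q 2) := by
  have e1 := h1 (-2)
  have e2 := h1 (-1)
  have e1' := h2 (-2) (by norm_num) (by norm_num)
  have e2' := h2 (-1) (by norm_num) (by norm_num)
  rw [normalRes_one hp0 hq0] at e1
  rw [normalRes_two hp0 hq0] at e2
  rw [normalRes_one hq0 hp0] at e1'
  rw [normalRes_two hq0 hp0] at e2'
  exact ⟨by linear_combination -e1, by linear_combination -e1', by linear_combination e2,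
    by linear_combination e2'⟩

/-- Both level-3 equations contain the unknowns only in the combination `p₃ + q₃`, so they are
compatible exactly when the inhomogeneities coincide. -/
theorem normalRes_three_eq (hp0 : p 0 = 1) (hq0 : q 0 = 1)
    (h : LowLevels M C M' C' (p 1) (q 1) (p 2) (q 2)) :
    normalRes D T M a C p q 0
      = -2 * p 3 - 2 * q 3 + res3 D T a (p 1) (q 1) (p 2) (q 2) ∧
    normalRes D T M' a' C' q p 0
      = -2 * p 3 - 2 * q 3 + res3 D T a' (q 1) (p 1) (q 2) (p 2) := by
  rw [normalRes_three hp0 hq0, normalRes_three hq0 hp0, h.eq_M, h.eq_M', h.eq_C, h.eq_C', res3,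
    res3]
  constructor <;> ring

/-- The unknowns enter as `2(p₄ - q₄)` and its negative, so addition removes them. What remains of
level 3 is the sum `p₃ + q₃`, fixed by the level-3 equations: the free coefficient `p₃` drops out of
the obstruction. -/
theorem normalRes_four_add (hp0 : p 0 = 1) (hq0 : q 0 = 1)
    (h : LowLevels M C M' C' (p 1) (q 1) (p 2) (q 2))
    (h3 : normalRes D T M a C p q 0 = 0) (h3' : normalRes D T M' a' C' q p 0 = 0) :
    normalRes D T M a C p q 1 + normalRes D T M' a' C' q p 1
      = obstr4 D T a a' (p 1) (q 1) (p 2) (q 2) := by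
  obtain ⟨e, e'⟩ := normalRes_three_eq (D := D) (T := T) (a := a) (a' := a') hp0 hq0 h
  have es : res3 D T a (p 1) (q 1) (p 2) (q 2) + res3 D T a' (q 1) (p 1) (q 2) (p 2)
      = 4 * (p 3 + q 3) := by linear_combination h3 + h3' - e - e'
  rw [normalRes_four hp0 hq0, normalRes_four hq0 hp0, h.eq_M, h.eq_M', h.eq_C, h.eq_C', obstr4, es]
  simp only [Derivation.leibniz, derivation_ofNat, map_add, smul_eq_mul]
  ring

theorem obstr_eq_zero_of_solution (hp0 : p 0 = 1) (hq0 : q 0 = 1)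
    (h1 : ∀ n, normalRes D T M a C p q n = 0) (h2 : ∀ n, normalRes D T M' a' C' q p n = 0) :
    ∃ p₁ q₁ p₂ q₂ : A, LowLevels M C M' C' p₁ q₁ p₂ q₂ ∧ obstr3 D T a a' p₁ q₁ p₂ q₂ = 0 ∧
      obstr4 D T a a' p₁ q₁ p₂ q₂ = 0 := by
  have hl := LowLevels.of_solution hp0 hq0 h1 (fun n _ _ => h2 n)
  obtain ⟨e, e'⟩ := normalRes_three_eq (D := D) (T := T) (a := a) (a' := a') hp0 hq0 hl
  refine ⟨_, _, _, _, hl, ?_, ?_⟩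
  · rw [obstr3]; linear_combination h1 0 - h2 0 - e + e'
  · rw [← normalRes_four_add hp0 hq0 hl (h1 0) (h2 0), h1, h2, add_zero]

variable (D T) in
-- The recursion leaves open only the second equation at levels 3 and 4, and these two equations are
-- what the obstructions express.
theorem exists_solution_of_obstr (h : ∀ p₁ q₁ p₂ q₂ : A, LowLevels M C M' C' p₁ q₁ p₂ q₂ →
      obstr3 D T a a' p₁ q₁ p₂ q₂ = 0 ∧ obstr4 D T a a' p₁ q₁ p₂ q₂ = 0) (x₃ x₄ : A) :
    ∃ p q : ℕ → A, p 0 = 1 ∧ q 0 = 1 ∧ p 3 = x₃ ∧ p 4 = x₄ ∧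
      (∀ n, normalRes D T M a C p q n = 0) ∧ (∀ n, normalRes D T M' a' C' q p n = 0) := by
  obtain ⟨p, q, hp0, hq0, hp3, hp4, h1, h2⟩ :=
    exists_recursive_solution D T M a C M' a' C' x₃ x₄
  have hl := LowLevels.of_solution hp0 hq0 h1 h2
  obtain ⟨o3, o4⟩ := h _ _ _ _ hl
  obtain ⟨e, e'⟩ := normalRes_three_eq (D := D) (T := T) (a := a) (a' := a') hp0 hq0 hl
  have h20 : normalRes D T M' a' C' q p 0 = 0 := by
    rw [obstr3] at o3; linear_combination h1 0 - e + e' - o3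
  have h21 : normalRes D T M' a' C' q p 1 = 0 := by
    linear_combination normalRes_four_add hp0 hq0 hl (h1 0) h20 + o4 - h1 1
  refine ⟨p, q, hp0, hq0, hp3, hp4, h1, fun n => ?_⟩
  by_cases hn0 : n = 0
  · rw [hn0, h20]
  by_cases hn1 : n = 1
  · rw [hn1, h21]
  exact h2 n hn0 hn1

variable {p₁ q₁ p₂ q₂ : A}

/-- Here `p₂, q₂` are eliminated in favour of `C - C'`, and `a, a'` remain independent. This is the
form suited to comparing solutions with the same `M, M'` but different `C, C'`. -/
theorem obstr3_eq (hl : LowLevels M C M' C' p₁ q₁ p₂ q₂) {s d : A} (hs : s = p₁ + q₁)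
    (hd : d = p₁ - q₁) : obstr3 D T a a' p₁ q₁ p₂ q₂ =
      D (C - C') - 2 * s * (C - C') + D (D d) - 5 * s * D d - 3 * d * D s + 6 * s ^ 2 * d
        + a * T p₁ - a' * T q₁ := by
  rw [hl.eq_C, hl.eq_C', hs, hd, obstr3, res3, res3]
  simp only [Derivation.leibniz, derivation_ofNat, map_add, map_sub, smul_eq_mul, pow_two]
  ring

/-- For `a' = -a` the combination `e` absorbs `d` completely. -/
theorem obstr3_eq_of_real {s d e : A} (hs : s = p₁ + q₁) (hd : d = p₁ - q₁)
    (he : e = 2 * (p₂ - q₂) + D d - s * d) :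
    obstr3 D T a (-a) p₁ q₁ p₂ q₂ = D e - 2 * s * e + a * T s := by
  rw [he, hs, hd, obstr3, res3, res3]
  simp only [Derivation.leibniz, derivation_ofNat, map_add, map_sub, smul_eq_mul, pow_two]
  ring

set_option maxHeartbeats 1000000 in
-- The variables `e`, `k` and `m` isolate the arbitrariness of `u₀`: it can enter through `d`, which
-- multiplies `obstr3`, and through `m`, which multiplies an expression in `ρ = D a - 2 s a`. In the
-- applications `β = a σ`, and `ρ = 0` once `f g²` depends on `t` only.
theorem obstr4_eq_of_real (hDT : ∀ x, D (T x) = T (D x)) {s d e k m β ρ : A}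
    (hs : s = p₁ + q₁) (hd : d = p₁ - q₁)
    (he : e = 2 * (p₂ - q₂) + D d - s * d)
    (hk : k = 12 * (p₂ + q₂) - 2 * a * m - 3 * d ^ 2)
    (hm : D m = -(T β + T d)) (hρ : ρ = D a - 2 * s * a) :
    4 * obstr4 D T a (-a) p₁ q₁ p₂ q₂ = 2 * d * obstr3 D T a (-a) p₁ q₁ p₂ q₂
      + 2 * m * (D ρ - 3 * s * ρ)
      + (D (D k) - 5 * s * D k - 2 * D s * k + 6 * s ^ 2 * k)
      + 4 * (D (D (D s)) - 6 * s * D (D s) - 3 * D s ^ 2 + 12 * s ^ 2 * D s - 3 * s ^ 4)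
      + 2 * e ^ 2 + 2 * a * T e - 2 * a * (T (D β) - s * T β) - 4 * ρ * T β := by
  have hβ : T β = -(D m + T d) := by linear_combination hm
  have hβ' : T (D β) = -(D (D m) + D (T d)) := by rw [← hDT, hβ, map_neg, map_add]
  rw [obstr3_eq_of_real hs hd he, hβ, hβ', hρ, hk, he, hs, hd, obstr4, res3, res3]
  simp only [Derivation.leibniz, derivation_ofNat, map_add, map_sub, map_neg, smul_eq_mul, pow_succ,
    pow_zero, one_mul, map_zero, ← hDT]
  ring

end Compatibility

end VCNLS

/-! ### The obstructions when `f g²` depends on `t` only. -/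

namespace VCNLS

section Frame

variable {A : Type*} [CommRing A] [Algebra ℂ A]

/-- The logarithmic derivatives attached to `θ = g / Φₓ` and `f = K / g ^ 2`, where `Ki = 1 / K`,
`κ = K_t / K`, `G` and `Gt` are the logarithmic derivatives of `g` along `D` and `∂ₜ`, and
`T = ∂ₜ - σ D`. -/
structure IsFrame (D T : Derivation ℂ A A) (i θ Ki κ s Gt σ : A) : Prop where
  comm : ∀ x, D (T x) = T (D x)
  i_mul_i : i * i = -1
  D_i : D i = 0
  T_i : T i = 0
  D_θ : D θ = θ * s
  T_θ : T θ = θ * (Gt - D σ - σ * s)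
  T_s : T s = D (Gt - D σ - σ * s)
  D_Ki : D Ki = 0
  T_Ki : T Ki = -κ * Ki
  D_κ : D κ = 0

/-- The coefficients of the normalised system in terms of the frame and of the logarithmic
derivatives `L, L'` and `m, m'` of `u₀, v₀` along `D` and `T`. -/
structure IsFrameSystem (D T : Derivation ℂ A A) (i θ Ki κ s Gt σ G h₁ h₂ L L' m m' M C M' C' : A) :
    Prop where
  L_add : L + L' = -(G + 2 * s)
  m_add : m + m' = -(Gt - σ * G + 2 * (Gt - D σ - σ * s) - κ)
  D_m : D m = T L
  D_m' : D m' = T L'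
  eq_M : M = G - s + i * Ki * θ ^ 2 * σ + 2 * L
  eq_M' : M' = G - s - i * Ki * θ ^ 2 * σ + 2 * L'
  eq_C : C = (h₁ + i * h₂) * Ki * θ ^ 2 + i * Ki * θ ^ 2 * m + (G - s + i * Ki * θ ^ 2 * σ) * L
    + L ^ 2 + D L
  eq_C' : C' = (h₁ - i * h₂) * Ki * θ ^ 2 - i * Ki * θ ^ 2 * m' + (G - s - i * Ki * θ ^ 2 * σ) * L'
    + L' ^ 2 + D L'

variable {D T : Derivation ℂ A A} {i θ Ki κ s Gt σ G h₁ h₂ L L' m m' M C M' C' p₁ q₁ p₂ q₂ : A}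

/-- Sums and differences of the level-1 and level-2 equations. The values of `s`, `e` and `k` no
longer contain `L, L', m, m'`, so they do not depend on the choice of `u₀`. -/
theorem IsFrameSystem.reduce (hF : IsFrame D T i θ Ki κ s Gt σ)
    (hS : IsFrameSystem D T i θ Ki κ s Gt σ G h₁ h₂ L L' m m' M C M' C')
    (hl : LowLevels M C M' C' p₁ q₁ p₂ q₂) :
    s = p₁ + q₁ ∧ p₁ - q₁ = -(i * Ki * θ ^ 2 * σ + (L - L')) ∧
    i * (Ki * θ ^ 2 * (2 * (h₂ - Gt) + κ - (Gt - D σ - σ * s)))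
      = 2 * (p₂ - q₂) + D (p₁ - q₁) - s * (p₁ - q₁) ∧
    12 * (p₂ + q₂) - 2 * (i * Ki * θ ^ 2) * (m - m') - 3 * (p₁ - q₁) ^ 2
      = 4 * h₁ * Ki * θ ^ 2 - G ^ 2 - 2 * D G + 2 * s * G + Ki ^ 2 * θ ^ 4 * σ ^ 2
        + 2 * s ^ 2 - 4 * D s := by
  have hs : s = p₁ + q₁ := by
    refine eq_of_intCast_mul (show (6 : ℤ) ≠ 0 by norm_num) ?_
    push_cast
    linear_combination hS.eq_M + hS.eq_M' + 2 * hS.L_add - hl.eq_M - hl.eq_M'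
  have hd : p₁ - q₁ = -(i * Ki * θ ^ 2 * σ + (L - L')) := by
    refine eq_of_intCast_mul (show (2 : ℤ) ≠ 0 by norm_num) ?_
    push_cast
    linear_combination hl.eq_M - hl.eq_M' + hS.eq_M' - hS.eq_M
  have hL' : L' = -(G + 2 * s) - L := by linear_combination hS.L_add
  have hm' : m' = -(Gt - σ * G + 2 * (Gt - D σ - σ * s) - κ) - m := by linear_combination hS.m_add
  have hDL : D L' = -(D G + 2 * D s) - D L := by
    rw [hL', map_sub, map_neg, map_add, Derivation.leibniz, derivation_ofNat]; simp
  refine ⟨hs, hd, ?_, ?_⟩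
  · have e : 2 * (p₂ - q₂) = C - C' - 2 * s * (p₁ - q₁) := by
      rw [hs]; linear_combination hl.eq_C' - hl.eq_C
    rw [e, hd, hS.eq_C, hS.eq_C', hm']
    simp only [map_neg, map_add, map_sub, Derivation.leibniz, smul_eq_mul, pow_two, hF.D_i, hF.D_θ,
      hF.D_Ki, hDL]
    rw [hL']
    ring
  · have e : 12 * (p₂ + q₂) = 2 * (C + C') - 6 * s ^ 2 + 2 * (p₁ - q₁) ^ 2 := by
      rw [hs]; linear_combination (-2) * hl.eq_C' - 2 * hl.eq_C
    rw [e, hd, hS.eq_C, hS.eq_C', hDL, hL']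
    linear_combination (-Ki ^ 2 * θ ^ 4 * σ ^ 2) * hF.i_mul_i

/-- Since `e` is `θ²` times a factor, `D e - 2 s e` differentiates that factor only; its part `-(Gt
- D σ - σ s)` is cancelled by `a T s`. -/
theorem obstr3_eq_frame (hF : IsFrame D T i θ Ki κ s Gt σ)
    (hS : IsFrameSystem D T i θ Ki κ s Gt σ G h₁ h₂ L L' m m' M C M' C')
    (hl : LowLevels M C M' C' p₁ q₁ p₂ q₂) :
    obstr3 D T (i * Ki * θ ^ 2) (-(i * Ki * θ ^ 2)) p₁ q₁ p₂ q₂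
      = 2 * i * Ki * θ ^ 2 * D (h₂ - Gt) := by
  obtain ⟨hs, hd, he, hk⟩ := hS.reduce hF hl
  rw [obstr3_eq_of_real hs rfl he, hF.T_s]
  simp only [map_add, map_sub, Derivation.leibniz, smul_eq_mul, pow_two, hF.D_i, hF.D_θ,
      hF.D_Ki, hF.D_κ, derivation_ofNat]
  ring

set_option maxHeartbeats 1000000 in
-- Here `ρ = 0` because `a = i θ²/K`, and `obstr3` vanishes by assumption, so the terms in `d` and
-- `m` disappear. The operator acting on `k` sends `θ² V` to `θ⁴ V₂`: it is the second derivative in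
-- `∫ g dx` in disguise. All occurrences of `σ` cancel except the one that turns `T Gt` into `∂ₜ
-- Gt`.
theorem obstr4_eq_frame (hF : IsFrame D T i θ Ki κ s Gt σ)
    (hS : IsFrameSystem D T i θ Ki κ s Gt σ G h₁ h₂ L L' m m' M C M' C')
    (hl : LowLevels M C M' C' p₁ q₁ p₂ q₂) (hγ : D (h₂ - Gt) = 0) {V V₁ V₂ : A}
    (hV : 4 * h₁ * Ki * θ ^ 2 = 2 * θ ^ 2 * V + G ^ 2 + 2 * D G - 2 * s * G)
    (hV₁ : D V = θ * V₁) (hV₂ : D V₁ = θ * V₂) :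
    2 * obstr4 D T (i * Ki * θ ^ 2) (-(i * Ki * θ ^ 2)) p₁ q₁ p₂ q₂
      = θ ^ 4 * (V₂ + Ki ^ 2 * (-(2 * (h₂ - Gt) + κ) ^ 2 + κ * (2 * (h₂ - Gt) + κ)
        - (2 * T (h₂ - Gt) + T κ) + (T Gt + σ * D Gt + Gt ^ 2) - κ * Gt)) := by
  obtain ⟨hs, hd, he, hk⟩ := hS.reduce hF hl
  have h3 := obstr3_eq_frame hF hS hl
  rw [hγ, mul_zero] at h3
  generalize hγ' : h₂ - Gt = γ at *
  refine eq_of_intCast_mul (show (2 : ℤ) ≠ 0 by norm_num) ?_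
  have hm : D (m - m') = -(T (i * Ki * θ ^ 2 * σ) + T (p₁ - q₁)) := by
    rw [map_sub, hS.D_m, hS.D_m', hd, map_neg, map_add T, map_sub]; ring
  have key := obstr4_eq_of_real (a := i * Ki * θ ^ 2) hF.comm hs rfl he rfl hm rfl
  rw [hk, h3] at key
  have hk' : 4 * h₁ * Ki * θ ^ 2 - G ^ 2 - 2 * D G + 2 * s * G + Ki ^ 2 * θ ^ 4 * σ ^ 2
        + 2 * s ^ 2 - 4 * D s = 2 * θ ^ 2 * V + Ki ^ 2 * θ ^ 4 * σ ^ 2 + 2 * s ^ 2 - 4 * D s := by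
    linear_combination hV
  have hTDσ : T (D σ) = D (T σ) := (hF.comm σ).symm
  rw [hk'] at key
  push_cast
  rw [← mul_assoc, show (2 : A) * 2 = 4 by norm_num, key]
  simp only [map_add, map_sub, Derivation.leibniz, smul_eq_mul, pow_succ, pow_zero,
    one_mul, hF.D_i, hF.D_θ, hF.D_Ki, hF.T_i, hF.T_θ, hF.T_Ki, hF.T_s, hV₁, hV₂,
    derivation_ofNat, hTDσ, map_zero]
  have hi2 : i ^ 2 = -1 := by rw [pow_two, hF.i_mul_i]
  ring_nf
  simp only [hi2]
  ring

end Frame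

end VCNLS

/-! ### Derivations adapted to `Φ`, and normalisation of the series. -/

namespace VCNLS

section AdaptedDerivations

variable {A : Type*} [CommRing A] [Algebra ℂ A]

/-- `D` and `T` are the commuting derivations with `∂ₓ = ω D`, `∂ₜ = T + σ D`, where `ω = Φₓ` and
`σ = Φₜ`; they differentiate along `Φ` and along the level curves of `Φ`. -/
structure Adapted (X Y D T : Derivation ℂ A A) (ω ωi σ : A) : Prop where
  comm : ∀ x, D (T x) = T (D x)
  X_eq : ∀ x, X x = ω * D x
  Y_eq : ∀ x, Y x = T x + σ * D x
  ω_mul : ω * ωi = 1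
  closed : X σ = Y ω

theorem derivation_inv (D : Derivation ℂ A A) {x y : A} (h : x * y = 1) :
    D y = -(y ^ 2 * D x) := by
  have h1 : D (x * y) = 0 := by rw [h, Derivation.map_one_eq_zero]
  rw [Derivation.leibniz, smul_eq_mul, smul_eq_mul] at h1
  linear_combination y * h1 - D y * h

/-- Take `D = ω⁻¹ X` and `T = Y - σ D`; they commute because `X σ = Y ω`, the equality of the mixed
derivatives of `Φ`. -/
theorem exists_adapted (X Y : Derivation ℂ A A) (hXY : ∀ x, X (Y x) = Y (X x)) {ω ωi σ : A}
    (hω : ω * ωi = 1) (hσ : X σ = Y ω) :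
    ∃ D T : Derivation ℂ A A, Adapted X Y D T ω ωi σ := by
  refine ⟨ωi • X, Y - σ • (ωi • X), ?_, ?_, ?_, hω, hσ⟩
  · intro x
    simp only [Derivation.coe_smul, Derivation.coe_sub, Pi.smul_apply, Pi.sub_apply, smul_eq_mul,
      map_sub, Derivation.leibniz, hXY, derivation_inv X hω, derivation_inv Y hω, hσ]
    ring
  · intro x
    simp only [Derivation.coe_smul, Pi.smul_apply, smul_eq_mul]
    linear_combination (-X x) * hω
  · intro x
    simp only [Derivation.coe_smul, Derivation.coe_sub, Pi.smul_apply, Pi.sub_apply, smul_eq_mul]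
    ring

/-- Equality of the mixed derivatives of `ln y`, without a logarithm. -/
theorem derivation_log_comm {D T : Derivation ℂ A A} (hDT : ∀ x, D (T x) = T (D x))
    {y yi l m : A} (hy : y * yi = 1) (hD : D y = y * l) (hT : T y = y * m) : D m = T l := by
  have h := hDT y
  rw [hD, hT, Derivation.leibniz, Derivation.leibniz, smul_eq_mul, smul_eq_mul, smul_eq_mul,
    smul_eq_mul, hD, hT] at h
  linear_combination yi * h - (D m - T l) * hy

/-- Termwise derivative of a formal series in powers of a function with derivative `ω`. -/
def seriesDeriv (X : Derivation ℂ A A) (ω : A) (c : ℤ → A) (n : ℤ) : A :=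
  X (c n) + ((n : A) + 1) * ω * c (n + 1)

/-- The coefficients of `s u_t + f u_xx + g u² v + h u`. -/
def algResidual (X Y : Derivation ℂ A A) (ω σ s f g h : A) (α : ℤ) (u : ℕ → A) (β : ℤ) (v : ℕ → A)
    (n : ℤ) : A :=
  s * seriesDeriv Y σ (laurent α u) n + f * seriesDeriv X ω (seriesDeriv X ω (laurent α u)) n
    + g * laurent (2 * α + β) (conv3 u v) n + h * laurent α u n

variable {X Y D T : Derivation ℂ A A} {ω ωi σ : A}

/-- The residual in terms of the normalised series `p = u / u₀`, `q = v / v₀`. -/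
theorem algResidual_eq_normalRes (hA : Adapted X Y D T ω ωi σ) {s f g h a c w u₀ v₀ L m : A}
    (ha : a * (f * ω ^ 2) = s) (hc : c * (f * ω ^ 2) = h) (hw : D ω = ω * w) (hL : D u₀ = u₀ * L)
    (hm : T u₀ = u₀ * m) (hg : g * (u₀ * v₀) = -2 * (f * ω ^ 2)) (p q : ℕ → A) (n : ℤ) :
    algResidual X Y ω σ s f g h (-1) (fun j => u₀ * p j) (-1) (fun j => v₀ * q j) n
      = f * ω ^ 2 * u₀ * normalRes D T (w + a * σ + 2 * L) a
        (c + a * m + (w + a * σ) * L + L ^ 2 + D L) p q n := by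
  have e : laurent (2 * (-1) + -1) (conv3 (fun j => u₀ * p j) (fun j => v₀ * q j)) n
      = u₀ ^ 2 * v₀ * laurent (-3) (conv3 p q) n := by
    rw [show conv3 (fun j => u₀ * p j) (fun j => v₀ * q j) = fun k => u₀ ^ 2 * v₀ * conv3 p q k from
      funext fun k => conv3_mul _ _ _ _ _, laurent_mul]; rfl
  simp only [algResidual, seriesDeriv, normalRes, nabla, e, laurent_mul]
  simp only [hA.X_eq, hA.Y_eq, Derivation.leibniz, smul_eq_mul, map_add, hw, hL, hm,
    Derivation.map_intCast, Derivation.map_one_eq_zero]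
  rw [← ha, ← hc]
  linear_combination (u₀ * laurent (-3) (conv3 p q) n) * hg

/-- The factor `2 = (-1)(-2)` comes from differentiating `Φ⁻¹` twice. -/
theorem algResidual_neg_three {s f g h : A} (u v : ℕ → A) :
    algResidual X Y ω σ s f g h (-1) u (-1) v (-3)
      = u 0 * (2 * (f * ω ^ 2) + g * (u 0 * v 0)) := by
  simp [algResidual, seriesDeriv, laurent, conv3]
  ring

end AdaptedDerivations

end VCNLS

/-! ### From real coefficients with `f g² = K(t)` to the frame. -/

namespace VCNLS

section AlgebraicTest

variable {A : Type*} [CommRing A] [Algebra ℂ A]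

/-- Real coefficients with `f g² = K(t)`, written with logarithmic derivatives; `V` is the part of
the real potential `h₁` that is not determined by `g`, differentiated in `∫ g dx`. -/
structure CoeffData (X Y : Derivation ℂ A A) (i f g gi K Ki κ Gx Gt h₁ V V₁ V₂ : A) : Prop where
  i_mul_i : i * i = -1
  X_i : X i = 0
  Y_i : Y i = 0
  f_mul : f * g ^ 2 = K
  K_mul : K * Ki = 1
  g_mul : g * gi = 1
  X_K : X K = 0
  Y_K : Y K = K * κ
  X_g : X g = g * Gx
  Y_g : Y g = g * Gt
  V_eq : 4 * h₁ * Ki * g ^ 2 = 2 * g ^ 2 * V + 2 * X Gx - Gx ^ 2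
  X_V : X V = g * V₁
  X_V₁ : X V₁ = g * V₂

/-- The expression whose vanishing determines the real potential. -/
def potentialDefect (Y : Derivation ℂ A A) (Ki κ Gt γ V₂ : A) : A :=
  V₂ + Ki ^ 2 * (-(2 * γ + κ) ^ 2 + κ * (2 * γ + κ) - (2 * Y γ + Y κ) + (Y Gt + Gt ^ 2) - κ * Gt)

variable {X Y D T : Derivation ℂ A A} {ω ωi σ i f g gi K Ki κ Gx Gt h₁ h₂ V V₁ V₂ : A}

theorem Adapted.D_of_X (hA : Adapted X Y D T ω ωi σ) (x : A) : D x = ωi * X x := by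
  linear_combination (-D x) * hA.ω_mul - ωi * hA.X_eq x

/-- Take `θ = g/Φₓ` and `s = D θ/θ`. The relations on `L + L'` and `m + m'` are the logarithmic
derivatives of the leading-order relation; those on `T s`, `D κ`, `D m` and `D m'` are equalities of
mixed logarithmic derivatives. -/
theorem CoeffData.exists_frame (hA : Adapted X Y D T ω ωi σ)
    (hC : CoeffData X Y i f g gi K Ki κ Gx Gt h₁ V V₁ V₂) (h₂ : A) {u₀ u₀i v₀ v₀i : A}
    (hu₀ : u₀ * u₀i = 1) (hv₀ : v₀ * v₀i = 1) (hg : g * (u₀ * v₀) = -2 * (f * ω ^ 2)) :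
    ∃ s G L L' m m' M C M' C' : A, IsFrame D T i (g * ωi) Ki κ s Gt σ ∧
      IsFrameSystem D T i (g * ωi) Ki κ s Gt σ G h₁ h₂ L L' m m' M C M' C' ∧
      4 * h₁ * Ki * (g * ωi) ^ 2 = 2 * (g * ωi) ^ 2 * V + G ^ 2 + 2 * D G - 2 * s * G ∧
      (∀ p q n, algResidual X Y ω σ i f g (h₁ + i * h₂) (-1) (fun j => u₀ * p j) (-1)
        (fun j => v₀ * q j) n
          = f * ω ^ 2 * u₀ * normalRes D T M (i * Ki * (g * ωi) ^ 2) C p q n) ∧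
      (∀ p q n, algResidual X Y ω σ (-i) f g (h₁ - i * h₂) (-1) (fun j => v₀ * q j) (-1)
        (fun j => u₀ * p j) n
          = f * ω ^ 2 * v₀ * normalRes D T M' (-(i * Ki * (g * ωi) ^ 2)) C' q p n) := by
  have hω := hA.ω_mul
  have hDi : ∀ x, X x = 0 → D x = 0 := fun x hx => by rw [hA.D_of_X, hx, mul_zero]
  have hTY : ∀ x, T x = Y x - σ * D x := fun x => by rw [hA.Y_eq]; ring
  have hDK := hDi K hC.X_K
  have hTK : T K = K * κ := by rw [hTY, hDK, hC.Y_K]; ring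
  have hDKi : D Ki = 0 := by rw [derivation_inv D hC.K_mul, hDK]; ring
  have hTKi : T Ki = -κ * Ki := by
    rw [derivation_inv T hC.K_mul, hTK]; linear_combination (-Ki * κ) * hC.K_mul
  have hDg : D g = g * (ωi * Gx) := by rw [hA.D_of_X, hC.X_g]; ring
  have hTg : T g = g * (Gt - σ * (ωi * Gx)) := by rw [hTY, hDg, hC.Y_g]; ring
  have hDω : D ω = ω * (ωi * D ω) := by linear_combination (-D ω) * hω
  generalize hw : ωi * D ω = w at hDω
  have hTω : T ω = ω * (D σ - σ * w) := by
    rw [hTY, ← hA.closed, hA.X_eq, hDω]; ring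
  have hDωi : D ωi = -ωi * w := by
    rw [derivation_inv D hω, hDω]; linear_combination (-ωi * w) * hω
  have hTωi : T ωi = -ωi * (D σ - σ * w) := by
    rw [derivation_inv T hω, hTω]; linear_combination (-ωi * (D σ - σ * w)) * hω
  have hDθ : D (g * ωi) = g * ωi * (ωi * Gx - w) := by
    rw [Derivation.leibniz, smul_eq_mul, smul_eq_mul, hDg, hDωi]; ring
  have hTθ : T (g * ωi) = g * ωi * (Gt - D σ - σ * (ωi * Gx - w)) := by
    rw [Derivation.leibniz, smul_eq_mul, smul_eq_mul, hTg, hTωi]; ring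
  have hθ : g * ωi * (ω * gi) = 1 := by linear_combination g * gi * hω + hC.g_mul
  have hDu : D u₀ = u₀ * (u₀i * D u₀) := by linear_combination (-D u₀) * hu₀
  have hTu : T u₀ = u₀ * (u₀i * T u₀) := by linear_combination (-T u₀) * hu₀
  have hDv : D v₀ = v₀ * (v₀i * D v₀) := by linear_combination (-D v₀) * hv₀
  have hTv : T v₀ = v₀ * (v₀i * T v₀) := by linear_combination (-T v₀) * hv₀
  generalize u₀i * D u₀ = L at hDu
  generalize u₀i * T u₀ = m at hTu
  generalize v₀i * D v₀ = L' at hDv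
  generalize v₀i * T v₀ = m' at hTv
  -- Multiplying the leading relation by `g²` replaces `f` by `K`, which `D` annihilates.
  have hprod : g ^ 3 * u₀ * v₀ = -2 * K * ω ^ 2 := by
    rw [← hC.f_mul]; linear_combination g ^ 2 * hg
  have hunit : g ^ 3 * u₀ * v₀ * (gi ^ 3 * u₀i * v₀i) = 1 := by
    calc g ^ 3 * u₀ * v₀ * (gi ^ 3 * u₀i * v₀i)
        = (g * gi) ^ 3 * (u₀ * u₀i) * (v₀ * v₀i) := by ring
      _ = 1 := by rw [hC.g_mul, hu₀, hv₀]; ring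
  have hL : L + L' = -(ωi * Gx + 2 * (ωi * Gx - w)) := by
    have h := congrArg D hprod
    simp only [Derivation.leibniz, pow_succ, pow_zero, one_mul, smul_eq_mul, hDg, hDu, hDv, hDK,
      hDω, map_neg, derivation_ofNat] at h
    linear_combination (gi ^ 3 * u₀i * v₀i) * h - (3 * ωi * Gx + L + L' - 2 * w) * hunit
      + (-2 * w * gi ^ 3 * u₀i * v₀i) * hprod
  have hm : m + m' = -(Gt - σ * (ωi * Gx) + 2 * (Gt - D σ - σ * (ωi * Gx - w)) - κ) := by
    have h := congrArg T hprod
    simp only [Derivation.leibniz, pow_succ, pow_zero, one_mul, smul_eq_mul, hTg, hTu, hTv, hTK,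
      hTω, map_neg, derivation_ofNat] at h
    linear_combination (gi ^ 3 * u₀i * v₀i) * h
      - (3 * (Gt - σ * (ωi * Gx)) + m + m' - κ - 2 * (D σ - σ * w)) * hunit
      - ((κ + 2 * (D σ - σ * w)) * gi ^ 3 * u₀i * v₀i) * hprod
  -- Thus `1/(f Φₓ²) = θ²/K`, which gives the coefficient `a = i θ²/K`.
  have hcoef : Ki * (g * ωi) ^ 2 * (f * ω ^ 2) = 1 := by
    calc Ki * (g * ωi) ^ 2 * (f * ω ^ 2) = f * g ^ 2 * Ki * (ω * ωi) ^ 2 := by ring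
      _ = 1 := by rw [hC.f_mul, hC.K_mul, hω]; ring
  refine ⟨ωi * Gx - w, ωi * Gx, L, L', m, m', _, _, _, _,
    ⟨hA.comm, hC.i_mul_i, hDi i hC.X_i, ?_, hDθ, hTθ, ?_, hDKi, hTKi, ?_⟩,
    ⟨hL, hm, derivation_log_comm hA.comm hu₀ hDu hTu, derivation_log_comm hA.comm hv₀ hDv hTv,
      rfl, rfl, rfl, rfl⟩, ?_, fun p q n => ?_, fun p q n => ?_⟩
  · rw [hTY, hC.Y_i, hDi i hC.X_i]; ring
  · exact (derivation_log_comm hA.comm hθ hDθ hTθ).symm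
  · rw [derivation_log_comm hA.comm hC.K_mul (l := 0) (m := κ) (by rw [hDK]; ring) hTK, map_zero]
  · have hDGx : D Gx = ωi * X Gx := hA.D_of_X _
    rw [Derivation.leibniz, smul_eq_mul, smul_eq_mul, hDωi, hDGx]
    linear_combination ωi ^ 2 * hC.V_eq
  · rw [algResidual_eq_normalRes hA (a := i * Ki * (g * ωi) ^ 2)
      (c := (h₁ + i * h₂) * Ki * (g * ωi) ^ 2) (L := L) (m := m) (w := w)
      (by linear_combination i * hcoef) (by linear_combination (h₁ + i * h₂) * hcoef) hDω hDu hTu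
      hg]
    ring_nf
  · rw [algResidual_eq_normalRes hA (a := -(i * Ki * (g * ωi) ^ 2))
      (c := (h₁ - i * h₂) * Ki * (g * ωi) ^ 2) (L := L') (m := m') (w := w)
      (by linear_combination (-i) * hcoef) (by linear_combination (h₁ - i * h₂) * hcoef) hDω hDv hTv
      (by rw [mul_comm v₀, hg])]
    ring_nf

end AlgebraicTest

end VCNLS

/-! ### Existence, uniqueness and necessary conditions for formal solutions. -/

namespace VCNLS

section FormalSolutions

variable {A : Type*} [CommRing A] [Algebra ℂ A]

/-- Formal solutions of the system with leading orders `-1`. -/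
structure IsFormalSolution (X Y : Derivation ℂ A A) (ω σ i f g h f' g' h' : A) (u v : ℕ → A) :
    Prop where
  eq_u : ∀ n, algResidual X Y ω σ i f g h (-1) u (-1) v n = 0
  eq_v : ∀ n, algResidual X Y ω σ (-i) f' g' h' (-1) v (-1) u n = 0

variable {X Y D T : Derivation ℂ A A}
  {ω ωi σ i f fi g gi h f' f'i g' h' K Ki κ Gx Gt h₁ h₂ V V₁ V₂ u₀i v₀i : A} {u v u' v' : ℕ → A}

theorem IsFormalSolution.leading (hs : IsFormalSolution X Y ω σ i f g h f' g' h' u v)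
    (hu : u 0 * u₀i = 1) (hv : v 0 * v₀i = 1) :
    g * (u 0 * v 0) = -2 * (f * ω ^ 2) ∧ g' * (u 0 * v 0) = -2 * (f' * ω ^ 2) := by
  have h1 := hs.eq_u (-3)
  have h2 := hs.eq_v (-3)
  rw [algResidual_neg_three] at h1 h2
  constructor
  · linear_combination u₀i * h1 - (2 * (f * ω ^ 2) + g * (u 0 * v 0)) * hu
  · linear_combination v₀i * h2 - (2 * (f' * ω ^ 2) + g' * (u 0 * v 0)) * hv

/-- Both obstructions vanish whatever `Φ` and `u₀` are, so the recursion runs with `p₃ = x₃/u₀` and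
`p₄ = x₄/u₀`. -/
theorem CoeffData.exists_solution (hA : Adapted X Y D T ω ωi σ)
    (hC : CoeffData X Y i f g gi K Ki κ Gx Gt h₁ V V₁ V₂) {u₀ v₀ : A}
    (hu₀ : u₀ * u₀i = 1) (hv₀ : v₀ * v₀i = 1) (hg : g * (u₀ * v₀) = -2 * (f * ω ^ 2))
    (hγ : X (h₂ - Gt) = 0) (hdef : potentialDefect Y Ki κ Gt (h₂ - Gt) V₂ = 0) (x₃ x₄ : A) :
    ∃ u v : ℕ → A, u 0 = u₀ ∧ v 0 = v₀ ∧ u 3 = x₃ ∧ u 4 = x₄ ∧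
      IsFormalSolution X Y ω σ i f g (h₁ + i * h₂) f g (h₁ - i * h₂) u v := by
  obtain ⟨s, G, L, L', m, m', M, C, M', C', hF, hS, hV, hu, hv⟩ :=
    hC.exists_frame hA h₂ hu₀ hv₀ hg
  have hDγ : D (h₂ - Gt) = 0 := by rw [hA.D_of_X, hγ, mul_zero]
  have hX : ∀ x, D x = ωi * X x := hA.D_of_X
  have hV₁ : D V = g * ωi * V₁ := by rw [hX, hC.X_V]; ring
  have hV₂ : D V₁ = g * ωi * V₂ := by rw [hX, hC.X_V₁]; ring
  obtain ⟨p, q, hp0, hq0, hp3, hp4, h1, h2⟩ := exists_solution_of_obstr (M := M) (C := C)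
    (M' := M') (C' := C') (a := i * Ki * (g * ωi) ^ 2) (a' := -(i * Ki * (g * ωi) ^ 2)) D T
    (fun p₁ q₁ p₂ q₂ hl => by
      refine ⟨by rw [obstr3_eq_frame hF hS hl, hDγ, mul_zero], ?_⟩
      refine eq_zero_of_intCast_mul (two_ne_zero : (2 : ℤ) ≠ 0) ?_
      push_cast
      rw [obstr4_eq_frame hF hS hl hDγ hV hV₁ hV₂]
      have e1 : T (h₂ - Gt) = Y (h₂ - Gt) := by rw [hA.Y_eq, hDγ]; ring
      have e2 : T κ = Y κ := by rw [hA.Y_eq, hF.D_κ]; ring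
      rw [potentialDefect, hA.Y_eq Gt] at hdef
      rw [e1, e2]
      linear_combination (g * ωi) ^ 4 * hdef) (u₀i * x₃) (u₀i * x₄)
  refine ⟨fun j => u₀ * p j, fun j => v₀ * q j, by simp [hp0], by simp [hq0], ?_, ?_,
    fun n => ?_, fun n => ?_⟩
  · simp only [hp3]; rw [← mul_assoc, hu₀, one_mul]
  · simp only [hp4]; rw [← mul_assoc, hu₀, one_mul]
  · rw [hu, h1, mul_zero]
  · rw [hv, h2, mul_zero]

theorem CoeffData.f_unit (hC : CoeffData X Y i f g gi K Ki κ Gx Gt h₁ V V₁ V₂) :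
    f * (g ^ 2 * Ki) = 1 := by
  linear_combination Ki * hC.f_mul + hC.K_mul

theorem CoeffData.solution_unique (hA : Adapted X Y D T ω ωi σ)
    (hC : CoeffData X Y i f g gi K Ki κ Gx Gt h₁ V V₁ V₂) (hu : u 0 * u₀i = 1)
    (hv : v 0 * v₀i = 1) {v₀i' : A} (hv' : v' 0 * v₀i' = 1)
    (hs : IsFormalSolution X Y ω σ i f g (h₁ + i * h₂) f g (h₁ - i * h₂) u v)
    (hs' : IsFormalSolution X Y ω σ i f g (h₁ + i * h₂) f g (h₁ - i * h₂) u' v')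
    (h0 : u 0 = u' 0) (N : ℕ) (h3 : 3 ≤ N → u 3 = u' 3) (h4 : 4 ≤ N → u 4 = u' 4) :
    ∀ j ≤ N, u j = u' j ∧ v j = v' j := by
  have hu' : u' 0 * u₀i = 1 := by rw [← h0, hu]
  have hg := (hs.leading hu hv).1
  have hg' := (hs'.leading hu' hv').1
  -- The leading relation determines `v₀` from `u₀`, so both solutions are normalised by the same
  -- pair and solve the same normalised system.
  have hv0 : v 0 = v' 0 := by
    rw [← h0] at hg'
    linear_combination (gi * u₀i) * hg - gi * u₀i * hg' - (v 0 - v' 0) * hC.g_mul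
      - (v 0 - v' 0) * g * gi * hu
  obtain ⟨s, G, L, L', m, m', M, C, M', C', hF, hS, hV, eu, ev⟩ :=
    hC.exists_frame hA h₂ hu hv hg
  have hω := hA.ω_mul
  have hfu : f * ω ^ 2 * u 0 * (g ^ 2 * Ki * ωi ^ 2 * u₀i) = 1 := by
    calc f * ω ^ 2 * u 0 * (g ^ 2 * Ki * ωi ^ 2 * u₀i)
        = (f * (g ^ 2 * Ki)) * (ω * ωi) ^ 2 * (u 0 * u₀i) := by ring
      _ = 1 := by rw [hC.f_unit, hω, hu]; ring
  have hfv : f * ω ^ 2 * v 0 * (g ^ 2 * Ki * ωi ^ 2 * v₀i) = 1 := by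
    calc f * ω ^ 2 * v 0 * (g ^ 2 * Ki * ωi ^ 2 * v₀i)
        = (f * (g ^ 2 * Ki)) * (ω * ωi) ^ 2 * (v 0 * v₀i) := by ring
      _ = 1 := by rw [hC.f_unit, hω, hv]; ring
  have key : ∀ u v : ℕ → A, IsFormalSolution X Y ω σ i f g (h₁ + i * h₂) f g (h₁ - i * h₂) u v →
      ∀ n, normalRes D T M (i * Ki * (g * ωi) ^ 2) C (fun j => u₀i * u j) (fun j => v₀i * v j) n = 0
        ∧ normalRes D T M' (-(i * Ki * (g * ωi) ^ 2)) C' (fun j => v₀i * v j)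
          (fun j => u₀i * u j) n = 0 := by
    intro y z hyz n
    refine ⟨(IsUnit.of_mul_eq_one _ hfu).mul_right_eq_zero.mp ?_,
      (IsUnit.of_mul_eq_one _ hfv).mul_right_eq_zero.mp ?_⟩
    · rw [← eu, mul_normalised hu, mul_normalised hv, hyz.eq_u]
    · rw [← ev, mul_normalised hu, mul_normalised hv, hyz.eq_v]
  have hN := normalRes_unique (p := fun j => u₀i * u j) (q := fun j => v₀i * v j)
    (p' := fun j => u₀i * u' j) (q' := fun j => v₀i * v' j)
    (by linear_combination hu) (by linear_combination hv) (by linear_combination hu')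
    (by rw [← hv0]; linear_combination hv) (fun n => (key u v hs n).1) (fun n => (key u v hs n).2)
    (fun n => (key u' v' hs' n).1) (fun n => (key u' v' hs' n).2) N
    (fun h => by simp only [h3 h]) (fun h => by simp only [h4 h])
  intro j hj
  obtain ⟨e1, e2⟩ := hN j hj
  constructor
  · rw [← congrFun (mul_normalised hu u) j, ← congrFun (mul_normalised hu u') j]; simp only [e1]
  · rw [← congrFun (mul_normalised hv v) j, ← congrFun (mul_normalised hv v') j]; simp only [e2]

/-- A formal solution annihilates the obstructions of the normalised system. -/
theorem IsFormalSolution.exists_obstr_eq_zero (hA : Adapted X Y D T ω ωi σ)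
    (hs : IsFormalSolution X Y ω σ i f g h f' g' h' u v) (hf : f * fi = 1) (hf' : f' * f'i = 1)
    (hu : u 0 * u₀i = 1) (hv : v 0 * v₀i = 1) {a c a' c' w L m L' m' : A}
    (ha : a * (f * ω ^ 2) = i) (hc : c * (f * ω ^ 2) = h) (ha' : a' * (f' * ω ^ 2) = -i)
    (hc' : c' * (f' * ω ^ 2) = h') (hw : D ω = ω * w) (hL : D (u 0) = u 0 * L)
    (hm : T (u 0) = u 0 * m) (hL' : D (v 0) = v 0 * L') (hm' : T (v 0) = v 0 * m') :
    ∃ p₁ q₁ p₂ q₂ : A, LowLevels (w + a * σ + 2 * L) (c + a * m + (w + a * σ) * L + L ^ 2 + D L)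
      (w + a' * σ + 2 * L') (c' + a' * m' + (w + a' * σ) * L' + L' ^ 2 + D L') p₁ q₁ p₂ q₂ ∧
      obstr3 D T a a' p₁ q₁ p₂ q₂ = 0 ∧ obstr4 D T a a' p₁ q₁ p₂ q₂ = 0 := by
  obtain ⟨hg, hg'⟩ := hs.leading hu hv
  have hω := hA.ω_mul
  have hfu : f * ω ^ 2 * u 0 * (fi * ωi ^ 2 * u₀i) = 1 := by
    calc f * ω ^ 2 * u 0 * (fi * ωi ^ 2 * u₀i) = (f * fi) * (ω * ωi) ^ 2 * (u 0 * u₀i) := by ring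
      _ = 1 := by rw [hf, hω, hu]; ring
  have hfv : f' * ω ^ 2 * v 0 * (f'i * ωi ^ 2 * v₀i) = 1 := by
    calc f' * ω ^ 2 * v 0 * (f'i * ωi ^ 2 * v₀i)
        = (f' * f'i) * (ω * ωi) ^ 2 * (v 0 * v₀i) := by ring
      _ = 1 := by rw [hf', hω, hv]; ring
  refine obstr_eq_zero_of_solution (p := fun j => u₀i * u j) (q := fun j => v₀i * v j)
    (by linear_combination hu) (by linear_combination hv) (fun n => ?_) (fun n => ?_)
  · refine (IsUnit.of_mul_eq_one _ hfu).mul_right_eq_zero.mp ?_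
    rw [← algResidual_eq_normalRes hA ha hc hw hL hm hg, mul_normalised hu, mul_normalised hv,
      hs.eq_u]
  · refine (IsUnit.of_mul_eq_one _ hfv).mul_right_eq_zero.mp ?_
    rw [← algResidual_eq_normalRes hA ha' hc' hw hL' hm' (g := g')
      (by rw [mul_comm (v 0), hg']),
      mul_normalised hu, mul_normalised hv, hs.eq_v]

/-- The obstructions of a solution vanish, and their prefactors `2iθ²/K` and `θ⁴` are units; a
single solution for a single `Φ` thus yields both conditions. -/
theorem CoeffData.necessary (hA : Adapted X Y D T ω ωi σ)
    (hC : CoeffData X Y i f g gi K Ki κ Gx Gt h₁ V V₁ V₂) (hu : u 0 * u₀i = 1)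
    (hv : v 0 * v₀i = 1)
    (hs : IsFormalSolution X Y ω σ i f g (h₁ + i * h₂) f g (h₁ - i * h₂) u v) :
    X (h₂ - Gt) = 0 ∧ potentialDefect Y Ki κ Gt (h₂ - Gt) V₂ = 0 := by
  have hg := (hs.leading hu hv).1
  obtain ⟨s, G, L, L', m, m', M, C, M', C', hF, hS, hV, eu, ev⟩ :=
    hC.exists_frame hA h₂ hu hv hg
  have hω := hA.ω_mul
  have hfu : f * ω ^ 2 * u 0 * (g ^ 2 * Ki * ωi ^ 2 * u₀i) = 1 := by
    calc f * ω ^ 2 * u 0 * (g ^ 2 * Ki * ωi ^ 2 * u₀i)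
        = (f * (g ^ 2 * Ki)) * (ω * ωi) ^ 2 * (u 0 * u₀i) := by ring
      _ = 1 := by rw [hC.f_unit, hω, hu]; ring
  have hfv : f * ω ^ 2 * v 0 * (g ^ 2 * Ki * ωi ^ 2 * v₀i) = 1 := by
    calc f * ω ^ 2 * v 0 * (g ^ 2 * Ki * ωi ^ 2 * v₀i)
        = (f * (g ^ 2 * Ki)) * (ω * ωi) ^ 2 * (v 0 * v₀i) := by ring
      _ = 1 := by rw [hC.f_unit, hω, hv]; ring
  obtain ⟨p₁, q₁, p₂, q₂, hl, h3, h4⟩ := obstr_eq_zero_of_solution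
    (M := M) (C := C) (M' := M') (C' := C') (a := i * Ki * (g * ωi) ^ 2)
    (a' := -(i * Ki * (g * ωi) ^ 2)) (D := D) (T := T)
    (p := fun j => u₀i * u j) (q := fun j => v₀i * v j)
    (by linear_combination hu) (by linear_combination hv)
    (fun n => (IsUnit.of_mul_eq_one _ hfu).mul_right_eq_zero.mp (by
      rw [← eu, mul_normalised hu, mul_normalised hv, hs.eq_u]))
    (fun n => (IsUnit.of_mul_eq_one _ hfv).mul_right_eq_zero.mp (by
      rw [← ev, mul_normalised hu, mul_normalised hv, hs.eq_v]))
  have hθ : g * ωi * (ω * gi) = 1 := by linear_combination g * gi * hω + hC.g_mul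
  have hDγ : D (h₂ - Gt) = 0 := by
    rw [obstr3_eq_frame hF hS hl] at h3
    refine eq_zero_of_intCast_mul (two_ne_zero : (2 : ℤ) ≠ 0) ?_
    have hun : i * Ki * (g * ωi) ^ 2 * (-i * K * (ω * gi) ^ 2) = 1 := by
      calc i * Ki * (g * ωi) ^ 2 * (-i * K * (ω * gi) ^ 2)
          = -(i * i) * (K * Ki) * (g * ωi * (ω * gi)) ^ 2 := by ring
        _ = 1 := by rw [hC.i_mul_i, hC.K_mul, hθ]; ring
    push_cast
    linear_combination (-i * K * (ω * gi) ^ 2) * h3 - 2 * D (h₂ - Gt) * hun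
  have hX : ∀ x, D x = ωi * X x := hA.D_of_X
  refine ⟨by rw [hA.X_eq, hDγ, mul_zero], ?_⟩
  have h4' := obstr4_eq_frame hF hS hl hDγ hV (V₁ := V₁) (V₂ := V₂)
    (by rw [hX, hC.X_V]; ring) (by rw [hX, hC.X_V₁]; ring)
  have e1 : T (h₂ - Gt) = Y (h₂ - Gt) := by rw [hA.Y_eq, hDγ]; ring
  have e2 : T κ = Y κ := by rw [hA.Y_eq, hF.D_κ]; ring
  rw [h4, mul_zero, e1, e2] at h4'
  have hθ4 : (g * ωi) ^ 4 * (ω * gi) ^ 4 = 1 := by rw [← mul_pow, hθ, one_pow]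
  refine (IsUnit.of_mul_eq_one _ hθ4).mul_right_eq_zero.mp ?_
  rw [h4', potentialDefect, hA.Y_eq Gt]

/-- Two values of `T u₀ / u₀` that differ by `1` force a first-order equation for `a + a'`. -/
theorem LowLevels.deriv_add_eq {M C M' C' a a' p₁ q₁ p₂ q₂ r₁ s₁ r₂ s₂ : A}
    (hl : LowLevels M C M' C' p₁ q₁ p₂ q₂) (hl' : LowLevels M (C + a) M' (C' - a') r₁ s₁ r₂ s₂)
    (h3 : obstr3 D T a a' p₁ q₁ p₂ q₂ = 0) (h3' : obstr3 D T a a' r₁ s₁ r₂ s₂ = 0) :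
    3 * D (a + a') = -(M + M') * (a + a') := by
  have hp : p₁ = r₁ := by
    refine eq_of_intCast_mul (show (6 : ℤ) ≠ 0 by norm_num) ?_
    push_cast
    linear_combination 2 * hl.eq_M - hl.eq_M' - 2 * hl'.eq_M + hl'.eq_M'
  have hq : q₁ = s₁ := by
    refine eq_of_intCast_mul (show (6 : ℤ) ≠ 0 by norm_num) ?_
    push_cast
    linear_combination 2 * hl.eq_M' - hl.eq_M - 2 * hl'.eq_M' + hl'.eq_M
  subst hp hq
  rw [obstr3_eq hl rfl rfl] at h3
  rw [obstr3_eq hl' rfl rfl, show C + a - (C' - a') = C - C' + (a + a') by ring, map_add] at h3'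
  linear_combination 3 * h3' - 3 * h3 + (a + a') * (hl.eq_M + hl.eq_M')

/-- If `Φₓ = 1` and `Φₜ = σ` vanishes at a point, the obstruction at level `4` there is affine in
`σₜ`, with slope proportional to `∂ₓ a + 2 l a / 3`. -/
theorem LowLevels.affine_obstr {B : Type*} [CommRing B] (φ : A →+* B)
    (hcomm : ∀ x, D (T x) = T (D x)) (hT : ∀ x, T x = Y x - σ * D x) (hYD : ∀ x, Y (D x) = D (Y x))
    (hDσ : D σ = 0) (hσ : φ σ = 0)
    {a C C' l n s p₁ q₁ p₂ q₂ : A} (hs : 3 * s = -l) (hln : Y l = D n)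
    (hl : LowLevels (a * σ) C (-a * σ + 2 * l) C' p₁ q₁ p₂ q₂)
    (h3 : obstr3 D T a (-a) p₁ q₁ p₂ q₂ = 0) (h4 : obstr4 D T a (-a) p₁ q₁ p₂ q₂ = 0) :
    φ (-2 * n * (D (D a - 2 * s * a) - 3 * s * (D a - 2 * s * a))
      + (D (D (2 * (C + C') - 6 * s ^ 2 - l ^ 2 + 2 * a * n))
        - 5 * s * D (2 * (C + C') - 6 * s ^ 2 - l ^ 2 + 2 * a * n)
        - 2 * D s * (2 * (C + C') - 6 * s ^ 2 - l ^ 2 + 2 * a * n)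
        + 6 * s ^ 2 * (2 * (C + C') - 6 * s ^ 2 - l ^ 2 + 2 * a * n))
      + 4 * (D (D (D s)) - 6 * s * D (D s) - 3 * D s ^ 2 + 12 * s ^ 2 * D s - 3 * s ^ 4)
      + 2 * (C - C' - 3 * s * l + D l) ^ 2 + 2 * a * Y (C - C' - 3 * s * l + D l))
      = 8 * φ (Y σ) * φ (a * (D a - 2 * s * a)) := by
  have hs' : s = p₁ + q₁ := by
    refine eq_of_intCast_mul (show (6 : ℤ) ≠ 0 by norm_num) ?_
    push_cast
    linear_combination 2 * hs - hl.eq_M - hl.eq_M'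
  have hd : p₁ - q₁ = l - a * σ := by
    refine eq_of_intCast_mul (show (2 : ℤ) ≠ 0 by norm_num) ?_
    push_cast
    linear_combination hl.eq_M - hl.eq_M'
  have hm : D (-(n - σ * l)) = -(T (a * σ) + T (p₁ - q₁)) := by
    rw [hd, map_sub T, hT l, hln]
    simp only [map_sub, map_neg, Derivation.leibniz, smul_eq_mul, hDσ]
    ring
  have he : C - C' - 3 * s * l + D l + 3 * s * a * σ - D (a * σ)
      = 2 * (p₂ - q₂) + D (p₁ - q₁) - s * (p₁ - q₁) := by
    have : 2 * (p₂ - q₂) = C - C' - 2 * s * (p₁ - q₁) := by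
      rw [hs']; linear_combination hl.eq_C' - hl.eq_C
    rw [this, hd, map_sub]; ring
  have hk : 12 * (p₂ + q₂) - 2 * a * (-(n - σ * l)) - 3 * (p₁ - q₁) ^ 2
      = 2 * (C + C') - 6 * s ^ 2 - l ^ 2 + 2 * a * n - a ^ 2 * σ ^ 2 := by
    have : 12 * (p₂ + q₂) = 2 * (C + C') - 6 * s ^ 2 + 2 * (p₁ - q₁) ^ 2 := by
      rw [hs']; linear_combination (-2) * hl.eq_C' - 2 * hl.eq_C
    rw [this, hd]; ring
  have key := obstr4_eq_of_real (a := a) hcomm hs' rfl he rfl hm rfl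
  rw [hk, h3, h4] at key
  generalize hk0 : 2 * (C + C') - 6 * s ^ 2 - l ^ 2 + 2 * a * n = k₀ at *
  generalize he0 : C - C' - 3 * s * l + D l = e₀ at *
  simp only [hT, map_add, map_sub, Derivation.leibniz, smul_eq_mul, pow_succ, pow_zero, one_mul,
    hDσ, map_zero, derivation_ofNat, hYD] at key
  -- Under `φ` every term containing `σ` undifferentiated vanishes, and `D σ = 0`; only `Y σ`
  -- remains.
  have key' := congrArg φ key
  simp only [map_add, map_sub, map_mul, map_neg, map_zero, map_ofNat, hσ, map_pow,
    Derivation.leibniz, smul_eq_mul, derivation_ofNat] at key' ⊢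
  linear_combination -key'

end FormalSolutions

end VCNLS

/-! ### Reality of `f, g` and the relation `(f g²)ₓ = 0`. -/

namespace VCNLS

section ReductionOfCoefficients

variable {A : Type*} [CommRing A] [Algebra ℂ A]

theorem adapted_one {X Y : Derivation ℂ A A} (hXY : ∀ x, X (Y x) = Y (X x)) {σ : A}
    (hσ : X σ = 0) : Adapted X Y X (Y - σ • X) 1 1 σ where
  comm x := by
    simp [Derivation.leibniz, hXY, hσ]
  X_eq x := by ring
  Y_eq x := by simp
  ω_mul := by ring
  closed := by simp [hσ]

variable {X Y : Derivation ℂ A A} {i f fi g gi h f' f'i g' h' : A}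

/-- If the formal solutions with `Φₓ = 1`, `Φₜ = σ ∈ {0, 1}` exist for all `u₀`, the two equations
of the system have the same leading coefficients. -/
theorem coeff_eq_of_formalSolutions (hXY : ∀ x, X (Y x) = Y (X x)) (hi : i * i = -1)
    (hf : f * fi = 1) (hf' : f' * f'i = 1) (hg : g * gi = 1) (hred : ∀ x : A, x ^ 2 = 0 → x = 0)
    {E Ei : A} (hE : E * Ei = 1) (hXE : X E = 0) (hYE : Y E = E)
    (H : ∀ σ w wi : A, (σ = 0 ∨ σ = 1) → w * wi = 1 → ∃ (u v : ℕ → A) (vi : A), u 0 = w ∧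
      v 0 * vi = 1 ∧ IsFormalSolution X Y 1 σ i f g h f' g' h' u v) :
    f = f' ∧ g = g' := by
  obtain ⟨u₁, v₁, r', hu₁, hr, hs₁⟩ := H 0 1 1 (Or.inl rfl) (one_mul 1)
  obtain ⟨hlead, hlead'⟩ := hs₁.leading (u₀i := 1) (by rw [hu₁, one_mul]) hr
  rw [hu₁] at hlead hlead'
  generalize v₁ 0 = r at hr hlead hlead'
  have hXr : X r = r * (r' * X r) := by linear_combination (-X r) * hr
  have hYr : Y r = r * (r' * Y r) := by linear_combination (-Y r) * hr
  generalize r' * X r = l at hXr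
  generalize r' * Y r = n at hYr
  -- With `Φₓ = 1` the relation `g u₀ v₀ = -2f` gives `v₀ = r/w` for `u₀ = w`. As `X w = 0`, the
  -- choice of `w` affects only `C` and `C'`, through `μ = w_t/w`.
  have key : ∀ σ w wi μ : A, (σ = 0 ∨ σ = 1) → w * wi = 1 → X w = 0 → Y w = w * μ →
      ∃ p₁ q₁ p₂ q₂ : A, LowLevels (i * fi * σ) (h * fi + i * fi * μ) (-i * f'i * σ + 2 * l)
        (h' * f'i + -i * f'i * (n - σ * l - μ) + (-i * f'i * σ) * l + l ^ 2 + X l) p₁ q₁ p₂ q₂ ∧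
      obstr3 X (Y - σ • X) (i * fi) (-i * f'i) p₁ q₁ p₂ q₂ = 0 := by
    intro σ w wi μ hσ hw hXw hYw
    have hXσ : X σ = 0 := by
      rcases hσ with rfl | rfl
      · exact map_zero X
      · exact X.map_one_eq_zero
    obtain ⟨u, v, vi, hu0, hv0, hs⟩ := H σ w wi hσ hw
    have hu : u 0 * wi = 1 := by rw [hu0, hw]
    have hv : v 0 = wi * r := by
      have h1 := (hs.leading hu hv0).1
      rw [hu0] at h1
      linear_combination (gi * wi) * h1 - gi * wi * hlead - v 0 * g * gi * hw
        - (v 0 - wi * r) * hg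
    have hXwi : X wi = 0 := by rw [derivation_inv X hw, hXw]; ring
    have hYwi : Y wi = -(wi * μ) := by
      rw [derivation_inv Y hw, hYw]; linear_combination (-wi * μ) * hw
    obtain ⟨p₁, q₁, p₂, q₂, hl, h3, -⟩ := hs.exists_obstr_eq_zero (adapted_one hXY hXσ) hf hf' hu
      hv0
      (a := i * fi) (c := h * fi) (a' := -i * f'i) (c' := h' * f'i) (w := 0) (L := 0) (m := μ)
      (L' := l) (m' := n - σ * l - μ) (by linear_combination i * hf)
      (by linear_combination h * hf) (by linear_combination (-i) * hf')
      (by linear_combination h' * hf') (by rw [X.map_one_eq_zero, mul_zero])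
      (by rw [hu0, hXw, mul_zero]) (by simp [hu0, hXw, hYw])
      (by rw [hv]; simp [hXwi, hXr]; ring) (by rw [hv]; simp [hXwi, hYwi, hXr, hYr]; ring)
    refine ⟨p₁, q₁, p₂, q₂, ?_, h3⟩
    convert hl using 1
    · ring
    · rw [map_zero]; ring
    · ring
    · ring
  -- Compare `u₀ = 1` (`μ = 0`) with `u₀ = E` (`μ = 1`): `C` changes by `a` and `C'` by `-a'`.
  have key2 : ∀ σ : A, (σ = 0 ∨ σ = 1) → 3 * X (i * fi + -i * f'i)
      = -(i * fi * σ + (-i * f'i * σ + 2 * l)) * (i * fi + -i * f'i) := by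
    intro σ hσ
    obtain ⟨p₁, q₁, p₂, q₂, hl, h3⟩ := key σ 1 1 0 hσ (one_mul 1) X.map_one_eq_zero
      (by rw [Y.map_one_eq_zero, mul_zero])
    obtain ⟨r₁, s₁, r₂, s₂, hl', h3'⟩ := key σ E Ei 1 hσ hE hXE (by rw [hYE, mul_one])
    refine LowLevels.deriv_add_eq hl ?_ h3 h3'
    convert hl' using 1 <;> ring
  -- Subtracting the equations for `σ = 0` and `σ = 1` leaves `(a + a')² = 0`.
  have hsq := hred (i * fi + -i * f'i) (by
    linear_combination key2 1 (Or.inr rfl) - key2 0 (Or.inl rfl))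
  have hff : f = f' := by
    linear_combination (i * f * f') * hsq + f' * hf - f * hf' - (f * f' * (fi - f'i)) * hi
  refine ⟨hff, ?_⟩
  rw [← hff] at hlead'
  linear_combination r' * hlead - r' * hlead' - (g - g') * hr

/-- If moreover formal solutions with `Φₜ = 0` and with `Φₜ = 0`, `Φₜₜ = 2` at a point exist, then
`(f g²)ₓ = 0` there. -/
theorem eval_deriv_eq_zero_of_formalSolutions (φ : A →+* ℂ) (hXY : ∀ x, X (Y x) = Y (X x))
    (hXi : X i = 0) (hi : i * i = -1) (hf : f * fi = 1) (hg : g * gi = 1) {σ : A}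
    (hXσ : X σ = 0) (hσ : φ σ = 0) (hYσ : φ (Y σ) = 2)
    (H : ∀ τ : A, (τ = 0 ∨ τ = σ) → ∃ (u v : ℕ → A) (vi : A), u 0 = 1 ∧
      v 0 * vi = 1 ∧ IsFormalSolution X Y 1 τ i f g h f g h' u v) :
    φ (X (f * g ^ 2)) = 0 := by
  obtain ⟨u₁, v₁, r', hu₁, hr, hs₁⟩ := H 0 (Or.inl rfl)
  obtain ⟨hlead, -⟩ := hs₁.leading (u₀i := 1) (by rw [hu₁, one_mul]) hr
  rw [hu₁] at hlead
  generalize v₁ 0 = r at hr hlead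
  have hXr : X r = r * (r' * X r) := by linear_combination (-X r) * hr
  have hYr : Y r = r * (r' * Y r) := by linear_combination (-Y r) * hr
  generalize r' * X r = l at hXr
  generalize r' * Y r = n at hYr
  -- This is the value of `p₁ + q₁`, the same for every `Φ` with `Φₓ = 1` and `u₀ = 1`.
  obtain ⟨s, hs⟩ := exists_intCast_mul_eq (show (3 : ℤ) ≠ 0 by norm_num) (-l)
  push_cast at hs
  have hXfi : X fi = -(fi ^ 2 * X f) := derivation_inv X hf
  have key : ∀ τ : A, (τ = 0 ∨ τ = σ) →
      ∃ p₁ q₁ p₂ q₂ : A, LowLevels (i * fi * τ) (h * fi) (-(i * fi) * τ + 2 * l)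
        (h' * fi - i * fi * n + l ^ 2 + X l) p₁ q₁ p₂ q₂ ∧
      obstr3 X (Y - τ • X) (i * fi) (-(i * fi)) p₁ q₁ p₂ q₂ = 0 ∧
      obstr4 X (Y - τ • X) (i * fi) (-(i * fi)) p₁ q₁ p₂ q₂ = 0 := by
    intro τ hτ
    have hXτ : X τ = 0 := by
      rcases hτ with rfl | rfl
      · exact map_zero X
      · exact hXσ
    obtain ⟨u, v, vi, hu0, hv0, hs⟩ := H τ hτ
    have hu : u 0 * 1 = 1 := by rw [hu0, one_mul]
    have hv : v 0 = r := by
      have h1 := (hs.leading hu hv0).1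
      rw [hu0] at h1
      linear_combination gi * h1 - gi * hlead - (v 0 - r) * hg
    obtain ⟨p₁, q₁, p₂, q₂, hl, h34⟩ := hs.exists_obstr_eq_zero (adapted_one hXY hXτ) hf hf hu hv0
      (a := i * fi) (c := h * fi) (a' := -(i * fi)) (c' := h' * fi) (w := 0) (L := 0) (m := 0)
      (L' := l) (m' := n - τ * l) (by linear_combination i * hf)
      (by linear_combination h * hf) (by linear_combination (-i) * hf)
      (by linear_combination h' * hf) (by rw [X.map_one_eq_zero, mul_zero])
      (by rw [hu0, X.map_one_eq_zero, mul_zero]) (by simp [hu0])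
      (by rw [hv, hXr]) (by rw [hv]; simp [hXr, hYr]; ring)
    refine ⟨p₁, q₁, p₂, q₂, ?_, h34⟩
    convert hl using 1
    · ring
    · rw [map_zero]; ring
    · ring
    · ring
  -- The witness `c` is left open and read off from `affine_obstr`: its left side does not involve
  -- `τ`, so one constant serves both `τ = 0` and `τ = σ`.
  have key2 : ∃ c : ℂ, ∀ τ : A, (τ = 0 ∨ τ = σ) →
      c = 8 * φ (Y τ) * φ (i * fi * (X (i * fi) - 2 * s * (i * fi))) := by
    refine ⟨?_, fun τ hτ => ?_⟩
    rotate_left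
    obtain ⟨p₁, q₁, p₂, q₂, hl, h3, h4⟩ := key τ hτ
    have hXτ : X τ = 0 := by
      rcases hτ with rfl | rfl
      · exact map_zero X
      · exact hXσ
    have hφτ : φ τ = 0 := by
      rcases hτ with rfl | rfl
      · exact map_zero φ
      · exact hσ
    exact hl.affine_obstr (Y := Y) φ (adapted_one hXY hXτ).comm (fun x => by simp)
      (fun x => (hXY x).symm) hXτ hφτ hs (derivation_log_comm hXY hr hXr hYr).symm h3 h4
  obtain ⟨c, key2⟩ := key2
  have e0 := key2 0 (Or.inl rfl)
  have e1 := key2 σ (Or.inr rfl)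
  rw [e0, map_zero, map_zero, hYσ] at e1
  have e2 : φ (i * fi * (X (i * fi) - 2 * s * (i * fi))) = 0 := by
    linear_combination (-1 / 16 : ℂ) * e1
  have h5 : g * X r + r * X g = -2 * X f := by
    have h := congrArg X hlead
    simp only [Derivation.leibniz, smul_eq_mul, derivation_ofNat, map_neg, one_mul, one_pow,
      mul_one] at h
    linear_combination h
  -- With `l = f_x/f - g_x/g` and `3 s = -l`, the slope `a (a_x - 2 s a)` at `a = i/f` is `(f g²)ₓ /
  -- (3 f³ g²)`.
  have h6 : 3 * (i * fi * (X (i * fi) - 2 * s * (i * fi))) * (f ^ 3 * g ^ 2) = X (f * g ^ 2) := by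
    rw [hXr] at h5
    have h7 : l * f * g = g * X f - f * X g := by
      refine eq_of_intCast_mul (two_ne_zero : (2 : ℤ) ≠ 0) ?_
      push_cast
      linear_combination (g * l + X g) * hlead - g * h5
    simp only [Derivation.leibniz, smul_eq_mul, pow_two, hXi, hXfi]
    calc _ = -(i * i) * (3 * (f * fi) ^ 3 * g ^ 2 * X f + 6 * s * (f * fi) ^ 2 * f * g ^ 2) := by
            ring
      _ = _ := by
        rw [hi, hf]; linear_combination 2 * f * g ^ 2 * hs - 2 * g * h7
  rw [← h6, map_mul, map_mul, e2]
  ring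

end ReductionOfCoefficients

end VCNLS

/-! ### Translation between Painlevé expansions and formal solutions in `An W`. -/

namespace VCNLS

open TopologicalSpace Topology An

section Evaluation

variable {W : Opens (ℝ × ℝ)} {Φ : ℝ × ℝ → ℝ} {ω σ : An W}

theorem ev_laurent {u : ℕ → ℝ × ℝ → ℂ} {uA : ℕ → An W} (hu : ∀ j z, ev z (uA j) = u j z) (α n : ℤ)
    (z : W) : ev z (laurent α uA n) = laurentCoeff α u n z := by
  unfold laurent laurentCoeff
  split_ifs
  · exact hu _ z
  · simp

theorem ev_conv3 {u v : ℕ → ℝ × ℝ → ℂ} {uA vA : ℕ → An W} (hu : ∀ j z, ev z (uA j) = u j z)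
    (hv : ∀ j z, ev z (vA j) = v j z) (k : ℕ) (z : W) :
    ev z (conv3 uA vA k) = cubicConv u v k z := by
  simp only [conv3_eq_sum, cubicConv, map_sum, map_mul, hu, hv]

theorem ev_seriesDeriv_dx (hω : ∀ z : W, ev z ω = ((Dx Φ z : ℝ) : ℂ))
    {c : ℤ → ℝ × ℝ → ℂ} {cA : ℤ → An W}
    (hc : ∀ n z, ev z (cA n) = c n z) (n : ℤ) (z : W) :
    ev z (seriesDeriv dx ω cA n) = seriesDx Φ c n z := by
  simp only [seriesDeriv, seriesDx, map_add, map_mul, map_intCast, map_one, hω, hc, ev_dx (hc n)]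

theorem ev_seriesDeriv_dt (hσ : ∀ z : W, ev z σ = ((Dt Φ z : ℝ) : ℂ))
    {c : ℤ → ℝ × ℝ → ℂ} {cA : ℤ → An W}
    (hc : ∀ n z, ev z (cA n) = c n z) (n : ℤ) (z : W) :
    ev z (seriesDeriv dt σ cA n) = seriesDt Φ c n z := by
  simp only [seriesDeriv, seriesDt, map_add, map_mul, map_intCast, map_one, hσ, hc, ev_dt (hc n)]

theorem ev_algResidual (hω : ∀ z : W, ev z ω = ((Dx Φ z : ℝ) : ℂ))
    (hσ : ∀ z : W, ev z σ = ((Dt Φ z : ℝ) : ℂ))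
    {s : ℂ} {f g h : ℝ × ℝ → ℂ} {sA fA gA hA : An W} (hs : ∀ z, ev z sA = s)
    (hf : ∀ z, ev z fA = f z) (hg : ∀ z, ev z gA = g z) (hh : ∀ z, ev z hA = h z)
    {u v : ℕ → ℝ × ℝ → ℂ} {uA vA : ℕ → An W} (hu : ∀ j z, ev z (uA j) = u j z)
    (hv : ∀ j z, ev z (vA j) = v j z) (α β n : ℤ) (z : W) :
    ev z (algResidual (A := An W) dx dt ω σ sA fA gA hA α uA β vA n)
      = residual s f g h Φ α u β v n z := by
  simp only [algResidual, residual, map_add, map_mul, hs, hf, hg, hh,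
    ev_seriesDeriv_dt hσ (ev_laurent hu α), ev_seriesDeriv_dx hω (ev_seriesDeriv_dx hω
      (ev_laurent hu α)), ev_laurent (ev_conv3 hu hv), ev_laurent hu]

theorem algResidual_of_le {A : Type*} [CommRing A] [Algebra ℂ A] (X Y : Derivation ℂ A A)
    (ω σ s f g h : A) {α n : ℤ} (hn : n ≤ α - 2) (u v : ℕ → A) (β : ℤ) :
    algResidual X Y ω σ s f g h α u β v n
      = f * (((n : A) + 1) * ω * (((n : A) + 2) * ω * laurent α u (n + 2)))
        + g * laurent (2 * α + β) (conv3 u v) n := by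
  simp only [algResidual, seriesDeriv, laurent_of_lt u (show n < α by omega),
    laurent_of_lt u (show n + 1 < α by omega), map_zero, mul_zero, add_zero, zero_add, Int.cast_add,
    Int.cast_one, show n + 1 + 1 = n + 2 by ring]
  ring

/-- Dominant balance in the first equation. If `2α + β < α - 2` the term `g u₀² v₀` stands alone, if
`2α + β > α - 2` the term `α(α-1) f Φₓ² u₀` does, and neither vanishes. Equality means `α + β = -2`,
which two negative integers satisfy only as `-1, -1`. -/
theorem leading_orders_eq {α β : ℤ} (hα : α < 0) (hβ : β < 0) {s f g h : An W} {u v : ℕ → An W}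
    (z : W) (hω : ev z ω ≠ 0) (hf : ev z f ≠ 0) (hg : ev z g ≠ 0) (hu : ev z (u 0) ≠ 0)
    (hv : ev z (v 0) ≠ 0) (hres : ∀ n, algResidual (A := An W) dx dt ω σ s f g h α u β v n = 0) :
    α = -1 ∧ β = -1 := by
  have hconv : conv3 u v 0 = u 0 * u 0 * v 0 := by simp [conv3]
  rcases lt_trichotomy (2 * α + β) (α - 2) with hlt | heq | hgt
  · have h1 := congrArg (ev z) (hres (2 * α + β))
    rw [algResidual_of_le _ _ _ _ _ _ _ _ hlt.le, laurent_of_lt u (by omega)] at h1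
    have h2 := laurent_add (2 * α + β) (conv3 u v) 0
    rw [Nat.cast_zero, add_zero] at h2
    rw [h2, hconv] at h1
    simp [hg, hu, hv] at h1
  · exact ⟨by omega, by omega⟩
  · have h1 := congrArg (ev z) (hres (α - 2))
    rw [algResidual_of_le _ _ _ _ _ _ _ _ le_rfl, laurent_of_lt _ hgt] at h1
    have h2 := laurent_add α u 0
    rw [Nat.cast_zero, add_zero] at h2
    rw [show α - 2 + 2 = α by ring, h2] at h1
    have h3 : (α : ℂ) - 2 + 1 ≠ 0 := by
      intro h; have : α - 2 + 1 = 0 := by exact_mod_cast h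
      omega
    have h4 : (α : ℂ) ≠ 0 := by exact_mod_cast hα.ne
    have e2 : ev z 2 = 2 := map_ofNat _ 2
    simp [hf, hω, hu, h3, h4, e2] at h1

/-- The imaginary unit as a constant function. -/
def iC (W : Opens (ℝ × ℝ)) : An W := algebraMap ℂ (An W) Complex.I

theorem ev_iC (z : W) : ev z (iC W) = Complex.I := (ev z).commutes _

theorem iC_mul_iC : iC W * iC W = -1 := by
  rw [iC, ← map_mul, Complex.I_mul_I, map_neg, map_one]

theorem analyticOnNhd_ofReal {s : Set (ℝ × ℝ)} {F : ℝ × ℝ → ℝ} (hF : AnalyticOnNhd ℝ F s) :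
    AnalyticOnNhd ℝ (fun z => (F z : ℂ)) s :=
  fun z hz => (Complex.ofRealCLM.analyticAt _).comp (hF z hz)

theorem analyticOnNhd_conj {s : Set (ℝ × ℝ)} {F : ℝ × ℝ → ℂ} (hF : AnalyticOnNhd ℝ F s) :
    AnalyticOnNhd ℝ (fun z => conj (F z)) s :=
  fun z hz => (Complex.conjCLE.toContinuousLinearMap.analyticAt _).comp (hF z hz)

theorem analyticOnNhd_re {s : Set (ℝ × ℝ)} {F : ℝ × ℝ → ℂ} (hF : AnalyticOnNhd ℝ F s) :
    AnalyticOnNhd ℝ (fun z => (F z).re) s :=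
  fun z hz => (Complex.reCLM.analyticAt _).comp (hF z hz)

theorem analyticOnNhd_im {s : Set (ℝ × ℝ)} {F : ℝ × ℝ → ℂ} (hF : AnalyticOnNhd ℝ F s) :
    AnalyticOnNhd ℝ (fun z => (F z).im) s :=
  fun z hz => (Complex.imCLM.analyticAt _).comp (hF z hz)

theorem Dx_ofReal {F : ℝ × ℝ → ℝ} {z : ℝ × ℝ} (hF : DifferentiableAt ℝ F z) :
    Dx (fun z => (F z : ℂ)) z = ((Dx F z : ℝ) : ℂ) :=
  (hasDerivAt_Dx hF).ofReal_comp.deriv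

theorem Dt_ofReal {F : ℝ × ℝ → ℝ} {z : ℝ × ℝ} (hF : DifferentiableAt ℝ F z) :
    Dt (fun z => (F z : ℂ)) z = ((Dt F z : ℝ) : ℂ) :=
  (hasDerivAt_Dt hF).ofReal_comp.deriv

/-- The restriction to `W` of a real function that is analytic there. -/
def ofRealFun (F : ℝ × ℝ → ℝ) (hF : AnalyticOnNhd ℝ F W) : An W :=
  ofFun (fun z => (F z : ℂ)) (analyticOnNhd_ofReal hF)

theorem ev_ofRealFun (F : ℝ × ℝ → ℝ) (hF : AnalyticOnNhd ℝ F W) (z : W) :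
    ev z (ofRealFun F hF) = (F z : ℂ) := rfl

theorem dx_ofRealFun (F : ℝ × ℝ → ℝ) (hF : AnalyticOnNhd ℝ F W) :
    dx (ofRealFun F hF) = ofRealFun (Dx F) (analyticOnNhd_Dx hF) := ext_ev fun z => by
  rw [ev_dx (F := fun z => (F z : ℂ)) (ev_ofRealFun F hF), Dx_ofReal (hF z z.2).differentiableAt,
    ev_ofRealFun]

theorem dt_ofRealFun (F : ℝ × ℝ → ℝ) (hF : AnalyticOnNhd ℝ F W) :
    dt (ofRealFun F hF) = ofRealFun (Dt F) (analyticOnNhd_Dt hF) := ext_ev fun z => by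
  rw [ev_dt (F := fun z => (F z : ℂ)) (ev_ofRealFun F hF), Dt_ofReal (hF z z.2).differentiableAt,
    ev_ofRealFun]

theorem ofRealFun_congr {F G : ℝ × ℝ → ℝ} (hF : AnalyticOnNhd ℝ F W) (hG : AnalyticOnNhd ℝ G W)
    (h : ∀ z ∈ (W : Set (ℝ × ℝ)), F z = G z) : ofRealFun F hF = ofRealFun G hG :=
  ext_ev fun z => by rw [ev_ofRealFun, ev_ofRealFun, h z z.2]

end Evaluation

section Expansions

variable {W : Opens (ℝ × ℝ)} {Φ : ℝ × ℝ → ℝ} {f g h : ℝ × ℝ → ℂ} {ω σ fA gA hA fA' gA' hA' : An W}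

/-- Elements of `An W` that represent the coefficients, their conjugates, and the derivatives
of `Φ`. -/
structure Represents (f g h : ℝ × ℝ → ℂ) (Φ : ℝ × ℝ → ℝ) (ω σ fA gA hA fA' gA' hA' : An W) :
    Prop where
  ω_eq : ∀ z : W, ev z ω = ((Dx Φ z : ℝ) : ℂ)
  σ_eq : ∀ z : W, ev z σ = ((Dt Φ z : ℝ) : ℂ)
  f_eq : ∀ z : W, ev z fA = f z
  g_eq : ∀ z : W, ev z gA = g z
  h_eq : ∀ z : W, ev z hA = h z
  f_eq' : ∀ z : W, ev z fA' = conj (f z)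
  g_eq' : ∀ z : W, ev z gA' = conj (g z)
  h_eq' : ∀ z : W, ev z hA' = conj (h z)

theorem Represents.algResidual_eq_zero (hR : Represents f g h Φ ω σ fA gA hA fA' gA' hA')
    {α β : ℤ} {u v : ℕ → ℝ × ℝ → ℂ} (hE : IsPainleveExpansion f g h W Φ α β u v) {uA vA : ℕ → An W}
    (hu : ∀ j z, ev z (uA j) = u j z) (hv : ∀ j z, ev z (vA j) = v j z) :
    (∀ n, algResidual (A := An W) dx dt ω σ (iC W) fA gA hA α uA β vA n = 0) ∧
    (∀ n, algResidual (A := An W) dx dt ω σ (-iC W) fA' gA' hA' β vA α uA n = 0) := by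
  refine ⟨fun n => ext_ev fun z => ?_, fun n => ext_ev fun z => ?_⟩
  · rw [ev_algResidual hR.ω_eq hR.σ_eq ev_iC hR.f_eq hR.g_eq hR.h_eq hu hv, map_zero]
    exact hE.eq_u n z z.2
  · rw [ev_algResidual hR.ω_eq hR.σ_eq (s := -Complex.I)
      (f := fun w => conj (f w)) (g := fun w => conj (g w)) (h := fun w => conj (h w))
      (fun z => by rw [map_neg, ev_iC])
      hR.f_eq' hR.g_eq' hR.h_eq' hv hu, map_zero]
    exact hE.eq_v n z z.2

theorem Represents.isPainleveExpansion (hR : Represents f g h Φ ω σ fA gA hA fA' gA' hA')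
    {uA vA : ℕ → An W}
    (hs : IsFormalSolution (A := An W) dx dt ω σ (iC W) fA gA hA fA' gA' hA' uA vA)
    (hu0 : ∀ z, ev z (uA 0) ≠ 0) (hv0 : ∀ z, ev z (vA 0) ≠ 0) :
    IsPainleveExpansion f g h W Φ (-1) (-1) (fun j => toFun (uA j)) (fun j => toFun (vA j)) where
  analytic_u j := analytic (uA j)
  analytic_v j := analytic (vA j)
  u_zero_ne := toFun_ne_zero hu0
  v_zero_ne := toFun_ne_zero hv0
  eq_u n z hz := (ev_algResidual hR.ω_eq hR.σ_eq ev_iC hR.f_eq hR.g_eq hR.h_eq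
    (fun j z => (toFun_apply (uA j) z).symm) (fun j z => (toFun_apply (vA j) z).symm) (-1) (-1) n
    ⟨z, hz⟩).symm.trans (by rw [hs.eq_u n, map_zero])
  eq_v n z hz := (ev_algResidual hR.ω_eq hR.σ_eq (s := -Complex.I)
    (fun z => by rw [map_neg, ev_iC]) hR.f_eq' hR.g_eq' hR.h_eq'
    (fun j z => (toFun_apply (vA j) z).symm) (fun j z => (toFun_apply (uA j) z).symm) (-1) (-1) n
    ⟨z, hz⟩).symm.trans (by rw [hs.eq_v n, map_zero])

end Expansions

end VCNLS

/-! ### The real form of the conditions, and quadrature in `∫ g dx`. -/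

namespace VCNLS

open TopologicalSpace Topology An

/-- Derivative in `∫ G dx`. -/
def Dint (G V : ℝ × ℝ → ℝ) : ℝ × ℝ → ℝ := fun z => Dx V z / G z

/-- The part of the real potential that the obstructions control. -/
def redPotential (K G h₁ : ℝ × ℝ → ℝ) : ℝ × ℝ → ℝ := fun z =>
  2 * h₁ z / K z - (2 * Dx (fun w => Dx G w / G w) z - (Dx G z / G z) ^ 2) / (2 * G z ^ 2)

/-- The real form of `potentialDefect`. -/
def defect (K G h₁ γ : ℝ × ℝ → ℝ) : ℝ × ℝ → ℝ := fun z =>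
  Dint G (Dint G (redPotential K G h₁)) z + (1 / K z) ^ 2 *
    (-(2 * γ z + Dt K z / K z) ^ 2 + Dt K z / K z * (2 * γ z + Dt K z / K z)
      - (2 * Dt γ z + Dt (fun w => Dt K w / K w) z)
      + (Dt (fun w => Dt G w / G w) z + (Dt G z / G z) ^ 2) - Dt K z / K z * (Dt G z / G z))

theorem map_potentialDefect {A : Type*} [CommRing A] [Algebra ℂ A] (φ : A →ₐ[ℂ] ℂ)
    (Y : Derivation ℂ A A) (Ki κ Gt γ V₂ : A) :
    φ (potentialDefect Y Ki κ Gt γ V₂) = φ V₂ + φ Ki ^ 2 * (-(2 * φ γ + φ κ) ^ 2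
      + φ κ * (2 * φ γ + φ κ) - (2 * φ (Y γ) + φ (Y κ)) + (φ (Y Gt) + φ Gt ^ 2) - φ κ * φ Gt) := by
  simp only [potentialDefect, map_add, map_sub, map_mul, map_neg, map_pow, map_ofNat]

section Analyticity

variable {s : Set (ℝ × ℝ)} {K G h₁ : ℝ × ℝ → ℝ}

theorem analyticOnNhd_Dx_div (hG : AnalyticOnNhd ℝ G s) (hG0 : ∀ z ∈ s, G z ≠ 0) {V : ℝ × ℝ → ℝ}
    (hV : AnalyticOnNhd ℝ V s) : AnalyticOnNhd ℝ (fun z => Dx V z / G z) s :=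
  (analyticOnNhd_Dx hV).div hG hG0

theorem analyticOnNhd_Dt_div (hG : AnalyticOnNhd ℝ G s) (hG0 : ∀ z ∈ s, G z ≠ 0) {V : ℝ × ℝ → ℝ}
    (hV : AnalyticOnNhd ℝ V s) : AnalyticOnNhd ℝ (fun z => Dt V z / G z) s :=
  (analyticOnNhd_Dt hV).div hG hG0

theorem analyticOnNhd_redPotential (hK : AnalyticOnNhd ℝ K s) (hK0 : ∀ z ∈ s, K z ≠ 0)
    (hG : AnalyticOnNhd ℝ G s) (hG0 : ∀ z ∈ s, G z ≠ 0) (hh : AnalyticOnNhd ℝ h₁ s) :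
    AnalyticOnNhd ℝ (redPotential K G h₁) s := by
  refine ((analyticOnNhd_const.mul hh).div hK hK0).sub
    (((analyticOnNhd_const.mul (analyticOnNhd_Dx (analyticOnNhd_Dx_div hG hG0 hG))).sub
      ((analyticOnNhd_Dx_div hG hG0 hG).pow 2)).div (analyticOnNhd_const.mul (hG.pow 2))
      fun z hz => ?_)
  exact mul_ne_zero two_ne_zero (pow_ne_zero 2 (hG0 z hz))

end Analyticity

section CoeffData

variable {W : Opens (ℝ × ℝ)} {F G h₁ h₂ : ℝ × ℝ → ℝ}

theorem exists_coeffData (hF : AnalyticOnNhd ℝ F W) (hG : AnalyticOnNhd ℝ G W)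
    (hh₁ : AnalyticOnNhd ℝ h₁ W) (hh₂ : AnalyticOnNhd ℝ h₂ W)
    (hF0 : ∀ z ∈ (W : Set (ℝ × ℝ)), F z ≠ 0) (hG0 : ∀ z ∈ (W : Set (ℝ × ℝ)), G z ≠ 0)
    (hK : ∀ z ∈ (W : Set (ℝ × ℝ)), Dx (fun w => F w * G w ^ 2) z = 0) :
    ∃ gi K Ki κ Gx Gt V V₁ V₂ : An W,
      CoeffData (A := An W) dx dt (iC W) (ofRealFun F hF) (ofRealFun G hG) gi K Ki κ Gx Gt
        (ofRealFun h₁ hh₁) V V₁ V₂ ∧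
      (∀ z, ev z (dx (ofRealFun h₂ hh₂ - Gt))
        = ((Dx (fun w => h₂ w - Dt G w / G w) z : ℝ) : ℂ)) ∧
      (∀ z, ev z (potentialDefect (A := An W) dt Ki κ Gt (ofRealFun h₂ hh₂ - Gt) V₂)
        = ((defect (fun w => F w * G w ^ 2) G h₁ (fun w => h₂ w - Dt G w / G w) z : ℝ) : ℂ)) := by
  have hKa : AnalyticOnNhd ℝ (fun w => F w * G w ^ 2) W := hF.mul (hG.pow 2)
  have hK0 : ∀ z ∈ (W : Set (ℝ × ℝ)), F z * G z ^ 2 ≠ 0 := fun z hz =>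
    mul_ne_zero (hF0 z hz) (pow_ne_zero 2 (hG0 z hz))
  have hGi : AnalyticOnNhd ℝ (fun z => 1 / G z) W := analyticOnNhd_const.div hG hG0
  have hKi : AnalyticOnNhd ℝ (fun z => 1 / (F z * G z ^ 2)) W := analyticOnNhd_const.div hKa hK0
  have hκ := analyticOnNhd_Dt_div hKa hK0 hKa
  have hGx := analyticOnNhd_Dx_div hG hG0 hG
  have hGt := analyticOnNhd_Dt_div hG hG0 hG
  have hV := analyticOnNhd_redPotential hKa hK0 hG hG0 hh₁
  have hV₁ : AnalyticOnNhd ℝ (Dint G (redPotential (fun w => F w * G w ^ 2) G h₁)) W :=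
    analyticOnNhd_Dx_div hG hG0 hV
  have hV₂ : AnalyticOnNhd ℝ (Dint G (Dint G (redPotential (fun w => F w * G w ^ 2) G h₁))) W :=
    analyticOnNhd_Dx_div hG hG0 hV₁
  have hγa : AnalyticOnNhd ℝ (fun w => h₂ w - Dt G w / G w) W := hh₂.sub hGt
  have hγ : ofRealFun h₂ hh₂ - ofRealFun _ hGt = ofRealFun _ hγa := ext_ev fun z => by
    simp [ev_ofRealFun]
  refine ⟨ofRealFun _ hGi, ofRealFun _ hKa, ofRealFun _ hKi, ofRealFun _ hκ, ofRealFun _ hGx,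
    ofRealFun _ hGt, ofRealFun _ hV, ofRealFun _ hV₁, ofRealFun _ hV₂,
    ⟨iC_mul_iC, dx.map_algebraMap _, dt.map_algebraMap _, ?_, ?_, ?_, ?_, ?_, ?_, ?_, ?_, ?_, ?_⟩,
    fun z => ?_, fun z => ?_⟩
  · exact ext_ev fun z => by simp [ev_ofRealFun]
  · refine ext_ev fun z => ?_
    simp only [map_mul, ev_ofRealFun, map_one, ← Complex.ofReal_mul]
    rw [mul_one_div_cancel (hK0 z z.2), Complex.ofReal_one]
  · refine ext_ev fun z => ?_
    simp only [map_mul, ev_ofRealFun, map_one, ← Complex.ofReal_mul]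
    rw [mul_one_div_cancel (hG0 z z.2), Complex.ofReal_one]
  · rw [dx_ofRealFun]
    exact ext_ev fun z => by rw [ev_ofRealFun, hK z z.2, map_zero, Complex.ofReal_zero]
  · rw [dt_ofRealFun]
    refine ext_ev fun z => ?_
    simp only [map_mul, ev_ofRealFun, ← Complex.ofReal_mul]
    rw [mul_div_cancel₀ _ (hK0 z z.2)]
  · rw [dx_ofRealFun]
    refine ext_ev fun z => ?_
    simp only [map_mul, ev_ofRealFun, ← Complex.ofReal_mul]
    rw [mul_div_cancel₀ _ (hG0 z z.2)]
  · rw [dt_ofRealFun]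
    refine ext_ev fun z => ?_
    simp only [map_mul, ev_ofRealFun, ← Complex.ofReal_mul]
    rw [mul_div_cancel₀ _ (hG0 z z.2)]
  · rw [dx_ofRealFun]
    refine ext_ev fun z => ?_
    simp only [map_mul, map_add, map_sub, map_pow, map_ofNat, ev_ofRealFun]
    have hz := hG0 z z.2
    have hKz := hK0 z z.2
    norm_cast
    unfold redPotential
    field_simp
    ring
  · rw [dx_ofRealFun]
    refine ext_ev fun z => ?_
    simp only [map_mul, ev_ofRealFun, ← Complex.ofReal_mul, Dint]
    rw [mul_div_cancel₀ _ (hG0 z z.2)]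
  · rw [dx_ofRealFun]
    refine ext_ev fun z => ?_
    simp only [map_mul, ev_ofRealFun, ← Complex.ofReal_mul]
    rw [Dint.eq_1 G (Dint G _), mul_div_cancel₀ _ (hG0 z z.2)]
  · rw [hγ, dx_ofRealFun, ev_ofRealFun]
  · have e : ∀ {R : ℝ × ℝ → ℝ} (hR : AnalyticOnNhd ℝ R W),
        ev z (dt (ofRealFun R hR)) = ((Dt R z : ℝ) : ℂ) := fun hR => by
      rw [dt_ofRealFun, ev_ofRealFun]
    rw [hγ]
    refine (map_potentialDefect (A := An W) (ev z) dt _ _ _ _ _).trans ?_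
    rw [e hγa, e hκ, e hGt, defect]
    simp only [ev_ofRealFun]
    norm_cast

end CoeffData

section Potential

variable {I J : Set ℝ} {x₀ : ℝ}

theorem hasDerivAt_intX (hI : IsOpen I) (hI' : I.OrdConnected) (hx₀ : x₀ ∈ I) {F : ℝ × ℝ → ℝ}
    {t : ℝ} (hF : ContinuousOn (fun x => F (x, t)) I) {x : ℝ} (hx : x ∈ I) :
    HasDerivAt (fun x => intX x₀ F (x, t)) (F (x, t)) x := by
  have h1 : IntervalIntegrable (fun s => F (s, t)) MeasureTheory.volume x₀ x :=
    (hF.mono (hI'.uIcc_subset hx₀ hx)).intervalIntegrable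
  exact intervalIntegral.integral_hasDerivAt_right h1
    (hF.stronglyMeasurableAtFilter hI x hx) (hF.continuousAt (hI.mem_nhds hx))

theorem intX_self (F : ℝ × ℝ → ℝ) (t : ℝ) : intX x₀ F (x₀, t) = 0 := by
  simp [intX]

/-- Second-order equations in `∫ g dx` and their explicit solutions. -/
theorem exists_quadrature_iff (hI : IsOpen I) (hI' : I.OrdConnected) (hx₀ : x₀ ∈ I)
    {G τ : ℝ × ℝ → ℝ} {t : ℝ} (hG : ContinuousOn (fun x => G (x, t)) I)
    (hG0 : ∀ x ∈ I, G (x, t) ≠ 0) (hτ : ContinuousOn (fun x => τ (x, t)) I) {P P₁ P₂ : ℝ → ℝ}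
    (hP : ∀ x ∈ I, HasDerivAt P (G (x, t) * P₁ x) x)
    (hP₁ : ∀ x ∈ I, HasDerivAt P₁ (G (x, t) * P₂ x) x) (c : ℝ) :
    (∃ d₀ d₁, ∀ x ∈ I, P x = c / 2 * intX x₀ G (x, t) ^ 2
        + intX x₀ (fun w => G w * intX x₀ τ w) (x, t) + d₀ * intX x₀ G (x, t) + d₁) ↔
      ∀ x ∈ I, P₂ x = c + τ (x, t) / G (x, t) := by
  have hX : ∀ x ∈ I, HasDerivAt (fun x => intX x₀ G (x, t)) (G (x, t)) x := fun x hx =>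
    hasDerivAt_intX hI hI' hx₀ hG hx
  have hZ₁ : ∀ x ∈ I, HasDerivAt (fun x => intX x₀ τ (x, t)) (τ (x, t)) x := fun x hx =>
    hasDerivAt_intX hI hI' hx₀ hτ hx
  have hZ : ∀ x ∈ I, HasDerivAt (fun x => intX x₀ (fun w => G w * intX x₀ τ w) (x, t))
      (G (x, t) * intX x₀ τ (x, t)) x := fun x hx =>
    hasDerivAt_intX (F := fun w => G w * intX x₀ τ w) hI hI' hx₀
      (hG.mul fun y hy => (hZ₁ y hy).continuousAt.continuousWithinAt) hx
  have hQ₁ : ∀ d₀, ∀ x ∈ I, HasDerivAt (fun x => c * intX x₀ G (x, t) + intX x₀ τ (x, t) + d₀)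
      (c * G (x, t) + τ (x, t)) x := fun d₀ x hx =>
    (((hX x hx).const_mul c).add (hZ₁ x hx)).add_const d₀
  have hQ : ∀ d₀ d₁, ∀ x ∈ I, HasDerivAt (fun x => c / 2 * intX x₀ G (x, t) ^ 2
        + intX x₀ (fun w => G w * intX x₀ τ w) (x, t) + d₀ * intX x₀ G (x, t) + d₁)
      (G (x, t) * (c * intX x₀ G (x, t) + intX x₀ τ (x, t) + d₀)) x := fun d₀ d₁ x hx => by
    refine ((((((hX x hx).pow 2).const_mul (c / 2)).add (hZ x hx)).add
      ((hX x hx).const_mul d₀)).add_const d₁).congr_deriv ?_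
    push_cast
    ring
  have hpre : IsPreconnected I := hI'.isPreconnected
  constructor
  · rintro ⟨d₀, d₁, h⟩
    have h1 : ∀ x ∈ I, P₁ x = c * intX x₀ G (x, t) + intX x₀ τ (x, t) + d₀ := fun x hx => by
      have := (hP x hx).unique ((hQ d₀ d₁ x hx).congr_of_eventuallyEq
        (Filter.eventuallyEq_of_mem (hI.mem_nhds hx) h))
      exact mul_left_cancel₀ (hG0 x hx) this
    intro x hx
    have := (hP₁ x hx).unique ((hQ₁ d₀ x hx).congr_of_eventuallyEq
        (Filter.eventuallyEq_of_mem (hI.mem_nhds hx) h1))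
    have hne := hG0 x hx
    field_simp
    linear_combination this
  · intro h
    have h1 : Set.EqOn P₁ (fun x => c * intX x₀ G (x, t) + intX x₀ τ (x, t) + P₁ x₀) I := by
      refine hI.eqOn_of_deriv_eq hpre
        (fun x hx => (hP₁ x hx).differentiableAt.differentiableWithinAt)
        (fun x hx => (hQ₁ _ x hx).differentiableAt.differentiableWithinAt) (fun x hx => ?_) hx₀ ?_
      · rw [(hP₁ x hx).deriv, (hQ₁ _ x hx).deriv, h x hx]
        have hne := hG0 x hx
        field_simp
      · simp only [intX_self]; ring
    -- All the integrals vanish at `x₀`, so the constants of integration are the values there.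
    refine ⟨P₁ x₀, P x₀, hI.eqOn_of_deriv_eq hpre
        (fun x hx => (hP x hx).differentiableAt.differentiableWithinAt)
        (fun x hx => (hQ _ _ x hx).differentiableAt.differentiableWithinAt) (fun x hx => ?_) hx₀ ?_⟩
    · rw [(hP x hx).deriv, (hQ _ _ x hx).deriv, h1 hx]
    · simp only [intX_self]; ring

end Potential

end VCNLS

/-! ### Vanishing defect is equivalent to the explicit potential. -/

namespace VCNLS

open Topology

theorem eventually_slice_fst {U : Set (ℝ × ℝ)} (hU : IsOpen U) {z : ℝ × ℝ} (hz : z ∈ U) :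
    ∀ᶠ x in 𝓝 z.1, (x, z.2) ∈ U :=
  (hU.preimage (by fun_prop : Continuous fun x : ℝ => (x, z.2))).mem_nhds hz

theorem eventually_slice_snd {U : Set (ℝ × ℝ)} (hU : IsOpen U) {z : ℝ × ℝ} (hz : z ∈ U) :
    ∀ᶠ t in 𝓝 z.2, (z.1, t) ∈ U :=
  (hU.preimage (by fun_prop : Continuous fun t : ℝ => (z.1, t))).mem_nhds hz

section

variable {E : Type*} [NormedAddCommGroup E] [NormedSpace ℝ E] {U : Set (ℝ × ℝ)} {F G : ℝ × ℝ → E}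
  {z : ℝ × ℝ}

theorem Dx_congr_on (hU : IsOpen U) (h : ∀ w ∈ U, F w = G w) (hz : z ∈ U) : Dx F z = Dx G z :=
  Filter.EventuallyEq.deriv_eq ((eventually_slice_fst hU hz).mono fun _ hx => h _ hx)

theorem Dt_congr_on (hU : IsOpen U) (h : ∀ w ∈ U, F w = G w) (hz : z ∈ U) : Dt F z = Dt G z :=
  Filter.EventuallyEq.deriv_eq ((eventually_slice_snd hU hz).mono fun _ hx => h _ hx)

theorem Dx_comp_snd (k : ℝ → E) (z : ℝ × ℝ) : Dx (fun w => k w.2) z = 0 :=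
  deriv_const z.1 (k z.2)

theorem Dt_comp_snd (k : ℝ → E) (z : ℝ × ℝ) : Dt (fun w => k w.2) z = deriv k z.2 := rfl

end

section Potential

variable {I J : Set ℝ} {x₀ : ℝ} {U : Set (ℝ × ℝ)} {F G h₁ h₂ : ℝ × ℝ → ℝ} {K γ : ℝ → ℝ}

/-- `K` and `γ` are arbitrary functions a priori; they inherit differentiability from the analytic
functions of `(x, t)` that they represent. -/
theorem differentiableAt_of_eq_comp_snd (hU : IsOpen U) {R : ℝ × ℝ → ℝ}
    (hR : AnalyticOnNhd ℝ R U) {k : ℝ → ℝ} (h : ∀ z ∈ U, R z = k z.2) {z : ℝ × ℝ} (hz : z ∈ U) :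
    DifferentiableAt ℝ k z.2 :=
  (hasDerivAt_Dt (hR z hz).differentiableAt).differentiableAt.congr_of_eventuallyEq
    ((eventually_slice_snd hU hz).mono fun _ ht => (h _ ht).symm)

theorem tau1_eq (hU : IsOpen U) (hK : ∀ z ∈ U, F z * G z ^ 2 = K z.2) {z : ℝ × ℝ} (hz : z ∈ U) :
    tau1 K G z = -(1 / 2) * Dt (fun w => Dt G w / (F w * G w ^ 2)) z := by
  rw [tau1, Dt_congr_on hU (G := fun w => Dt G w / (F w * G w ^ 2))
    (fun w hw => by rw [hK w hw]) hz]

/-- In the `K⁻²` term the part depending on `t` alone is `-2 τ₀/K`, and the rest, `(g_tt - (K_t/K)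
g_t)/(K² g)`, is `-2 τ₁/(K g)`. -/
theorem defect_eq (hU : IsOpen U) (hF : AnalyticOnNhd ℝ F U) (hG : AnalyticOnNhd ℝ G U)
    (hh₂ : AnalyticOnNhd ℝ h₂ U) (hF0 : ∀ z ∈ U, F z ≠ 0) (hG0 : ∀ z ∈ U, G z ≠ 0)
    (hK : ∀ z ∈ U, F z * G z ^ 2 = K z.2) (hγ : ∀ z ∈ U, h₂ z - Dt G z / G z = γ z.2)
    {z : ℝ × ℝ} (hz : z ∈ U) :
    defect (fun w => F w * G w ^ 2) G h₁ (fun w => h₂ w - Dt G w / G w) z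
      = Dint G (Dint G (redPotential (fun w => F w * G w ^ 2) G h₁)) z
        - 2 / K z.2 * (tau0 K γ z.2 + tau1 K G z / G z) := by
  have hKa : AnalyticOnNhd ℝ (fun w => F w * G w ^ 2) U := hF.mul (hG.pow 2)
  have hGta := analyticOnNhd_Dt_div hG hG0 hG
  have hKd := differentiableAt_of_eq_comp_snd hU hKa hK hz
  have hγd := differentiableAt_of_eq_comp_snd hU (hh₂.sub hGta) hγ hz
  have hK0 : ∀ z ∈ U, K z.2 ≠ 0 := fun z hz => hK z hz ▸ mul_ne_zero (hF0 z hz)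
    (pow_ne_zero 2 (hG0 z hz))
  have e1 : ∀ w ∈ U, Dt (fun w => F w * G w ^ 2) w = deriv K w.2 := fun w hw => by
    rw [Dt_congr_on hU hK hw, Dt_comp_snd]
  have e2 : Dt (fun w => Dt (fun w => F w * G w ^ 2) w / (F w * G w ^ 2)) z
      = deriv (logDeriv K) z.2 := by
    rw [Dt_congr_on hU (G := fun w => logDeriv K w.2)
      (fun w hw => by rw [e1 w hw, hK w hw, logDeriv_apply]) hz, Dt_comp_snd]
  have e3 : Dt (fun w => h₂ w - Dt G w / G w) z = deriv γ z.2 := by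
    rw [Dt_congr_on hU hγ hz, Dt_comp_snd]
  have hd : HasDerivAt (fun t => G (z.1, t)) (Dt G z) z.2 :=
    hasDerivAt_Dt (hG z hz).differentiableAt
  have hdd : HasDerivAt (fun t => Dt G (z.1, t)) (Dt (Dt G) z) z.2 :=
    hasDerivAt_Dt (analyticOnNhd_Dt hG z hz).differentiableAt
  have e4 : Dt (fun w => Dt G w / G w) z
      = (Dt (Dt G) z * G z - Dt G z * Dt G z) / G z ^ 2 := (hdd.div hd (hG0 z hz)).deriv
  have e5 : tau1 K G z
      = -(1 / 2) * ((Dt (Dt G) z * K z.2 - Dt G z * deriv K z.2) / K z.2 ^ 2) := by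
    rw [tau1]
    exact congrArg _ (hdd.div hKd.hasDerivAt (hK0 z hz)).deriv
  have e6 : deriv (fun s => γ s * K s) z.2 = deriv γ z.2 * K z.2 + γ z.2 * deriv K z.2 :=
    (hγd.hasDerivAt.mul hKd.hasDerivAt).deriv
  rw [defect, e1 z hz, e2, e3, e4, e5, tau0, e6, hK z hz, hγ z hz]
  have h1 := hK0 z hz
  have h2 := hG0 z hz
  field_simp
  ring

theorem redPotential_eq (hG : AnalyticOnNhd ℝ G U) (hG0 : ∀ z ∈ U, G z ≠ 0) {K : ℝ × ℝ → ℝ}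
    {z : ℝ × ℝ} (hz : z ∈ U) (hK0 : K z ≠ 0) :
    K z / 2 * redPotential K G h₁ z
      = h₁ z - K z / 2 * (Dx (Dx G) z / G z ^ 3 - 3 / 2 * (Dx G z ^ 2 / G z ^ 4)) := by
  have e : Dx (fun w => Dx G w / G w) z
      = (Dx (Dx G) z * G z - Dx G z * Dx G z) / G z ^ 2 :=
    ((hasDerivAt_Dx (analyticOnNhd_Dx hG z hz).differentiableAt).div
      (hasDerivAt_Dx (hG z hz).differentiableAt) (hG0 z hz)).deriv
  rw [redPotential, e]
  have := hG0 z hz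
  field_simp
  ring

theorem exists_potential_iff (hI : IsOpen I) (hI' : I.OrdConnected) (hJ : IsOpen J) (hx₀ : x₀ ∈ I)
    (hF : AnalyticOnNhd ℝ F (I ×ˢ J)) (hG : AnalyticOnNhd ℝ G (I ×ˢ J))
    (hh₁ : AnalyticOnNhd ℝ h₁ (I ×ˢ J)) (hh₂ : AnalyticOnNhd ℝ h₂ (I ×ˢ J))
    (hF0 : ∀ z ∈ I ×ˢ J, F z ≠ 0) (hG0 : ∀ z ∈ I ×ˢ J, G z ≠ 0)
    (hK : ∀ z ∈ I ×ˢ J, F z * G z ^ 2 = K z.2)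
    (hγ : ∀ z ∈ I ×ˢ J, h₂ z - Dt G z / G z = γ z.2) :
    (∃ δ₀ δ₁ : ℝ → ℝ, ∀ z ∈ I ×ˢ J, h₁ z = potential x₀ G K γ δ₀ δ₁ z) ↔
      ∀ z ∈ I ×ˢ J, defect (fun w => F w * G w ^ 2) G h₁ (fun w => h₂ w - Dt G w / G w) z = 0 := by
  have hU : IsOpen (I ×ˢ J) := hI.prod hJ
  have hKa : AnalyticOnNhd ℝ (fun w => F w * G w ^ 2) (I ×ˢ J) := hF.mul (hG.pow 2)
  have hK0 : ∀ z ∈ I ×ˢ J, F z * G z ^ 2 ≠ 0 := fun z hz =>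
    mul_ne_zero (hF0 z hz) (pow_ne_zero 2 (hG0 z hz))
  set V := redPotential (fun w => F w * G w ^ 2) G h₁ with hVdef
  have hV : AnalyticOnNhd ℝ V (I ×ˢ J) := analyticOnNhd_redPotential hKa hK0 hG hG0 hh₁
  have hV₁ : AnalyticOnNhd ℝ (Dint G V) (I ×ˢ J) := analyticOnNhd_Dx_div hG hG0 hV
  have hslice : ∀ {R : ℝ × ℝ → ℝ}, AnalyticOnNhd ℝ R (I ×ˢ J) → ∀ t ∈ J,
      ContinuousOn (fun x => R (x, t)) I := fun hR t ht =>
    hR.continuousOn.comp (by fun_prop : Continuous fun x : ℝ => (x, t)).continuousOn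
      fun x hx => ⟨hx, ht⟩
  -- Continuity is seen after replacing `K` by the analytic function `f g²`.
  have hτ : ∀ t ∈ J, ContinuousOn (fun x => tau1 K G (x, t)) I := fun t ht =>
    (hslice (analyticOnNhd_const.mul (analyticOnNhd_Dt ((analyticOnNhd_Dt hG).div hKa hK0))) t
      ht).congr fun x hx => tau1_eq hU hK ⟨hx, ht⟩
  have key : ∀ t ∈ J, ((∃ d₀ d₁, ∀ x ∈ I, K t / 2 * V (x, t)
        = tau0 K γ t / 2 * intX x₀ G (x, t) ^ 2
        + intX x₀ (fun w => G w * intX x₀ (tau1 K G) w) (x, t) + d₀ * intX x₀ G (x, t) + d₁) ↔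
      ∀ x ∈ I, K t / 2 * Dint G (Dint G V) (x, t) = tau0 K γ t + tau1 K G (x, t) / G (x, t)) :=
    fun t ht => by
      refine exists_quadrature_iff hI hI' hx₀ (hslice hG t ht) (fun x hx => hG0 _ ⟨hx, ht⟩)
        (hτ t ht) (P := fun x => K t / 2 * V (x, t)) (P₁ := fun x => K t / 2 * Dint G V (x, t))
        (P₂ := fun x => K t / 2 * Dint G (Dint G V) (x, t)) (fun x hx => ?_) (fun x hx => ?_) _
      · refine ((hasDerivAt_Dx (hV (x, t) ⟨hx, ht⟩).differentiableAt).const_mul (K t / 2)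
          ).congr_deriv ?_
        have := hG0 (x, t) ⟨hx, ht⟩
        rw [Dint]
        field_simp
      · refine ((hasDerivAt_Dx (hV₁ (x, t) ⟨hx, ht⟩).differentiableAt).const_mul (K t / 2)
          ).congr_deriv ?_
        have := hG0 (x, t) ⟨hx, ht⟩
        rw [Dint.eq_1 G (Dint G V)]
        field_simp
  have hred : ∀ z ∈ I ×ˢ J, K z.2 / 2 * V z = h₁ z - K z.2 / 2 *
      (Dx (Dx G) z / G z ^ 3 - 3 / 2 * (Dx G z ^ 2 / G z ^ 4)) := fun z hz => by
    have := redPotential_eq (h₁ := h₁) hG hG0 (K := fun w => F w * G w ^ 2) hz (hK0 z hz)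
    simpa only [hK z hz] using this
  have hdefect : ∀ z ∈ I ×ˢ J,
      (defect (fun w => F w * G w ^ 2) G h₁ (fun w => h₂ w - Dt G w / G w) z = 0 ↔
        K z.2 / 2 * Dint G (Dint G V) z = tau0 K γ z.2 + tau1 K G z / G z) := fun z hz => by
    rw [defect_eq hU hF hG hh₂ hF0 hG0 hK hγ hz]
    have h0 : K z.2 ≠ 0 := hK z hz ▸ hK0 z hz
    rw [sub_eq_zero, div_mul_eq_mul_div, div_mul_eq_mul_div, eq_div_iff h0, div_eq_iff two_ne_zero]
    constructor <;> intro h <;> linear_combination h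
  constructor
  · rintro ⟨δ₀, δ₁, h⟩ z hz
    refine (hdefect z hz).2 ((key z.2 hz.2).1 ⟨δ₀ z.2, δ₁ z.2, fun x hx => ?_⟩ z.1 hz.1)
    have e := hred (x, z.2) ⟨hx, hz.2⟩
    rw [h (x, z.2) ⟨hx, hz.2⟩, potential] at e
    linear_combination e
  · intro h
    -- The constants are chosen for each `t` separately, with value zero off `J`; no regularity in
    -- `t` is claimed for `δ₀, δ₁`.
    have h1 : ∀ t, ∃ d₀ d₁, t ∈ J → ∀ x ∈ I, K t / 2 * V (x, t)
        = tau0 K γ t / 2 * intX x₀ G (x, t) ^ 2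
        + intX x₀ (fun w => G w * intX x₀ (tau1 K G) w) (x, t) + d₀ * intX x₀ G (x, t) + d₁ :=
      fun t => by
        by_cases ht : t ∈ J
        · obtain ⟨d₀, d₁, hd⟩ := (key t ht).2 fun x hx => (hdefect (x, t) ⟨hx, ht⟩).1 (h _ ⟨hx, ht⟩)
          exact ⟨d₀, d₁, fun _ => hd⟩
        · exact ⟨0, 0, fun ht' => absurd ht' ht⟩
    choose δ₀ δ₁ hδ using h1
    refine ⟨δ₀, δ₁, fun z hz => ?_⟩
    have e := hδ z.2 hz.2 z.1 hz.1
    rw [hred z hz] at e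
    rw [potential]
    linear_combination e

end Potential

end VCNLS

/-! ### Sufficiency. -/

namespace VCNLS

open TopologicalSpace Topology An

section Sufficiency

variable {W : Opens (ℝ × ℝ)} {Φ : ℝ × ℝ → ℝ} {f g h : ℝ × ℝ → ℂ}

theorem represents_of_real (hf : AnalyticOnNhd ℝ f W) (hg : AnalyticOnNhd ℝ g W)
    (hh : AnalyticOnNhd ℝ h W) (hΦ : AnalyticOnNhd ℝ Φ W)
    (hre : ∀ z ∈ (W : Set (ℝ × ℝ)), (f z).im = 0 ∧ (g z).im = 0) :
    Represents (W := W) f g h Φ (ofRealFun _ (analyticOnNhd_Dx hΦ))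
      (ofRealFun _ (analyticOnNhd_Dt hΦ))
      (ofRealFun _ (analyticOnNhd_re hf)) (ofRealFun _ (analyticOnNhd_re hg))
      (ofRealFun _ (analyticOnNhd_re hh) + iC W * ofRealFun _ (analyticOnNhd_im hh))
      (ofRealFun _ (analyticOnNhd_re hf)) (ofRealFun _ (analyticOnNhd_re hg))
      (ofRealFun _ (analyticOnNhd_re hh) - iC W * ofRealFun _ (analyticOnNhd_im hh)) where
  ω_eq _ := rfl
  σ_eq _ := rfl
  f_eq z := by rw [ev_ofRealFun]; exact Complex.ext (by simp) (by simp [(hre z z.2).1])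
  g_eq z := by rw [ev_ofRealFun]; exact Complex.ext (by simp) (by simp [(hre z z.2).2])
  h_eq z := by
    rw [map_add, map_mul, ev_iC, ev_ofRealFun, ev_ofRealFun]
    exact Complex.ext (by simp) (by simp)
  f_eq' z := by rw [ev_ofRealFun]; exact Complex.ext (by simp) (by simp [(hre z z.2).1])
  g_eq' z := by rw [ev_ofRealFun]; exact Complex.ext (by simp) (by simp [(hre z z.2).2])
  h_eq' z := by
    rw [map_sub, map_mul, ev_iC, ev_ofRealFun, ev_ofRealFun]
    exact Complex.ext (by simp) (by simp)

theorem Represents.isFormalSolution {ω σ fA gA hA fA' gA' hA' : An W}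
    (hR : Represents f g h Φ ω σ fA gA hA fA' gA' hA') {u v : ℕ → ℝ × ℝ → ℂ}
    (hE : IsPainleveExpansion f g h W Φ (-1) (-1) u v) :
    IsFormalSolution (A := An W) dx dt ω σ (iC W) fA gA hA fA' gA' hA'
      (fun j => ofFun (u j) (hE.analytic_u j)) (fun j => ofFun (v j) (hE.analytic_v j)) :=
  have h := hR.algResidual_eq_zero hE (uA := fun j => ofFun (u j) (hE.analytic_u j))
    (vA := fun j => ofFun (v j) (hE.analytic_v j)) (fun _ _ => rfl) (fun _ _ => rfl)
  ⟨h.1, h.2⟩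

theorem ev_ne_zero_of_mul_eq_one {F G : An W} (h : F * G = 1) (z : W) : ev z F ≠ 0 :=
  left_ne_zero_of_mul_eq_one (by rw [← map_mul, h, map_one] : ev z F * ev z G = 1)

theorem passesPainleveTest_of_real {U : Set (ℝ × ℝ)} (hf : AnalyticOnNhd ℝ f U)
    (hg : AnalyticOnNhd ℝ g U) (hh : AnalyticOnNhd ℝ h U) (hf0 : ∀ z ∈ U, f z ≠ 0)
    (hg0 : ∀ z ∈ U, g z ≠ 0) (hre : ∀ z ∈ U, (f z).im = 0 ∧ (g z).im = 0)
    (hK : ∀ z ∈ U, Dx (fun w => (f w).re * (g w).re ^ 2) z = 0)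
    (hγ : ∀ z ∈ U, Dx (fun w => (h w).im - Dt (fun w => (g w).re) w / (g w).re) z = 0)
    (hdef : ∀ z ∈ U, defect (fun w => (f w).re * (g w).re ^ 2) (fun w => (g w).re)
      (fun w => (h w).re) (fun w => (h w).im - Dt (fun w => (g w).re) w / (g w).re) z = 0) :
    PassesPainleveTest U f g h := by
  -- The free functions sit at the resonances 0, 3 and 4, all in the `u`-series.
  refine ⟨-1, -1, by norm_num, by norm_num, ![Sum.inl 0, Sum.inl 3, Sum.inl 4],
    fun W' Φ hW' hWU hΦ => ?_⟩
  obtain ⟨W, rfl⟩ : ∃ W : Opens (ℝ × ℝ), (W : Set (ℝ × ℝ)) = W' := ⟨⟨W', hW'⟩, rfl⟩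
  have hfW := hf.mono hWU
  have hgW := hg.mono hWU
  have hhW := hh.mono hWU
  have hfr0 : ∀ z ∈ (W : Set (ℝ × ℝ)), (f z).re ≠ 0 := fun z hz h0 =>
    hf0 z (hWU hz) (Complex.ext h0 (hre z (hWU hz)).1)
  have hgr0 : ∀ z ∈ (W : Set (ℝ × ℝ)), (g z).re ≠ 0 := fun z hz h0 =>
    hg0 z (hWU hz) (Complex.ext h0 (hre z (hWU hz)).2)
  have hR := represents_of_real hfW hgW hhW hΦ.analytic fun z hz => hre z (hWU hz)
  obtain ⟨gi, K, Ki, κ, Gx, Gt, V, V₁, V₂, hC, hCγ, hCdef⟩ :=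
    exists_coeffData (analyticOnNhd_re hfW) (analyticOnNhd_re hgW) (analyticOnNhd_re hhW)
      (analyticOnNhd_im hhW) hfr0 hgr0 fun z hz => hK z (hWU hz)
  generalize hωe : ofRealFun _ (analyticOnNhd_Dx hΦ.analytic) = ω at hR
  generalize hσe : ofRealFun _ (analyticOnNhd_Dt hΦ.analytic) = σ at hR
  obtain ⟨ωi, hω⟩ := exists_mul_eq_one (F := ω) fun z => by
    rw [hR.ω_eq, Complex.ofReal_ne_zero]; exact hΦ.nonchar z z.2
  have hσ : dx σ = dt ω := by
    rw [← hωe, ← hσe, dx_ofRealFun, dt_ofRealFun]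
    exact ofRealFun_congr _ _ fun z hz => Dx_Dt_comm (hΦ.analytic z hz)
  obtain ⟨D, T, hA⟩ := exists_adapted (A := An W) dx dt dx_dt hω hσ
  generalize ofRealFun _ (analyticOnNhd_re hfW) = fA at hR hC
  generalize ofRealFun _ (analyticOnNhd_re hgW) = gA at hR hC
  generalize ofRealFun _ (analyticOnNhd_re hhW) = h₁ at hR hC
  generalize ofRealFun _ (analyticOnNhd_im hhW) = h₂ at hR hC hCγ hCdef
  have hγ' : dx (h₂ - Gt) = 0 := ext_ev fun z => by
    rw [hCγ, hγ z (hWU z.2), map_zero, Complex.ofReal_zero]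
  have hdef' : potentialDefect (A := An W) dt Ki κ Gt (h₂ - Gt) V₂ = 0 := ext_ev fun z => by
    rw [hCdef, hdef z (hWU z.2), map_zero, Complex.ofReal_zero]
  constructor
  · intro a ha ha0
    obtain ⟨wi, hw⟩ := exists_mul_eq_one (F := ofFun (a 0) (ha 0)) fun z => ha0 0 rfl z z.2
    obtain ⟨c, hc⟩ := exists_mul_eq_one (F := (-2 : An W)) fun z => by
      rw [map_neg, map_ofNat]; norm_num
    -- The leading relation forces `v₀ = -2 f Φₓ²/(g u₀)`; this exhibits its inverse.
    have hv : -2 * (fA * ω ^ 2 * gi * wi)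
        * (c * (gA ^ 2 * Ki * ωi ^ 2 * gA * ofFun (a 0) (ha 0))) = 1 := by
      calc -2 * (fA * ω ^ 2 * gi * wi) * (c * (gA ^ 2 * Ki * ωi ^ 2 * gA * ofFun (a 0) (ha 0)))
          = -2 * c * (fA * (gA ^ 2 * Ki)) * (ω * ωi) ^ 2 * (gA * gi)
            * (ofFun (a 0) (ha 0) * wi) := by ring
        _ = 1 := by rw [hc, hC.f_unit, hω, hC.g_mul, hw]; ring
    obtain ⟨u, v, hu0, hv0, hu3, hu4, hs⟩ := hC.exists_solution hA hw hv
      (by linear_combination (-2 * fA * ω ^ 2) * hC.g_mul * (ofFun (a 0) (ha 0) * wi)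
            + (-2 * fA * ω ^ 2) * hw)
      hγ' hdef' (ofFun (a 1) (ha 1)) (ofFun (a 2) (ha 2))
    rw [← hu0] at hw
    rw [← hv0] at hv
    refine ⟨_, _, hR.isPainleveExpansion hs (ev_ne_zero_of_mul_eq_one hw)
      (ev_ne_zero_of_mul_eq_one hv), fun k z hz => ?_⟩
    fin_cases k
    · exact (toFun_apply (u 0) ⟨z, hz⟩).trans ((congrArg (ev ⟨z, hz⟩) hu0).trans rfl)
    · exact (toFun_apply (u 3) ⟨z, hz⟩).trans ((congrArg (ev ⟨z, hz⟩) hu3).trans rfl)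
    · exact (toFun_apply (u 4) ⟨z, hz⟩).trans ((congrArg (ev ⟨z, hz⟩) hu4).trans rfl)
  · intro u v u' v' hE hE' N hN j hj z hz
    obtain ⟨r, hr⟩ := exists_mul_eq_one (F := ofFun (u 0) (hE.analytic_u 0)) fun z =>
      hE.u_zero_ne z z.2
    obtain ⟨q, hq⟩ := exists_mul_eq_one (F := ofFun (v 0) (hE.analytic_v 0)) fun z =>
      hE.v_zero_ne z z.2
    obtain ⟨q', hq'⟩ := exists_mul_eq_one (F := ofFun (v' 0) (hE'.analytic_v 0)) fun z =>
      hE'.v_zero_ne z z.2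
    obtain ⟨h1, h2⟩ := hC.solution_unique hA hr hq hq' (hR.isFormalSolution hE)
      (hR.isFormalSolution hE') (ext_ev fun z => hN 0 (Nat.zero_le N) z z.2) N
      (fun h3 => ext_ev fun z => hN 1 h3 z z.2) (fun h4 => ext_ev fun z => hN 2 h4 z z.2) j hj
    exact ⟨congrArg (ev ⟨z, hz⟩) h1, congrArg (ev ⟨z, hz⟩) h2⟩

end Sufficiency

end VCNLS

/-! ### Necessity. -/

namespace VCNLS

open TopologicalSpace Topology An

section Scaling

variable {f g h : ℝ × ℝ → ℂ} {Φ : ℝ × ℝ → ℝ} {α β : ℤ} {u v : ℕ → ℝ × ℝ → ℂ}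

theorem laurentCoeff_const_mul (c : ℂ) (α : ℤ) (u : ℕ → ℝ × ℝ → ℂ) :
    laurentCoeff α (fun j z => c * u j z) = fun n z => c * laurentCoeff α u n z := by
  funext n z
  unfold laurentCoeff
  split_ifs <;> simp

theorem seriesDx_const_mul (c : ℂ) (Φ : ℝ × ℝ → ℝ) (r : ℤ → ℝ × ℝ → ℂ) :
    seriesDx Φ (fun n z => c * r n z) = fun n z => c * seriesDx Φ r n z := by
  funext n z
  simp only [seriesDx, Dx, deriv_const_mul_field]
  ring

theorem seriesDt_const_mul (c : ℂ) (Φ : ℝ × ℝ → ℝ) (r : ℤ → ℝ × ℝ → ℂ) :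
    seriesDt Φ (fun n z => c * r n z) = fun n z => c * seriesDt Φ r n z := by
  funext n z
  simp only [seriesDt, Dt, deriv_const_mul_field]
  ring

theorem cubicConv_const_mul {c c' : ℂ} (hc : c * c' = 1) (u v : ℕ → ℝ × ℝ → ℂ) :
    cubicConv (fun j z => c * u j z) (fun j z => c' * v j z)
      = fun k z => c * cubicConv u v k z := by
  funext k z
  simp only [cubicConv, Finset.mul_sum]
  refine Finset.sum_congr rfl fun p _ => Finset.sum_congr rfl fun q _ => ?_
  linear_combination (c * u q.1 z * u q.2 z * v p.2 z) * hc

theorem residual_const_mul {c c' : ℂ} (hc : c * c' = 1) (s : ℂ) (n : ℤ) (z : ℝ × ℝ) :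
    residual s f g h Φ α (fun j z => c * u j z) β (fun j z => c' * v j z) n z
      = c * residual s f g h Φ α u β v n z := by
  simp only [residual, laurentCoeff_const_mul, seriesDx_const_mul, seriesDt_const_mul,
    cubicConv_const_mul hc]
  ring

/-- As `u` and `v` are independent, the phase symmetry extends to scalings with `c c' = 1`: `u²v` is
multiplied by `c² c' = c`. -/
theorem IsPainleveExpansion.const_mul {W : Set (ℝ × ℝ)} (hE : IsPainleveExpansion f g h W Φ α β u v)
    {c c' : ℂ} (hc : c * c' = 1) :
    IsPainleveExpansion f g h W Φ α β (fun j z => c * u j z) (fun j z => c' * v j z) where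
  analytic_u j := analyticOnNhd_const.mul (hE.analytic_u j)
  analytic_v j := analyticOnNhd_const.mul (hE.analytic_v j)
  u_zero_ne z hz := mul_ne_zero (left_ne_zero_of_mul_eq_one hc) (hE.u_zero_ne z hz)
  v_zero_ne z hz := mul_ne_zero (right_ne_zero_of_mul_eq_one hc) (hE.v_zero_ne z hz)
  eq_u n z hz := by rw [residual_const_mul hc, hE.eq_u n z hz, mul_zero]
  eq_v n z hz := by
    rw [residual_const_mul ((mul_comm c' c).trans hc), hE.eq_v n z hz, mul_zero]

end Scaling

section Necessity

variable {W : Opens (ℝ × ℝ)} {Φ : ℝ × ℝ → ℝ} {f g h : ℝ × ℝ → ℂ}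
  {σ fA gA hA fA' gA' hA' : An W}

/-- The test allows any leading orders and slots. This extracts all that necessity uses: leading
orders `-1` and an arbitrary nowhere vanishing `u₀`. -/
theorem PassesPainleveTest.exists_formalSolution (hT : PassesPainleveTest W f g h)
    (hΦ : IsSingularManifold W Φ) (hR : Represents f g h Φ 1 σ fA gA hA fA' gA' hA')
    (hf0 : ∀ z ∈ (W : Set (ℝ × ℝ)), f z ≠ 0) (hg0 : ∀ z ∈ (W : Set (ℝ × ℝ)), g z ≠ 0)
    {w wi : An W} (hw : w * wi = 1) :
    ∃ (u v : ℕ → An W) (vi : An W), u 0 = w ∧ v 0 * vi = 1 ∧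
      IsFormalSolution (A := An W) dx dt 1 σ (iC W) fA gA hA fA' gA' hA' u v := by
  obtain ⟨α, β, hα, hβ, slot, H⟩ := hT
  obtain ⟨Ha, Hb⟩ := H W Φ W.isOpen le_rfl hΦ
  obtain ⟨z₀, hz₀, -⟩ := hΦ.exists_zero
  have hfA : ∀ z, ev z fA ≠ 0 := fun z => by rw [hR.f_eq]; exact hf0 z z.2
  have hgA : ∀ z, ev z gA ≠ 0 := fun z => by rw [hR.g_eq]; exact hg0 z z.2
  have horders : ∀ {u v : ℕ → ℝ × ℝ → ℂ}, IsPainleveExpansion f g h W Φ α β u v →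
      α = -1 ∧ β = -1 := fun {u v} hE =>
    leading_orders_eq (u := fun j => ofFun (u j) (hE.analytic_u j))
      (v := fun j => ofFun (v j) (hE.analytic_v j)) hα hβ ⟨z₀, hz₀⟩
      (by rw [map_one]; exact one_ne_zero) (hfA _) (hgA _) (hE.u_zero_ne z₀ hz₀)
      (hE.v_zero_ne z₀ hz₀) (hR.algResidual_eq_zero hE (fun _ _ => rfl) fun _ _ => rfl).1
  obtain ⟨u, v, hE, -⟩ := Ha (fun _ _ => 1) (fun _ => analyticOnNhd_const)
    fun _ _ _ _ => one_ne_zero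
  obtain ⟨rfl, rfl⟩ := horders hE
  -- Without a slot of level 0, condition (b) with `N = 0` would identify an expansion `(u, v)` with
  -- `(2u, v/2)`.
  obtain ⟨k, hk⟩ : ∃ k, slotLevel (slot k) = 0 := by
    by_contra hne
    push Not at hne
    have h2 := (Hb u v _ _ hE (hE.const_mul (c := 2) (c' := 2⁻¹) (by norm_num)) 0
      (fun k hk => absurd (Nat.le_zero.1 hk) (hne k)) 0 le_rfl z₀ hz₀).1
    exact hE.u_zero_ne z₀ hz₀ (by linear_combination -h2)
  obtain ⟨gi, hgi⟩ := exists_mul_eq_one hgA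
  have hw0 := ev_ne_zero_of_mul_eq_one hw
  have prescribe : ∀ a : An W, (∀ z, ev z a ≠ 0) → ∃ u v : ℕ → ℝ × ℝ → ℂ,
      IsPainleveExpansion f g h W Φ (-1) (-1) u v ∧
      ∀ z : W, Sum.elim u v (slot k) z = ev z a := fun a ha => by
    obtain ⟨u, v, hE, hs⟩ := Ha (fun _ => toFun a) (fun _ => analytic a)
      fun _ _ => toFun_ne_zero ha
    exact ⟨u, v, hE, fun z => (hs k z z.2).trans (toFun_apply a z)⟩
  obtain ⟨u, v, hE, hu⟩ : ∃ u v, IsPainleveExpansion f g h W Φ (-1) (-1) u v ∧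
      ∀ z : W, u 0 z = ev z w := by
    rcases hslot : slot k with j | j <;> rw [hslot] at hk prescribe <;>
      obtain rfl : j = 0 := hk
    · exact prescribe w hw0
    -- If the slot is that of `v₀`, prescribe `v₀ = -2f/(g w)`; the leading relation with `Φₓ = 1`
    -- returns `u₀ = w`.
    · have hgi0 := ev_ne_zero_of_mul_eq_one ((mul_comm gi gA).trans hgi)
      have hwi0 := ev_ne_zero_of_mul_eq_one ((mul_comm wi w).trans hw)
      obtain ⟨u, v, hE, hv⟩ := prescribe (-2 * (fA * gi * wi)) fun z => by
        rw [map_mul, map_neg, map_ofNat, map_mul, map_mul]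
        exact mul_ne_zero (by norm_num) (mul_ne_zero (mul_ne_zero (hfA z) (hgi0 z)) (hwi0 z))
      refine ⟨u, v, hE, fun z => ?_⟩
      obtain ⟨ui, hui⟩ := exists_mul_eq_one (F := ofFun (u 0) (hE.analytic_u 0)) fun z =>
        hE.u_zero_ne z z.2
      obtain ⟨vi, hvi⟩ := exists_mul_eq_one (F := ofFun (v 0) (hE.analytic_v 0)) fun z =>
        hE.v_zero_ne z z.2
      have hlead := congrArg (ev z) ((hR.isFormalSolution hE).leading hui hvi).1
      simp only [map_mul, map_neg, map_ofNat, map_pow, map_one, ev_ofFun] at hlead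
      have hvz : v 0 z = -2 * (ev z fA * ev z gi * ev z wi) := by
        have := hv z
        rwa [map_mul, map_neg, map_ofNat, map_mul, map_mul] at this
      have h1 : ev z gA * ev z gi = 1 := by rw [← map_mul, hgi, map_one]
      have h2 : ev z w * ev z wi = 1 := by rw [← map_mul, hw, map_one]
      rw [hvz] at hlead
      have h3 : ev z fA * (u 0 z * ev z wi - 1) = 0 := by
        linear_combination (-1 / 2) * hlead - ev z fA * ev z wi * u 0 z * h1
      have h4 := (mul_eq_zero.1 h3).resolve_left (hfA z)
      linear_combination ev z w * h4 - u 0 z * h2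
  obtain ⟨vi, hvi⟩ := exists_mul_eq_one (F := ofFun (v 0) (hE.analytic_v 0)) fun z =>
    hE.v_zero_ne z z.2
  exact ⟨_, _, vi, ext_ev hu, hvi, hR.isFormalSolution hE⟩

theorem isSingularManifold_graph {q : ℝ → ℝ} (hq : AnalyticOnNhd ℝ q Set.univ) {z₀ : ℝ × ℝ}
    (hz₀ : z₀ ∈ (W : Set (ℝ × ℝ))) (hq0 : q z₀.2 = 0) :
    IsSingularManifold W (fun z => z.1 - z₀.1 + q z.2) ∧
      ∀ z, Dx (fun z : ℝ × ℝ => z.1 - z₀.1 + q z.2) z = 1 ∧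
        Dt (fun z : ℝ × ℝ => z.1 - z₀.1 + q z.2) z = deriv q z.2 := by
  have hDx : ∀ z, Dx (fun z : ℝ × ℝ => z.1 - z₀.1 + q z.2) z = 1 := fun z => by
    simp [Dx]
  refine ⟨⟨?_, ⟨z₀, hz₀, by simp [hq0]⟩, fun z _ => by rw [hDx]; exact one_ne_zero⟩,
    fun z => ⟨hDx z, by simp [Dt]⟩⟩
  exact fun z _ => ((analyticAt_fst).sub analyticAt_const).add
    ((hq z.2 (Set.mem_univ _)).comp analyticAt_snd)

theorem PassesPainleveTest.im_eq_zero (hT : PassesPainleveTest W f g h)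
    (hf : AnalyticOnNhd ℝ f W) (hg : AnalyticOnNhd ℝ g W) (hh : AnalyticOnNhd ℝ h W)
    (hf0 : ∀ z ∈ (W : Set (ℝ × ℝ)), f z ≠ 0) (hg0 : ∀ z ∈ (W : Set (ℝ × ℝ)), g z ≠ 0)
    {z : ℝ × ℝ} (hz : z ∈ (W : Set (ℝ × ℝ))) : (f z).im = 0 ∧ (g z).im = 0 := by
  have hcf := analyticOnNhd_conj hf
  obtain ⟨fi, hfi⟩ := exists_mul_eq_one (F := ofFun f hf) fun z => hf0 z z.2
  obtain ⟨fi', hfi'⟩ := exists_mul_eq_one (F := ofFun _ hcf) fun z => by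
    rw [ev_ofFun]; exact (map_ne_zero _).2 (hf0 z z.2)
  obtain ⟨gi, hgi⟩ := exists_mul_eq_one (F := ofFun g hg) fun z => hg0 z z.2
  have hexp : AnalyticOnNhd ℝ (fun z : ℝ × ℝ => Real.exp z.2) W := fun z _ =>
    analyticAt_snd.rexp
  obtain ⟨Ei, hE⟩ := exists_mul_eq_one (F := ofRealFun _ hexp) fun z => by
    rw [ev_ofRealFun]; exact Complex.ofReal_ne_zero.2 (Real.exp_ne_zero _)
  obtain ⟨h1, h2⟩ := coeff_eq_of_formalSolutions (A := An W) (X := dx) (Y := dt) (i := iC W)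
    (f := ofFun f hf) (g := ofFun g hg) (h := ofFun h hh) (f' := ofFun _ hcf)
    (g' := ofFun _ (analyticOnNhd_conj hg)) (h' := ofFun _ (analyticOnNhd_conj hh))
    dx_dt iC_mul_iC hfi hfi' hgi
    (fun x hx => ext_ev fun z => by
      have := congrArg (ev z) hx
      rw [map_pow, map_zero] at this
      rw [map_zero]; exact pow_eq_zero_iff two_ne_zero |>.1 this) hE
    (by
      rw [dx_ofRealFun]
      exact ext_ev fun z => by rw [ev_ofRealFun, Dx_comp_snd, map_zero, Complex.ofReal_zero])
    (by
      rw [dt_ofRealFun]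
      exact ofRealFun_congr _ _ fun z _ => by rw [Dt_comp_snd, Real.deriv_exp])
    (fun σ w wi hσ hw => by
      -- The two slopes `Φₜ = 0, 1` come from the lines `q = 0` and `q = t - t₀` through the given
      -- point.
      obtain ⟨q, hq, hq0, hq1⟩ : ∃ q : ℝ → ℝ, AnalyticOnNhd ℝ q Set.univ ∧ q z.2 = 0 ∧
          ∀ w : W, ev w σ = ((deriv q w.1.2 : ℝ) : ℂ) := by
        rcases hσ with rfl | rfl
        · exact ⟨fun _ => 0, analyticOnNhd_const, rfl, fun w => by simp⟩
        · exact ⟨fun t => t - z.2, analyticOnNhd_id.sub analyticOnNhd_const, sub_self _,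
            fun w => by simp⟩
      obtain ⟨hΦ, hD⟩ := isSingularManifold_graph hq hz hq0
      exact hT.exists_formalSolution hΦ ⟨fun w => by rw [(hD w).1, map_one, Complex.ofReal_one],
        fun w => by rw [(hD w).2, hq1], fun _ => rfl, fun _ => rfl, fun _ => rfl, fun _ => rfl,
        fun _ => rfl, fun _ => rfl⟩ hf0 hg0 hw)
  exact ⟨Complex.conj_eq_iff_im.1 (congrArg (ev ⟨z, hz⟩) h1).symm,
    Complex.conj_eq_iff_im.1 (congrArg (ev ⟨z, hz⟩) h2).symm⟩

theorem PassesPainleveTest.exists_graph_solution (hT : PassesPainleveTest W f g h)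
    (hf : AnalyticOnNhd ℝ f W) (hg : AnalyticOnNhd ℝ g W) (hh : AnalyticOnNhd ℝ h W)
    (hf0 : ∀ z ∈ (W : Set (ℝ × ℝ)), f z ≠ 0) (hg0 : ∀ z ∈ (W : Set (ℝ × ℝ)), g z ≠ 0)
    {z₀ : ℝ × ℝ} (hz₀ : z₀ ∈ (W : Set (ℝ × ℝ))) {q : ℝ → ℝ} (hq : AnalyticOnNhd ℝ q Set.univ)
    (hq0 : q z₀.2 = 0) {σ : An W} (hσ : ∀ w : W, ev w σ = ((deriv q w.1.2 : ℝ) : ℂ)) :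
    ∃ (u v : ℕ → An W) (vi : An W), u 0 = 1 ∧ v 0 * vi = 1 ∧
      IsFormalSolution (A := An W) dx dt 1 σ (iC W)
        (ofRealFun _ (analyticOnNhd_re hf)) (ofRealFun _ (analyticOnNhd_re hg))
        (ofRealFun _ (analyticOnNhd_re hh) + iC W * ofRealFun _ (analyticOnNhd_im hh))
        (ofRealFun _ (analyticOnNhd_re hf)) (ofRealFun _ (analyticOnNhd_re hg))
        (ofRealFun _ (analyticOnNhd_re hh) - iC W * ofRealFun _ (analyticOnNhd_im hh)) u v := by
  obtain ⟨hΦ, hD⟩ := isSingularManifold_graph hq hz₀ hq0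
  have hR := represents_of_real hf hg hh hΦ.analytic fun z hz =>
    hT.im_eq_zero hf hg hh hf0 hg0 hz
  exact hT.exists_formalSolution hΦ ⟨fun w => by rw [(hD w).1, map_one, Complex.ofReal_one],
    fun w => by rw [(hD w).2, hσ], hR.f_eq, hR.g_eq, hR.h_eq, hR.f_eq', hR.g_eq', hR.h_eq'⟩
    hf0 hg0 (one_mul 1)

theorem PassesPainleveTest.Dx_eq_zero (hT : PassesPainleveTest W f g h)
    (hf : AnalyticOnNhd ℝ f W) (hg : AnalyticOnNhd ℝ g W) (hh : AnalyticOnNhd ℝ h W)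
    (hf0 : ∀ z ∈ (W : Set (ℝ × ℝ)), f z ≠ 0) (hg0 : ∀ z ∈ (W : Set (ℝ × ℝ)), g z ≠ 0)
    {z : ℝ × ℝ} (hz : z ∈ (W : Set (ℝ × ℝ))) :
    Dx (fun w => (f w).re * (g w).re ^ 2) z = 0 := by
  have hre := fun z hz => hT.im_eq_zero hf hg hh hf0 hg0 (z := z) hz
  have hfr := analyticOnNhd_re hf
  have hgr := analyticOnNhd_re hg
  obtain ⟨fi, hfi⟩ := exists_mul_eq_one (F := ofRealFun _ hfr) fun z => by
    rw [ev_ofRealFun, Complex.ofReal_ne_zero]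
    exact fun h0 => hf0 z z.2 (Complex.ext h0 (hre z z.2).1)
  obtain ⟨gi, hgi⟩ := exists_mul_eq_one (F := ofRealFun _ hgr) fun z => by
    rw [ev_ofRealFun, Complex.ofReal_ne_zero]
    exact fun h0 => hg0 z z.2 (Complex.ext h0 (hre z z.2).2)
  -- This is `Φₜ` for the parabola `Φ = x - x₀ + (t - t₀)²`: it vanishes at the point and has
  -- `t`-derivative `2`.
  have hσ : AnalyticOnNhd ℝ (fun w : ℝ × ℝ => 2 * (w.2 - z.2)) W := fun w _ =>
    analyticAt_const.mul (analyticAt_snd.sub analyticAt_const)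
  have key := eval_deriv_eq_zero_of_formalSolutions (A := An W) (ev ⟨z, hz⟩ : An W →+* ℂ)
    (X := dx) (Y := dt) (i := iC W) dx_dt (dx.map_algebraMap _) iC_mul_iC hfi hgi
    (σ := ofRealFun _ hσ)
    (by
      rw [dx_ofRealFun]
      exact ext_ev fun z => by
        rw [ev_ofRealFun, Dx_comp_snd (fun t => 2 * (t - _)), map_zero, Complex.ofReal_zero])
    (by
      change ev ⟨z, hz⟩ (ofRealFun _ hσ) = 0
      rw [ev_ofRealFun, sub_self, mul_zero, Complex.ofReal_zero])
    (by
      change ev ⟨z, hz⟩ (dt (ofRealFun _ hσ)) = 2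
      rw [dt_ofRealFun, ev_ofRealFun, Dt_comp_snd (fun t => 2 * (t - z.2))]
      simp)
    (fun τ hτ => by
      rcases hτ with rfl | rfl
      · exact hT.exists_graph_solution hf hg hh hf0 hg0 hz (q := fun _ => 0) analyticOnNhd_const
          rfl fun w => by simp
      · exact hT.exists_graph_solution hf hg hh hf0 hg0 hz (q := fun t => (t - z.2) ^ 2)
          ((analyticOnNhd_id.sub analyticOnNhd_const).pow 2) (by simp) fun w => by
            rw [ev_ofRealFun]; simp)
  have e : ofRealFun _ hfr * ofRealFun _ hgr ^ 2 = ofRealFun _ (hfr.mul (hgr.pow 2)) :=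
    ext_ev fun z => by simp [ev_ofRealFun]
  rw [e, dx_ofRealFun] at key
  exact Complex.ofReal_eq_zero.1 key

theorem PassesPainleveTest.defect_eq_zero (hT : PassesPainleveTest W f g h)
    (hf : AnalyticOnNhd ℝ f W) (hg : AnalyticOnNhd ℝ g W) (hh : AnalyticOnNhd ℝ h W)
    (hf0 : ∀ z ∈ (W : Set (ℝ × ℝ)), f z ≠ 0) (hg0 : ∀ z ∈ (W : Set (ℝ × ℝ)), g z ≠ 0)
    {z : ℝ × ℝ} (hz : z ∈ (W : Set (ℝ × ℝ))) :
    Dx (fun w => (h w).im - Dt (fun w => (g w).re) w / (g w).re) z = 0 ∧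
    defect (fun w => (f w).re * (g w).re ^ 2) (fun w => (g w).re)
      (fun w => (h w).re) (fun w => (h w).im - Dt (fun w => (g w).re) w / (g w).re) z = 0 := by
  have hre := fun z hz => hT.im_eq_zero hf hg hh hf0 hg0 (z := z) hz
  obtain ⟨gi, K, Ki, κ, Gx, Gt, V, V₁, V₂, hC, hCγ, hCdef⟩ :=
    exists_coeffData (analyticOnNhd_re hf) (analyticOnNhd_re hg) (analyticOnNhd_re hh)
      (analyticOnNhd_im hh) (fun z hz h0 => hf0 z hz (Complex.ext h0 (hre z hz).1))
      (fun z hz h0 => hg0 z hz (Complex.ext h0 (hre z hz).2))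
      fun z hz => hT.Dx_eq_zero hf hg hh hf0 hg0 hz
  obtain ⟨u, v, vi, hu, hv, hs⟩ := hT.exists_graph_solution hf hg hh hf0 hg0 hz
    (q := fun _ => 0) analyticOnNhd_const rfl (σ := 0) fun w => by simp
  obtain ⟨h1, h2⟩ := hC.necessary (adapted_one (A := An W) dx_dt (map_zero dx))
    (u₀i := 1) (by rw [hu, one_mul]) hv hs
  have e1 := hCγ ⟨z, hz⟩
  have e2 := hCdef ⟨z, hz⟩
  rw [h1, map_zero] at e1
  rw [h2, map_zero] at e2
  exact ⟨Complex.ofReal_eq_zero.1 e1.symm, Complex.ofReal_eq_zero.1 e2.symm⟩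

end Necessity

end VCNLS

/-! ### Coefficients depending on `t` only, and the main equivalences. -/

namespace VCNLS

open TopologicalSpace Topology

section TimeDependent

theorem Dt_of_eq_comp_snd {U : Set (ℝ × ℝ)} (hU : IsOpen U) {R : ℝ × ℝ → ℝ} (k : ℝ → ℝ)
    (h : ∀ w ∈ U, R w = k w.2) {z : ℝ × ℝ} (hz : z ∈ U) : Dt R z = deriv k z.2 :=
  Dt_congr_on (G := fun w => k w.2) hU h hz

theorem Dx_of_eq_comp_snd {U : Set (ℝ × ℝ)} (hU : IsOpen U) {R : ℝ × ℝ → ℝ} (k : ℝ → ℝ)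
    (h : ∀ w ∈ U, R w = k w.2) {z : ℝ × ℝ} (hz : z ∈ U) : Dx R z = 0 :=
  (Dx_congr_on (G := fun w => k w.2) hU h hz).trans (Dx_comp_snd k z)

variable {I J : Set ℝ} {x₀ : ℝ} {F G K γ β : ℝ → ℝ}

/-- The right side is the coefficient of `(x - x₀)²` in the potential, since `∫ g dx = g (x - x₀)`
and `∫ g (∫ τ₁ dx) dx = g τ₁ (x - x₀)²/2`. Substitute `K = f g²` and `γ = β - g_t/g`. -/
theorem quadCoeff_eq (hJ : IsOpen J) (hF : AnalyticOnNhd ℝ F J) (hG : AnalyticOnNhd ℝ G J)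
    (hβ : AnalyticOnNhd ℝ β J) (hF0 : ∀ t ∈ J, F t ≠ 0) (hG0 : ∀ t ∈ J, G t ≠ 0)
    (hK : ∀ t ∈ J, F t * G t ^ 2 = K t) (hγ : ∀ t ∈ J, β t - deriv G t / G t = γ t)
    {t : ℝ} (ht : t ∈ J) :
    quadCoeff F G β t = tau0 K γ t * G t ^ 2 / 2
      + G t * (-(1 / 2) * deriv (fun s => deriv G s / K s) t) / 2 := by
  have congr : ∀ {P Q : ℝ → ℝ}, (∀ s ∈ J, P s = Q s) → ∀ s ∈ J, deriv P s = deriv Q s :=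
    fun h s hs => Filter.EventuallyEq.deriv_eq (Filter.eventuallyEq_of_mem (hJ.mem_nhds hs) h)
  have dF : ∀ s ∈ J, HasDerivAt F (deriv F s) s := fun s hs =>
    (hF s hs).differentiableAt.hasDerivAt
  have dG : ∀ s ∈ J, HasDerivAt G (deriv G s) s := fun s hs =>
    (hG s hs).differentiableAt.hasDerivAt
  have dF' : HasDerivAt (deriv F) (deriv (deriv F) t) t :=
    (hF t ht).deriv.differentiableAt.hasDerivAt
  have dG' : HasDerivAt (deriv G) (deriv (deriv G) t) t :=
    (hG t ht).deriv.differentiableAt.hasDerivAt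
  have dβ : HasDerivAt β (deriv β t) t := (hβ t ht).differentiableAt.hasDerivAt
  have dK : ∀ s ∈ J, HasDerivAt (fun s => F s * G s ^ 2)
      (deriv F s * G s ^ 2 + F s * (2 * G s * deriv G s)) s := fun s hs => by
    refine ((dF s hs).fun_mul ((dG s hs).fun_pow 2)).congr_deriv ?_
    push_cast
    ring
  have eK : ∀ s ∈ J, deriv K s = deriv F s * G s ^ 2 + F s * (2 * G s * deriv G s) :=
    fun s hs => (congr (fun r hr => (hK r hr).symm) s hs).trans (dK s hs).deriv
  have eF : deriv (logDeriv F) t = (deriv (deriv F) t * F t - deriv F t * deriv F t) / F t ^ 2 :=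
    (dF'.div (dF t ht) (hF0 t ht)).deriv
  have dGG := dG'.fun_div (dG t ht) (hG0 t ht)
  have elK : deriv (logDeriv K) t
      = (deriv (deriv F) t * F t - deriv F t * deriv F t) / F t ^ 2
        + 2 * ((deriv (deriv G) t * G t - deriv G t * deriv G t) / G t ^ 2) := by
    refine (congr (Q := fun s => deriv F s / F s + 2 * (deriv G s / G s)) (fun s hs => ?_) t
      ht).trans ((dF'.fun_div (dF t ht) (hF0 t ht)).fun_add (dGG.const_mul 2)).deriv
    rw [logDeriv_apply, eK s hs, ← hK s hs]
    have h1 := hF0 s hs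
    have h2 := hG0 s hs
    field_simp
  have eγK : deriv (fun s => γ s * K s) t
      = (deriv β t - (deriv (deriv G) t * G t - deriv G t * deriv G t) / G t ^ 2)
          * (F t * G t ^ 2)
        + (β t - deriv G t / G t) * (deriv F t * G t ^ 2 + F t * (2 * G t * deriv G t)) :=
    (congr (fun s hs => by rw [hγ s hs, hK s hs]) t ht).symm.trans
      ((dβ.fun_sub dGG).fun_mul (dK t ht)).deriv
  have eGK : deriv (fun s => deriv G s / K s) t
      = (deriv (deriv G) t * (F t * G t ^ 2)
          - deriv G t * (deriv F t * G t ^ 2 + F t * (2 * G t * deriv G t)))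
        / (F t * G t ^ 2) ^ 2 :=
    (congr (fun s hs => by rw [hK s hs]) t ht).symm.trans
      (dG'.fun_div (dK t ht) (mul_ne_zero (hF0 t ht) (pow_ne_zero 2 (hG0 t ht)))).deriv
  have eGi : deriv (deriv fun s => 1 / G s) t
      = (-deriv (deriv G) t * G t ^ 2 + deriv G t * (2 * G t * deriv G t)) / (G t ^ 2) ^ 2 := by
    refine (congr (Q := fun s => -deriv G s / G s ^ 2) (fun s hs => ?_) t ht).trans ?_
    · simpa only [one_div] using ((dG s hs).fun_inv (hG0 s hs)).deriv
    · refine ((dG'.fun_neg.fun_div ((dG t ht).fun_pow 2) (pow_ne_zero 2 (hG0 t ht))).congr_deriv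
        ?_).deriv
      push_cast
      ring
  rw [quadCoeff, tau0, eF, elK, eγK, eGK, eGi, ← hK t ht, ← hγ t ht, logDeriv_apply, logDeriv_apply]
  have h1 := hF0 t ht
  have h2 := hG0 t ht
  field_simp
  ring

theorem intX_eq_of_const (hI' : I.OrdConnected) (hx₀ : x₀ ∈ I) {R : ℝ × ℝ → ℝ} {t c : ℝ}
    (h : ∀ x ∈ I, R (x, t) = c) {x : ℝ} (hx : x ∈ I) : intX x₀ R (x, t) = c * (x - x₀) := by
  rw [intX, intervalIntegral.integral_congr (g := fun _ => c)
    fun s hs => h s (hI'.uIcc_subset hx₀ hx hs), intervalIntegral.integral_const, smul_eq_mul,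
    mul_comm]

theorem intX_eq_of_linear (hI' : I.OrdConnected) (hx₀ : x₀ ∈ I) {R : ℝ × ℝ → ℝ} {t c : ℝ}
    (h : ∀ x ∈ I, R (x, t) = c * (x - x₀)) {x : ℝ} (hx : x ∈ I) :
    intX x₀ R (x, t) = c / 2 * (x - x₀) ^ 2 := by
  rw [intX, intervalIntegral.integral_congr (g := fun s => c * (s - x₀))
    fun s hs => h s (hI'.uIcc_subset hx₀ hx hs), intervalIntegral.integral_const_mul,
    intervalIntegral.integral_comp_sub_right (fun s => s), integral_id]
  ring

theorem potential_eq_of_time_dependent (hI : IsOpen I) (hI' : I.OrdConnected) (hJ : IsOpen J)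
    (hx₀ : x₀ ∈ I) {g : ℝ × ℝ → ℝ} (hg : ∀ z ∈ I ×ˢ J, g z = G z.2)
    (hF : AnalyticOnNhd ℝ F J) (hG : AnalyticOnNhd ℝ G J)
    (hβ : AnalyticOnNhd ℝ β J) (hF0 : ∀ t ∈ J, F t ≠ 0) (hG0 : ∀ t ∈ J, G t ≠ 0)
    (hK : ∀ t ∈ J, F t * G t ^ 2 = K t) (hγ : ∀ t ∈ J, β t - deriv G t / G t = γ t)
    (δ₀ δ₁ : ℝ → ℝ) {z : ℝ × ℝ} (hz : z ∈ I ×ˢ J) :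
    potential x₀ g K γ δ₀ δ₁ z = quadCoeff F G β z.2 * (z.1 - x₀) ^ 2
      + δ₀ z.2 * (G z.2 * (z.1 - x₀)) + δ₁ z.2 := by
  obtain ⟨x, t⟩ := z
  obtain ⟨hx, ht⟩ : x ∈ I ∧ t ∈ J := hz
  have hU : IsOpen (I ×ˢ J) := hI.prod hJ
  have hDt : ∀ w ∈ I ×ˢ J, Dt g w = deriv G w.2 := fun w hw =>
    Dt_of_eq_comp_snd hU G hg hw
  have hDx : ∀ w ∈ I ×ˢ J, Dx g w = 0 := fun w hw =>
    Dx_of_eq_comp_snd hU G hg hw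
  have hDxx : ∀ w ∈ I ×ˢ J, Dx (Dx g) w = 0 := fun w hw =>
    Dx_of_eq_comp_snd hU (fun _ => 0) hDx hw
  have hτ : ∀ y ∈ I, tau1 K g (y, t) = -(1 / 2) * deriv (fun s => deriv G s / K s) t :=
    fun y hy => by
      rw [tau1, Dt_of_eq_comp_snd hU (fun s => deriv G s / K s)
        (fun w hw => by rw [hDt w hw]) ⟨hy, ht⟩]
  have h1 := intX_eq_of_const hI' hx₀ (R := g) (t := t) (c := G t)
    (fun y hy => hg (y, t) ⟨hy, ht⟩) hx
  have h2 := intX_eq_of_linear hI' hx₀ (R := fun w => g w * intX x₀ (tau1 K g) w) (t := t)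
    (c := G t * (-(1 / 2) * deriv (fun s => deriv G s / K s) t)) (fun y hy => by
      rw [hg (y, t) ⟨hy, ht⟩, intX_eq_of_const hI' hx₀ hτ hy]; ring) hx
  rw [potential, h1, h2, hDx _ ⟨hx, ht⟩, hDxx _ ⟨hx, ht⟩,
    quadCoeff_eq hJ hF hG hβ hF0 hG0 hK hγ ht]
  ring

end TimeDependent

section Main

variable {I J : Set ℝ} {x₀ : ℝ} {f g h : ℝ × ℝ → ℂ}

theorem eq_of_Dx_eq_zero (hI : IsOpen I) (hI' : I.OrdConnected) (hx₀ : x₀ ∈ I) {R : ℝ × ℝ → ℝ}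
    (hR : AnalyticOnNhd ℝ R (I ×ˢ J)) (h : ∀ z ∈ I ×ˢ J, Dx R z = 0) {z : ℝ × ℝ}
    (hz : z ∈ I ×ˢ J) : R z = R (x₀, z.2) := by
  have hd : ∀ x ∈ I, HasDerivAt (fun x => R (x, z.2)) 0 x := fun x hx => by
    have := hasDerivAt_Dx (hR (x, z.2) ⟨hx, hz.2⟩).differentiableAt
    rwa [h (x, z.2) ⟨hx, hz.2⟩] at this
  exact hI.is_const_of_deriv_eq_zero hI'.isPreconnected
    (fun x hx => (hd x hx).differentiableAt.differentiableWithinAt)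
    (fun x hx => (hd x hx).deriv) hz.1 hx₀

theorem passesPainleveTest_iff (hI : IsOpen I) (hI' : I.OrdConnected) (hJ : IsOpen J)
    (hx₀ : x₀ ∈ I) (hf : AnalyticOnNhd ℝ f (I ×ˢ J)) (hg : AnalyticOnNhd ℝ g (I ×ˢ J))
    (hh : AnalyticOnNhd ℝ h (I ×ˢ J)) (hf0 : ∀ z ∈ I ×ˢ J, f z ≠ 0)
    (hg0 : ∀ z ∈ I ×ˢ J, g z ≠ 0) :
    PassesPainleveTest (I ×ˢ J) f g h ↔
      (∀ z ∈ I ×ˢ J, (f z).im = 0 ∧ (g z).im = 0) ∧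
      ∃ K γ δ₀ δ₁ : ℝ → ℝ, ∀ z ∈ I ×ˢ J,
        (f z).re * (g z).re ^ 2 = K z.2 ∧
        (h z).im = Dt (fun w => (g w).re) z / (g z).re + γ z.2 ∧
        (h z).re = potential x₀ (fun w => (g w).re) K γ δ₀ δ₁ z := by
  have hU : IsOpen (I ×ˢ J) := hI.prod hJ
  have hfr := analyticOnNhd_re hf
  have hgr := analyticOnNhd_re hg
  have hnz : (∀ z ∈ I ×ˢ J, (f z).im = 0 ∧ (g z).im = 0) →
      (∀ z ∈ I ×ˢ J, (f z).re ≠ 0) ∧ ∀ z ∈ I ×ˢ J, (g z).re ≠ 0 := fun hre =>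
    ⟨fun z hz h0 => hf0 z hz (Complex.ext h0 (hre z hz).1),
      fun z hz h0 => hg0 z hz (Complex.ext h0 (hre z hz).2)⟩
  constructor
  · intro hT
    have hT' : PassesPainleveTest ((⟨I ×ˢ J, hU⟩ : Opens (ℝ × ℝ)) : Set (ℝ × ℝ)) f g h := hT
    have hre : ∀ z ∈ I ×ˢ J, (f z).im = 0 ∧ (g z).im = 0 := fun z hz =>
      hT'.im_eq_zero hf hg hh hf0 hg0 hz
    obtain ⟨hfr0, hgr0⟩ := hnz hre
    -- Functions with vanishing `x`-derivative equal their values along `x = x₀`, since `I` is an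
    -- interval.
    let K : ℝ → ℝ := fun t => (f (x₀, t)).re * (g (x₀, t)).re ^ 2
    let γ : ℝ → ℝ := fun t => (h (x₀, t)).im - Dt (fun w => (g w).re) (x₀, t) / (g (x₀, t)).re
    have hK : ∀ z ∈ I ×ˢ J, (f z).re * (g z).re ^ 2 = K z.2 := fun z hz =>
      eq_of_Dx_eq_zero hI hI' hx₀ (hfr.mul (hgr.pow 2))
        (fun z hz => hT'.Dx_eq_zero hf hg hh hf0 hg0 hz) hz
    have hγ : ∀ z ∈ I ×ˢ J, (h z).im - Dt (fun w => (g w).re) z / (g z).re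
        = γ z.2 :=
      fun z hz => eq_of_Dx_eq_zero hI hI' hx₀
        ((analyticOnNhd_im hh).sub (analyticOnNhd_Dt_div hgr hgr0 hgr))
        (fun z hz => (hT'.defect_eq_zero hf hg hh hf0 hg0 hz).1) hz
    obtain ⟨δ₀, δ₁, hδ⟩ := (exists_potential_iff hI hI' hJ hx₀ hfr hgr (analyticOnNhd_re hh)
      (analyticOnNhd_im hh) hfr0 hgr0 hK (γ := γ) hγ).2 fun z hz =>
        (hT'.defect_eq_zero hf hg hh hf0 hg0 hz).2
    exact ⟨hre, K, γ, δ₀, δ₁, fun z hz => ⟨hK z hz, eq_add_of_sub_eq' (hγ z hz), hδ z hz⟩⟩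
  · rintro ⟨hre, K, γ, δ₀, δ₁, H⟩
    obtain ⟨hfr0, hgr0⟩ := hnz hre
    have hγ : ∀ z ∈ I ×ˢ J, (h z).im - Dt (fun w => (g w).re) z / (g z).re = γ z.2 :=
      fun z hz => sub_eq_of_eq_add' (H z hz).2.1
    exact passesPainleveTest_of_real hf hg hh hf0 hg0 hre
      (fun z hz => by rw [Dx_congr_on hU (fun w hw => (H w hw).1) hz, Dx_comp_snd])
      (fun z hz => by rw [Dx_congr_on hU hγ hz, Dx_comp_snd])
      ((exists_potential_iff hI hI' hJ hx₀ hfr hgr (analyticOnNhd_re hh)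
        (analyticOnNhd_im hh) hfr0 hgr0 (fun z hz => (H z hz).1) hγ).1
        ⟨δ₀, δ₁, fun z hz => (H z hz).2.2⟩)

theorem passesPainleveTest_iff_of_time_dependent (hI : IsOpen I) (hI' : I.OrdConnected)
    (hJ : IsOpen J) (hx₀ : x₀ ∈ I) (hf : AnalyticOnNhd ℝ f (I ×ˢ J))
    (hg : AnalyticOnNhd ℝ g (I ×ˢ J)) (hh : AnalyticOnNhd ℝ h (I ×ˢ J))
    (hf0 : ∀ z ∈ I ×ˢ J, f z ≠ 0) (hg0 : ∀ z ∈ I ×ˢ J, g z ≠ 0) {F G : ℝ → ℂ}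
    (hFG : ∀ z ∈ I ×ˢ J, f z = F z.2 ∧ g z = G z.2) :
    PassesPainleveTest (I ×ˢ J) f g h ↔
      (∀ t ∈ J, (F t).im = 0 ∧ (G t).im = 0) ∧
      ∃ β H₁ H₂ : ℝ → ℝ, ∀ z ∈ I ×ˢ J,
        (h z).im = β z.2 ∧
        (h z).re = quadCoeff (fun t => (F t).re) (fun t => (G t).re) β z.2 * z.1 ^ 2
          + H₁ z.2 * z.1 + H₂ z.2 := by
  have hU : IsOpen (I ×ˢ J) := hI.prod hJ
  have hgG : ∀ z ∈ I ×ˢ J, (g z).re = (fun t => (G t).re) z.2 := fun z hz => by rw [(hFG z hz).2]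
  have hDt : ∀ z ∈ I ×ˢ J, Dt (fun w => (g w).re) z / (g z).re
      = deriv (fun t => (G t).re) z.2 / (G z.2).re := fun z hz => by
    rw [Dt_of_eq_comp_snd hU (fun t => (G t).re) hgG hz, hgG z hz]
  have slice : ∀ {R : ℝ × ℝ → ℝ} {k : ℝ → ℝ}, AnalyticOnNhd ℝ R (I ×ˢ J) →
      (∀ z ∈ I ×ˢ J, R z = k z.2) → AnalyticOnNhd ℝ k J := fun {R k} hR hk t ht =>
    (AnalyticAt.comp (f := fun s : ℝ => (x₀, s)) (hR (x₀, t) ⟨hx₀, ht⟩)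
      (analyticAt_const.prod analyticAt_id)).congr
      (Filter.eventuallyEq_of_mem (hJ.mem_nhds ht) fun s hs => hk (x₀, s) ⟨hx₀, hs⟩)
  have hF' := slice (k := fun t => (F t).re) (analyticOnNhd_re hf) fun z hz => by
    rw [(hFG z hz).1]
  have hG' := slice (k := fun t => (G t).re) (analyticOnNhd_re hg) hgG
  have him : (∀ z ∈ I ×ˢ J, (f z).im = 0 ∧ (g z).im = 0) ↔
      ∀ t ∈ J, (F t).im = 0 ∧ (G t).im = 0 :=
    ⟨fun H t ht => by
      have := H (x₀, t) ⟨hx₀, ht⟩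
      rwa [(hFG (x₀, t) ⟨hx₀, ht⟩).1, (hFG (x₀, t) ⟨hx₀, ht⟩).2] at this,
     fun H z hz => by rw [(hFG z hz).1, (hFG z hz).2]; exact H z.2 hz.2⟩
  rw [passesPainleveTest_iff hI hI' hJ hx₀ hf hg hh hf0 hg0, him]
  refine and_congr_right fun hre => ?_
  have hF0 : ∀ t ∈ J, (F t).re ≠ 0 := fun t ht h0 => hf0 (x₀, t) ⟨hx₀, ht⟩
    ((hFG (x₀, t) ⟨hx₀, ht⟩).1.trans (Complex.ext h0 (hre t ht).1))
  have hG0 : ∀ t ∈ J, (G t).re ≠ 0 := fun t ht h0 => hg0 (x₀, t) ⟨hx₀, ht⟩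
    ((hFG (x₀, t) ⟨hx₀, ht⟩).2.trans (Complex.ext h0 (hre t ht).2))
  have hpot := fun {β K γ : ℝ → ℝ} (hβ : AnalyticOnNhd ℝ β J) hK hγ =>
    potential_eq_of_time_dependent (K := K) (γ := γ) hI hI' hJ hx₀ hgG hF' hG' hβ hF0 hG0 hK hγ
  constructor
  · rintro ⟨K, γ, δ₀, δ₁, H⟩
    have hβ : ∀ z ∈ I ×ˢ J, (h z).im
        = (fun t => deriv (fun t => (G t).re) t / (G t).re + γ t) z.2 := fun z hz => by
      rw [(H z hz).2.1, hDt z hz]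
    have hK : ∀ t ∈ J, (F t).re * (G t).re ^ 2 = K t := fun t ht => by
      have := (H (x₀, t) ⟨hx₀, ht⟩).1
      rwa [(hFG (x₀, t) ⟨hx₀, ht⟩).1, (hFG (x₀, t) ⟨hx₀, ht⟩).2] at this
    have e := fun z hz => hpot (γ := γ)
      (slice (k := fun t => deriv (fun t => (G t).re) t / (G t).re + γ t)
        (analyticOnNhd_im hh) hβ) hK
      (fun t _ => by ring) δ₀ δ₁ (z := z) hz
    generalize (fun t => deriv (fun t => (G t).re) t / (G t).re + γ t) = β at hβ e
    -- Expand `(x - x₀)²` and collect powers of `x`.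
    refine ⟨β, fun t => δ₀ t * (G t).re
        - 2 * x₀ * quadCoeff (fun t => (F t).re) (fun t => (G t).re) β t,
      fun t => quadCoeff (fun t => (F t).re) (fun t => (G t).re) β t * x₀ ^ 2
        - δ₀ t * (G t).re * x₀ + δ₁ t, fun z hz => ⟨hβ z hz, ?_⟩⟩
    rw [(H z hz).2.2, e z hz]
    ring
  · rintro ⟨β, H₁, H₂, H⟩
    -- Recentre the polynomial at `x₀`; the division by `g` occurs because `δ₀` multiplies `g (x -
    -- x₀)`.
    refine ⟨fun t => (F t).re * (G t).re ^ 2, fun t => β t - deriv (fun t => (G t).re) t / (G t).re,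
      fun t => (H₁ t + 2 * x₀ * quadCoeff (fun t => (F t).re) (fun t => (G t).re) β t) / (G t).re,
      fun t => quadCoeff (fun t => (F t).re) (fun t => (G t).re) β t * x₀ ^ 2
        + H₁ t * x₀ + H₂ t, fun z hz => ⟨?_, ?_, ?_⟩⟩
    · rw [(hFG z hz).1, (hFG z hz).2]
    · rw [hDt z hz, (H z hz).1]; ring
    · rw [hpot (slice (analyticOnNhd_im hh) fun z hz => (H z hz).1) (fun _ _ => rfl)
        (fun _ _ => rfl) _ _ hz, (H z hz).2]
      have := hG0 z.2 hz.2
      field_simp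
      ring

end Main

end VCNLS

end

theorem mainTheorem1 (I J : Set ℝ) (hI : IsOpen I) (hI' : I.OrdConnected)
    (hJ : IsOpen J) (hJ' : J.OrdConnected) (hJne : J.Nonempty) (x₀ : ℝ) (hx₀ : x₀ ∈ I)
    (f g h : ℝ × ℝ → ℂ)
    (hf : AnalyticOnNhd ℝ f (I ×ˢ J)) (hg : AnalyticOnNhd ℝ g (I ×ˢ J))
    (hh : AnalyticOnNhd ℝ h (I ×ˢ J))
    (hf0 : ∀ z ∈ I ×ˢ J, f z ≠ 0) (hg0 : ∀ z ∈ I ×ˢ J, g z ≠ 0) :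
    (VCNLS.PassesPainleveTest (I ×ˢ J) f g h ↔
      (∀ z ∈ I ×ˢ J, (f z).im = 0 ∧ (g z).im = 0) ∧
      ∃ K γ δ₀ δ₁ : ℝ → ℝ, ∀ z ∈ I ×ˢ J,
        (f z).re * (g z).re ^ 2 = K z.2 ∧
        (h z).im = VCNLS.Dt (fun w => (g w).re) z / (g z).re + γ z.2 ∧
        (h z).re = VCNLS.potential x₀ (fun w => (g w).re) K γ δ₀ δ₁ z) ∧
    ((∀ z ∈ I ×ˢ J, (f z).re = 0 ∧ (g z).re = 0) →
      ¬ VCNLS.PassesPainleveTest (I ×ˢ J) f g h) ∧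
    (∀ F G : ℝ → ℂ, (∀ z ∈ I ×ˢ J, f z = F z.2 ∧ g z = G z.2) →
      (VCNLS.PassesPainleveTest (I ×ˢ J) f g h ↔
        (∀ t ∈ J, (F t).im = 0 ∧ (G t).im = 0) ∧
        ∃ β H₁ H₂ : ℝ → ℝ, ∀ z ∈ I ×ˢ J,
          (h z).im = β z.2 ∧
          (h z).re = VCNLS.quadCoeff (fun t => (F t).re) (fun t => (G t).re) β z.2 * z.1 ^ 2
            + H₁ z.2 * z.1 + H₂ z.2)) := by
  have key := VCNLS.passesPainleveTest_iff hI hI' hJ hx₀ hf hg hh hf0 hg0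
  refine ⟨key, fun him hT => ?_, fun F G hFG =>
    VCNLS.passesPainleveTest_iff_of_time_dependent hI hI' hJ hx₀ hf hg hh hf0 hg0 hFG⟩
  -- At any one point `f` would be both real and purely imaginary, hence zero.
  obtain ⟨t₀, ht₀⟩ := hJne
  have hz : (x₀, t₀) ∈ I ×ˢ J := ⟨hx₀, ht₀⟩
  exact hf0 _ hz (Complex.ext (him _ hz).1 ((key.1 hT).1 _ hz).1)
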